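/- Let $(\Omega,\mathcal F,\mathbb P)$ be a complete probability space, $\vartheta:\Omega\to\Omega$ a measurable $\mathbb P$-preserving map, and $X,Y$ compact metric spaces with Borel $\sigma$-algebras $\mathcal B,\mathcal C$. A *continuous bundle RDS* $T$ on a measurable set $\mathcal E\subset\Omega\times X$ with compact fibers $\mathcal E_\omega$ is a family of maps $T_\omega:\mathcal E_\omega\to\mathcal E_{\vartheta\omega}$ such that $(\omega,x)\mapsto T_\omega x$ is measurable and $T_\omega$ is continuous for $\mathbb P$-a.e. $\omega$; its skew product is $\Theta(\omega,x)=(\vartheta\omega,T_\omega x)$. Let $T$ on $\mathcal E\subset\Omega\times X$ and $S$ on $\mathcal G\subset\Omega\times Y$ be continuous bundle RDSs over $(\Omega,\mathcal F,\mathbb P,\vartheta)$, let $S\times T$ be the continuous bundle RDS on $\mathcal H=\{(\omega,y,x):y\in\mathcal G_\omega,\ x\in\mathcal E_\omega\}$ with skew product $\Gamma(\omega,y,x)=(\vartheta\omega,S_\omega y,T_\omega x)$, and let $\mathcal D_{\mathcal H}$ be the $\sigma$-algebra on $\mathcal H$ pulled back from $(\mathcal F\times\mathcal C)|_{\mathcal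 G}$ by $(\omega,y,x)\mapsto(\omega,y)$. Let $\mathcal I_{\mathbb P}(\mathcal H)$ be the set of $\Gamma$-invariant probability measures on $\mathcal H$ with marginal $\mathbb P$ on $\Omega$, with the narrow topology, i.e. the coarsest topology for which $\mu\mapsto\int f\,d\mu$ is continuous for every measurable $f:\mathcal H\to\mathbb R$ that is continuous on a.e. fiber and satisfies $|f(\omega,y,x)|\le g(\omega)$ for some $\mathbb P$-integrable $g$. *Relative entropy.* For $\mu\in\mathcal I_{\mathbb P}(\mathcal H)$ and a finite or countable measurable partition $\mathcal R=\{R_i\}$ of $\mathcal H$ put $H_\mu(\mathcal R\mid\mathcal D_{\mathcal H})=-\int\sum_iE_\mu(1_{R_i}\mid\mathcal D_{\mathcal H})\log E_\mu(1_{R_i}\mid\mathcal D_{\mathcal H})\,d\mu$, $h_\mu(\mathcal R\mid\mathcal D_{\mathcal H})=\lim_n\frac1nH_\mu(\bigvee_{i=0}^{n-1}\Gamma^{-i}\mathcal R\mid\mathcal D_{\mathcal H})$, and $h_\mu(\Gamma\mid\mathcal D_{\mathcal H})=\sup_{\mathcal R}h_\mu(\mathcal R\mid\mathcal D_{\mathcal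 H})$ over all such $\mathcal R$ with $H_\mu(\mathcal R\mid\mathcal D_{\mathcal H})<\infty$. The defect of upper semi-continuity at $m\in\mathcal I_{\mathbb P}(\mathcal H)$ is $h^*_m(\Gamma\mid\mathcal D_{\mathcal H})=\limsup_{\mu\to m}h_\mu(\Gamma\mid\mathcal D_{\mathcal H})-h_m(\Gamma\mid\mathcal D_{\mathcal H})$ if $h_m(\Gamma\mid\mathcal D_{\mathcal H})<\infty$, and $\infty$ otherwise. *Relative tail entropy.* An open random cover of $\mathcal E$ is a finite family $\mathcal U=\{U_1,\dots,U_k\}$ of measurable subsets of $\mathcal E$ with union $\mathcal E$ such that $U_j(\omega)=\{x:(\omega,x)\in U_j\}$ is open in $\mathcal E_\omega$ for a.e. $\omega$ and all $j$; put $\mathcal U^{(n)}=\bigvee_{i=0}^{n-1}\Theta^{-i}\mathcal U$. For covers $\mathcal R,\mathcal Q$ let $N(\mathcal R\mid\mathcal Q)(\omega)=\max_{Q\in\mathcal Q}N(Q,\mathcal R)(\omega)$, where $N(Q,\mathcal R)(\omega)$ is the least number of members of $\mathcal R$ whose sections over $\omega$ cover $Q(\omega)$ ($1$ if $Q(\omega)=\emptyset$).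 Put $h_\Theta(\mathcal R\mid\mathcal Q)=\lim_n\frac1n\int\log N(\mathcal R^{(n)}\mid\mathcal Q^{(n)})(\omega)\,d\mathbb P(\omega)$ and $h^*(\Theta)=\inf_{\mathcal Q}\sup_{\mathcal R}h_\Theta(\mathcal R\mid\mathcal Q)$, with $\mathcal Q$ and $\mathcal R$ ranging over the open random covers of $\mathcal E$. **Theorem.** For every $m\in\mathcal I_{\mathbb P}(\mathcal H)$, $\;h^*_m(\Gamma\mid\mathcal D_{\mathcal H})\le h^*(\Theta)$ (in $[0,\infty]$). -/

import Mathlib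

open MeasureTheory Filter Topology
open scoped ENNReal ProbabilityTheory

namespace RandomBundle

noncomputable section

/-- A continuous bundle random dynamical system over `(Ω, P, θ)` with fibers in `X`: a measurable
set `carrier ⊆ Ω × X` with compact fibers and maps between the fibers over `ω` and `θ ω`,
jointly measurable, and continuous for almost every `ω`. -/
structure BundleRDS {Ω : Type*} [MeasurableSpace Ω] (P : Measure Ω) (θ : Ω → Ω)
    (X : Type*) [TopologicalSpace X] [MeasurableSpace X] where
  carrier : Set (Ω × X)
  measurableSet_carrier : MeasurableSet carrier
  isCompact_fiber : ∀ ω, IsCompact {x : X | (ω, x) ∈ carrier}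
  fiberMap : ∀ ω, {x : X // (ω, x) ∈ carrier} → {x : X // (θ ω, x) ∈ carrier}
  measurable_fiberMap : Measurable fun p : carrier => (fiberMap p.1.1 ⟨p.1.2, p.2⟩ : X)
  continuous_fiberMap : ∀ᵐ ω ∂P, Continuous (fiberMap ω)

variable {Ω : Type*} [MeasurableSpace Ω] {P : Measure Ω} {θ : Ω → Ω}
  {X : Type*} [TopologicalSpace X] [MeasurableSpace X]
  {Y : Type*} [TopologicalSpace Y] [MeasurableSpace Y]

namespace BundleRDS

/-- The fiber over `ω`, with the topology induced from `X`. -/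
abbrev Fiber (T : BundleRDS P θ X) (ω : Ω) : Type _ := {x : X // (ω, x) ∈ T.carrier}

/-- The inclusion of the fiber over `ω` into the bundle. -/
def incl (T : BundleRDS P θ X) (ω : Ω) (x : T.Fiber ω) : T.carrier := ⟨(ω, x.1), x.2⟩

/-- The skew product transformation `(ω, x) ↦ (θ ω, T_ω x)` of the bundle. -/
def skew (T : BundleRDS P θ X) (p : T.carrier) : T.carrier :=
  ⟨(θ p.1.1, (T.fiberMap p.1.1 ⟨p.1.2, p.2⟩).1), (T.fiberMap p.1.1 ⟨p.1.2, p.2⟩).2⟩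

/-- The product system `S × T` on `{(ω, y, x) : y ∈ G_ω, x ∈ E_ω}`, acting by
`(ω, y, x) ↦ (θ ω, S_ω y, T_ω x)`. -/
def prod (S : BundleRDS P θ Y) (T : BundleRDS P θ X) : BundleRDS P θ (Y × X) where
  carrier := {p | (p.1, p.2.1) ∈ S.carrier ∧ (p.1, p.2.2) ∈ T.carrier}
  measurableSet_carrier := by
    refine MeasurableSet.inter ?_ ?_
    · exact (measurable_fst.prodMk (measurable_fst.comp measurable_snd)) S.measurableSet_carrier
    · exact (measurable_fst.prodMk (measurable_snd.comp measurable_snd)) T.measurableSet_carrier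
  isCompact_fiber ω := (S.isCompact_fiber ω).prod (T.isCompact_fiber ω)
  fiberMap ω z :=
    ⟨((S.fiberMap ω ⟨z.1.1, z.2.1⟩).1, (T.fiberMap ω ⟨z.1.2, z.2.2⟩).1),
      (S.fiberMap ω ⟨z.1.1, z.2.1⟩).2, (T.fiberMap ω ⟨z.1.2, z.2.2⟩).2⟩
  measurable_fiberMap := by
    refine Measurable.prodMk ?_ ?_
    · exact S.measurable_fiberMap.comp
        (g := fun p : S.carrier => (S.fiberMap p.1.1 ⟨p.1.2, p.2⟩ : Y))
        (f := fun p : {p : Ω × Y × X | (p.1, p.2.1) ∈ S.carrier ∧ (p.1, p.2.2) ∈ T.carrier} =>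
          (⟨(p.1.1, p.1.2.1), p.2.1⟩ : S.carrier))
        (Measurable.subtype_mk (by fun_prop))
    · exact T.measurable_fiberMap.comp
        (g := fun p : T.carrier => (T.fiberMap p.1.1 ⟨p.1.2, p.2⟩ : X))
        (f := fun p : {p : Ω × Y × X | (p.1, p.2.1) ∈ S.carrier ∧ (p.1, p.2.2) ∈ T.carrier} =>
          (⟨(p.1.1, p.1.2.2), p.2.2⟩ : T.carrier))
        (Measurable.subtype_mk (by fun_prop))
  continuous_fiberMap := by
    filter_upwards [S.continuous_fiberMap, T.continuous_fiberMap] with ω hS hT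
    refine Continuous.subtype_mk (Continuous.prodMk ?_ ?_) _
    · exact continuous_subtype_val.comp (hS.comp (Continuous.subtype_mk (by fun_prop) _))
    · exact continuous_subtype_val.comp (hT.comp (Continuous.subtype_mk (by fun_prop) _))

/-- The projection `(ω, y, x) ↦ (ω, y)` of the product bundle onto the bundle of `S`. -/
def projLeft (S : BundleRDS P θ Y) (T : BundleRDS P θ X) (p : (S.prod T).carrier) : S.carrier :=
  ⟨(p.1.1, p.1.2.1), p.2.1⟩

/-- The σ-algebra on the product bundle pulled back from the bundle of `S`. -/
@[reducible]
def leftSigma (S : BundleRDS P θ Y) (T : BundleRDS P θ X) : MeasurableSpace (S.prod T).carrier :=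
  MeasurableSpace.comap (projLeft S T) inferInstance

/-! ### Invariant measures and the narrow topology -/

/-- Measures on the bundle with marginal `P` on `Ω` that are invariant under the skew product. -/
structure InvMeasure (T : BundleRDS P θ X) where
  toMeasure : Measure T.carrier
  marginal : toMeasure.map (fun p => p.1.1) = P
  invariant : MeasurePreserving T.skew toMeasure toMeasure

/-- Random continuous functions on the bundle: measurable, continuous on almost every fiber, with
integrable fiberwise supremum. -/
structure IsRandomContinuous (T : BundleRDS P θ X) (f : T.carrier → ℝ) : Prop where
  measurable : Measurable f
  continuous_fiber : ∀ᵐ ω ∂P, Continuous fun x : T.Fiber ω => f (T.incl ω x)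
  dominated : ∃ g : Ω → ℝ, Integrable g P ∧ ∀ p : T.carrier, |f p| ≤ g p.1.1

/-- The narrow topology: the coarsest one making `μ ↦ ∫ f dμ` continuous for all random
continuous `f`. -/
instance (T : BundleRDS P θ X) : TopologicalSpace T.InvMeasure :=
  ⨅ f : {f : T.carrier → ℝ // T.IsRandomContinuous f},
    TopologicalSpace.induced (fun μ : T.InvMeasure => ∫ p, f.1 p ∂μ.toMeasure) inferInstance

end BundleRDS

/-! ### Relative entropy

A finite or countable measurable partition is given by a measurable labelling `ξ : α → ι` with `ι`
countable; its elements are the sets `ξ ⁻¹' {i}` (empty ones contribute nothing). -/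

/-- `H_μ(ξ | 𝒮) = -∫ ∑ᵢ E(1_{Rᵢ} | 𝒮) log E(1_{Rᵢ} | 𝒮) dμ`. -/
def condEntropy {α ι : Type*} (𝒮 : MeasurableSpace α) {mα : MeasurableSpace α} (μ : Measure α)
    (ξ : α → ι) : ℝ≥0∞ :=
  ∫⁻ a, ∑' i, ENNReal.ofReal (Real.negMulLog ((μ⟦ξ ⁻¹' {i} | 𝒮⟧) a)) ∂μ

/-- The labelling of the partition `⋁_{i < n} f⁻ⁱ ξ`. -/
def itinerary {α ι : Type*} (f : α → α) (ξ : α → ι) (n : ℕ) : α → Fin n → ι :=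
  fun a i => ξ (f^[i] a)

/-- `h_μ(ξ | 𝒮) = lim (1/n) H_μ(ξ⁽ⁿ⁾ | 𝒮)` for a `μ`-preserving `f`; when `f⁻¹ 𝒮 ⊆ 𝒮`, the sequence
is subadditive, so that the upper limit is a limit. -/
def partitionEntropy {α ι : Type*} (𝒮 : MeasurableSpace α) {mα : MeasurableSpace α}
    (μ : Measure α) (f : α → α) (ξ : α → ι) : ℝ≥0∞ :=
  limsup (fun n : ℕ => condEntropy 𝒮 μ (itinerary f ξ n) / n) atTop

/-- The relative entropy `h_μ(f | 𝒮)`: supremum over all finite or countable partitions, measurable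
for the full σ-algebra `mα`, with finite conditional entropy. -/
def systemEntropy {α : Type*} (𝒮 : MeasurableSpace α) {mα : MeasurableSpace α}
    (μ : Measure α) (f : α → α) : ℝ≥0∞ :=
  ⨆ (ξ : α → ℕ) (_ : Measurable[mα] ξ) (_ : condEntropy 𝒮 μ ξ < ∞), partitionEntropy 𝒮 μ f ξ

namespace BundleRDS

/-- The relative entropy of the skew product given `𝒮`. -/
def relEntropy (T : BundleRDS P θ X) (𝒮 : MeasurableSpace T.carrier) (μ : T.InvMeasure) : ℝ≥0∞ :=
  systemEntropy 𝒮 μ.toMeasure T.skew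

open Classical in
/-- The defect of upper semi-continuity of the relative entropy at `m`. -/
def entropyDefect (T : BundleRDS P θ X) (𝒮 : MeasurableSpace T.carrier) (m : T.InvMeasure) :
    ℝ≥0∞ :=
  if T.relEntropy 𝒮 m < ∞ then limsup (fun μ => T.relEntropy 𝒮 μ) (𝓝 m) - T.relEntropy 𝒮 m else ∞

/-! ### Open random covers and relative tail entropy -/

/-- The section of a subset of the bundle over `ω`. -/
def sect (T : BundleRDS P θ X) (A : Set T.carrier) (ω : Ω) : Set (T.Fiber ω) := T.incl ω ⁻¹' A

/-- Closed random subsets of the bundle: measurable graph, almost every section closed in the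
fiber, and measurable as a set-valued map. (For complete `P` and compact metric `X` the last
condition follows from the first by the projection theorem.) -/
structure IsClosedRandomSet (T : BundleRDS P θ X) (C : Set T.carrier) : Prop where
  measurableSet : MeasurableSet C
  isClosed_sect : ∀ᵐ ω ∂P, IsClosed (T.sect C ω)
  measurableSet_hit : ∀ O : Set X, IsOpen O → MeasurableSet {ω | ∃ x ∈ T.sect C ω, x.1 ∈ O}

/-- A finite open random cover of the bundle, as an indexed family: each complement is a closed
random set. -/
structure IsOpenRandomCover (T : BundleRDS P θ X) {k : ℕ} (U : Fin k → Set T.carrier) : Prop where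
  isClosedRandomSet_compl : ∀ j, T.IsClosedRandomSet (U j)ᶜ
  cover : ⋃ j, U j = Set.univ

/-- The cover `⋁_{i < n} Θ⁻ⁱ U`. -/
def iterCover (T : BundleRDS P θ X) {k : ℕ} (U : Fin k → Set T.carrier) (n : ℕ)
    (a : Fin n → Fin k) : Set T.carrier :=
  ⋂ i : Fin n, T.skew^[i] ⁻¹' U (a i)

open Classical in
/-- `N(A, 𝓡)(ω)`: the least number of members of the family `R` whose sections over `ω` cover the
section of `A`; by convention `1` if that section is empty. -/
def coverNumber (T : BundleRDS P θ X) {ι : Type*} (A : Set T.carrier) (R : ι → Set T.carrier)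
    (ω : Ω) : ℕ :=
  if (T.sect A ω).Nonempty then
    sInf {c : ℕ | ∃ J : Finset ι, J.card = c ∧ T.sect A ω ⊆ ⋃ j ∈ J, T.sect (R j) ω}
  else 1

/-- `N(𝓡 | 𝓠)(ω) = max_{Q ∈ 𝓠} N(Q, 𝓡)(ω)`. -/
def condCoverNumber (T : BundleRDS P θ X) {ι κ : Type*} [Fintype κ] (R : ι → Set T.carrier)
    (Q : κ → Set T.carrier) (ω : Ω) : ℕ :=
  Finset.univ.sup fun q => T.coverNumber (Q q) R ω

/-- `h_Θ(𝓡 | 𝓠) = lim (1/n) ∫ log N(𝓡⁽ⁿ⁾ | 𝓠⁽ⁿ⁾)(ω) dP(ω)`; the sequence is subadditive, so that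
the upper limit is a limit. -/
def tailEntropyCovers (T : BundleRDS P θ X) {k l : ℕ} (R : Fin k → Set T.carrier)
    (Q : Fin l → Set T.carrier) : ℝ≥0∞ :=
  limsup (fun n : ℕ => (∫⁻ ω, ENNReal.ofReal
    (Real.log (T.condCoverNumber (T.iterCover R n) (T.iterCover Q n) ω)) ∂P) / n) atTop

/-- The relative tail entropy `h*(Θ) = inf_𝓠 sup_𝓡 h_Θ(𝓡 | 𝓠)`, over open random covers. -/
def tailEntropy (T : BundleRDS P θ X) : ℝ≥0∞ :=
  ⨅ (l : ℕ) (Q : Fin l → Set T.carrier) (_ : T.IsOpenRandomCover Q),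
    ⨆ (k : ℕ) (R : Fin k → Set T.carrier) (_ : T.IsOpenRandomCover R), T.tailEntropyCovers R Q

end BundleRDS

end

end RandomBundle

/-! Fix an open random cover `Q` of the bundle of `T`, and let τ(Q) be the supremum of h_Θ(R | Q)
over all open random covers `R`. It suffices to find a finite labelling ξ of the product bundle such
that h_μ(Γ | D) ≤ h_μ(ξ | D) + τ(Q) for every invariant μ, and such that μ ↦ h_μ(ξ | D) is upper
semicontinuous at `m`. The upper limit of h_μ(Γ | D) at `m` is then at most h_m(ξ | D) + τ(Q) ≤
h_m(Γ | D) + τ(Q), and one takes the infimum over `Q`. If h_m(Γ | D) = ∞, the first property at μ =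
m forces τ(Q) = ∞, since h_m(ξ | D) is finite. The labelling is provided by
`exists_partition_of_cover`.

Construction of ξ. Distances to the complements of the `Q j` in the fibers give a random partition
of unity φ_1, ..., φ_l subordinate to `Q` (`exists_partition_of_unity`). For 0 < t < 1/l some φ_j
exceeds t at almost every point, so the set of all such j determines a member of `Q` containing the
point. Only countably many t are such that `m` charges some level set {φ_j = t}, so t can avoid
them.

Upper semicontinuity. By the Gibbs inequality, H_μ(ξ | D) + 1 is at most the μ-integral of the code
length of q_ξ plus the total mass of q, for every μ and all D-measurable weights q_b ≥ 0. Near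
equality holds at `m` when q_b = g_b + δ with g_b close in L¹(m) to the conditional probability of
b. The g_b can be taken measurable in ω and continuous in y; as `m` does not charge the levels, the
integrand then has random continuous majorants costing arbitrarily little at `m`, and their
integrals are continuous in the narrow topology (`eventually_condEntropy_levelLabel_lt`). Cells of
itineraries are again level sets, and by subadditivity h_μ(ξ | D) is an infimum of normalized
entropies.

Comparison with τ(Q) (`relEntropy_le_partitionEntropy_add`). Conditional entropy is a least expected
code length, so it is bounded above by exhibiting codes. Up to small errors, a partition η is a
function of (ω, y), which costs nothing, and of κ(x), where κ is a partial labelling of `X` with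
compact level sets. The sets {κ = i or κ undefined} form an open random cover `R`. Once the
itinerary through `Q` and the times at which κ is undefined are known, a member of R⁽ⁿ⁾ containing
the point determines the itinerary of κ; choosing it in a minimal subcover costs log N(R⁽ⁿ⁾ |
Q⁽ⁿ⁾)(ω). The undefined times are rare, so they cost at most a small multiple of n. -/

namespace RandomBundle

noncomputable section

/-! ### Analytic sets and measurable projections -/

/-- An analytic set of measure greater than `c` contains a compact set of measure at least `c`. -/
theorem exists_isCompact_of_lt_measure_range {α : Type*} [TopologicalSpace α]
    [TopologicalSpace.PseudoMetrizableSpace α] [MeasurableSpace α] [BorelSpace α] (μ : Measure α)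
    [IsFiniteMeasure μ] {f : (ℕ → ℕ) → α} (hf : Continuous f) {c : ℝ≥0∞}
    (hc : c < μ (Set.range f)) : ∃ K, IsCompact K ∧ K ⊆ Set.range f ∧ c ≤ μ K := by
  classical
  let := TopologicalSpace.pseudoMetrizableSpacePseudoMetric α
  -- Coordinates are bounded one at a time. The images need not be measurable, but continuity of `μ`
  -- along increasing unions holds for arbitrary sets.
  have step : ∀ (S : Set (ℕ → ℕ)) (k : ℕ), ∃ N : ℕ,
      c < μ (f '' S) → c < μ (f '' (S ∩ {ν | ν k ≤ N})) := by
    intro S k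
    by_cases h : c < μ (f '' S)
    · have hmono : Monotone fun N : ℕ => f '' (S ∩ {ν | ν k ≤ N}) := fun a b hab =>
        Set.image_mono (Set.inter_subset_inter_right _ fun ν (hν : ν k ≤ a) => hν.trans hab)
      have hU : f '' S = ⋃ N : ℕ, f '' (S ∩ {ν | ν k ≤ N}) := by
        rw [← Set.image_iUnion, ← Set.inter_iUnion]
        congr 1
        ext ν
        simp only [Set.mem_inter_iff, Set.mem_iUnion, Set.mem_ofPred_eq]
        exact ⟨fun h => ⟨h, ν k, le_rfl⟩, fun h => h.1⟩
      rw [hU, hmono.measure_iUnion] at h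
      obtain ⟨N, hN⟩ := lt_iSup_iff.1 h
      exact ⟨N, fun _ => hN⟩
    · exact ⟨0, fun h' => absurd h' h⟩
  choose N hN using step
  let S : ℕ → Set (ℕ → ℕ) := fun k =>
    Nat.rec Set.univ (fun k S => S ∩ {ν | ν k ≤ N S k}) k
  have hS : ∀ k, S (k + 1) = S k ∩ {ν | ν k ≤ N (S k) k} := fun k => rfl
  have hSc : ∀ k, c < μ (f '' S k) := by
    intro k
    induction k with
    | zero => simpa [S] using hc
    | succ k ih => rw [hS]; exact hN _ _ ih
  let b : ℕ → ℕ := fun k => N (S k) k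
  have hSb : ∀ k, ∀ ν ∈ S k, ∀ i < k, ν i ≤ b i := by
    intro k
    induction k with
    | zero => intro ν _ i hi; omega
    | succ k ih =>
      intro ν hν i hi
      rw [hS] at hν
      rcases Nat.lt_succ_iff_lt_or_eq.1 hi with h | rfl
      · exact ih ν hν.1 i h
      · exact hν.2
  have hK : IsCompact (Set.univ.pi fun i => Set.Iic (b i)) :=
    isCompact_univ_pi fun i => (Set.finite_Iic _).isCompact
  refine ⟨f '' Set.univ.pi fun i => Set.Iic (b i), hK.image hf, Set.image_subset_range _ _, ?_⟩
  rw [Set.measure_eq_iInf_isOpen]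
  refine le_iInf₂ fun U hKU => le_iInf fun hU => ?_
  by_contra hlt
  have hex : ∀ k, ∃ ν ∈ S k, f ν ∉ U := by
    intro k
    by_contra! h
    exact hlt ((hSc k).le.trans (measure_mono (Set.image_subset_iff.2 h)))
  choose ν hνS hνU using hex
  -- Only the first `k` coordinates of `ν k` are known to be bounded by `b`. Compactness is applied
  -- to the truncations, which agree with `ν k` in these coordinates and so have the same limit.
  obtain ⟨κ, hκ, φ, hφ, hlim⟩ := hK.tendsto_subseq (x := fun k i => min (ν k i) (b i))
    fun k i _ => Set.mem_Iic.2 (min_le_right _ _)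
  have hlim' : Tendsto (ν ∘ φ) atTop (𝓝 κ) := by
    rw [tendsto_pi_nhds] at hlim ⊢
    intro i
    refine (hlim i).congr' ?_
    filter_upwards [eventually_gt_atTop i] with k hk
    exact min_eq_left (hSb _ _ (hνS _) i (hk.trans_le (hφ.id_le k)))
  have := (hf.tendsto κ).comp hlim' |>.eventually (hU.mem_nhds (hKU ⟨κ, hκ, rfl⟩))
  obtain ⟨k, hk⟩ := this.exists
  exact hνU _ hk

/-- Compact subsets with measures approaching that of `s` have a measurable union, contained in `s`
and of the same finite measure. -/
theorem nullMeasurableSet_of_analyticSet {α : Type*} [TopologicalSpace α] [T2Space α]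
    [TopologicalSpace.PseudoMetrizableSpace α] [MeasurableSpace α] [BorelSpace α] (μ : Measure α)
    [IsFiniteMeasure μ] {s : Set α} (hs : AnalyticSet s) : NullMeasurableSet s μ := by
  rw [AnalyticSet] at hs
  rcases hs with rfl | ⟨f, hf, rfl⟩
  · exact nullMeasurableSet_empty
  rcases eq_or_ne (μ (Set.range f)) 0 with h0 | h0
  · exact NullMeasurableSet.of_null h0
  obtain ⟨u, -, hu, hulim⟩ := exists_seq_strictMono_tendsto' (pos_iff_ne_zero.2 h0)
  choose K hK hKs hKu using fun n => exists_isCompact_of_lt_measure_range μ hf (hu n).2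
  have hle : μ (Set.range f) ≤ μ (⋃ n, K n) :=
    le_of_tendsto' hulim fun n => (hKu n).trans (measure_mono (Set.subset_iUnion _ _))
  have hm : MeasurableSet (⋃ n, K n) := MeasurableSet.iUnion fun n => (hK n).measurableSet
  have hae : (⋃ n, K n) =ᵐ[μ] Set.range f :=
    ae_eq_of_subset_of_measure_ge (Set.iUnion_subset hKs) hle hm.nullMeasurableSet
      (measure_ne_top _ _)
  exact hm.nullMeasurableSet.congr hae

/-- A measurable subset of a product depends on its first coordinate only through countably many
measurable sets. -/
theorem exists_measurable_cantor_of_measurableSet_prod {Ω X : Type*} [MeasurableSpace Ω]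
    [MeasurableSpace X] {A : Set (Ω × X)} (hA : MeasurableSet A) :
    ∃ φ : Ω → ℕ → Bool, Measurable φ ∧ ∃ B : Set ((ℕ → Bool) × X), MeasurableSet B ∧
      A = (fun p => (φ p.1, p.2)) ⁻¹' B := by
  classical
  induction A, hA using MeasurableSpace.induction_on_inter generateFrom_prod.symm
    isPiSystem_prod with
  | empty => exact ⟨fun _ _ => false, measurable_const, ∅, MeasurableSet.empty, rfl⟩
  | basic A hA =>
    obtain ⟨C, hC, F, hF, rfl⟩ := hA
    refine ⟨fun ω _ => decide (ω ∈ C), ?_, {q | q.1 0 = true ∧ q.2 ∈ F}, ?_, ?_⟩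
    · refine measurable_pi_lambda _ fun _ => measurable_to_bool ?_
      have : (fun ω => decide (ω ∈ C)) ⁻¹' {true} = C := by ext; simp
      rw [this]; exact hC
    · exact MeasurableSet.inter (measurableSet_eq_fun ((measurable_pi_apply 0).comp measurable_fst)
        measurable_const) (measurable_snd hF)
    · ext p; simp
  | compl A _ ih =>
    obtain ⟨φ, hφ, B, hB, rfl⟩ := ih
    exact ⟨φ, hφ, Bᶜ, hB.compl, rfl⟩
  | iUnion f _ _ ih =>
    choose φ hφ B hB hfB using ih
    -- Countably many binary sequences are interleaved into one by the pairing function.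
    refine ⟨fun ω k => φ k.unpair.1 ω k.unpair.2, ?_,
      ⋃ n, (fun q => (fun k => q.1 (Nat.pair n k), q.2)) ⁻¹' B n, ?_, ?_⟩
    · exact measurable_pi_lambda _ fun k => (measurable_pi_apply _).comp (hφ _)
    · refine MeasurableSet.iUnion fun n => ?_
      refine Measurable.prodMk (measurable_pi_lambda _ fun k => ?_) measurable_snd (hB n)
      exact (measurable_pi_apply _).comp measurable_fst
    · ext p
      simp only [Set.mem_iUnion, Set.mem_preimage]
      refine exists_congr fun n => ?_
      rw [hfB n]
      simp

/-- The measurable projection theorem. -/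
theorem measurableSet_image_fst {Ω X : Type*} [MeasurableSpace Ω] (P : Measure Ω)
    [IsFiniteMeasure P] [P.IsComplete] [TopologicalSpace X] [PolishSpace X] [MeasurableSpace X]
    [BorelSpace X] {A : Set (Ω × X)} (hA : MeasurableSet A) : MeasurableSet (Prod.fst '' A) := by
  obtain ⟨φ, hφ, B, hB, rfl⟩ := exists_measurable_cantor_of_measurableSet_prod hA
  have : PolishSpace Bool := inferInstance
  -- In the Polish model the projection is analytic, hence null measurable for the law of `φ`. The
  -- projection of the given set is its preimage under `φ`, and completeness of `P` makes it
  -- measurable.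
  have hBan : AnalyticSet (Prod.fst '' B) := hB.analyticSet.image_of_continuous continuous_fst
  have hnull := nullMeasurableSet_of_analyticSet (P.map φ) hBan
  have heq : Prod.fst '' ((fun p : Ω × X => (φ p.1, p.2)) ⁻¹' B) = φ ⁻¹' (Prod.fst '' B) := by
    ext ω
    simp only [Set.mem_image, Set.mem_preimage, Prod.exists, exists_and_right, exists_eq_right]
  rw [heq]
  exact (hnull.preimage (hφ.quasiMeasurePreserving P)).measurable_of_complete

/-! ### Approximation of measurable sets in products -/

/-- The sets with such approximations form a ring containing the products of measurable sets with
closed sets: for these, Urysohn functions between a closed set and an open neighbourhood of slightly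
larger measure are used. The ring generates the product σ-algebra, so its members approximate every
measurable set in measure. -/
theorem exists_carath_indicator {Ω Y : Type*} [MeasurableSpace Ω] [TopologicalSpace Y]
    [TopologicalSpace.PseudoMetrizableSpace Y] [MeasurableSpace Y] [BorelSpace Y]
    (ν : Measure (Ω × Y)) [IsFiniteMeasure ν] {B : Set (Ω × Y)} (hB : MeasurableSet B)
    {ε : ℝ≥0∞} (hε : 0 < ε) :
    ∃ f : Ω × Y → ℝ, Measurable f ∧ (∀ ω, Continuous fun y => f (ω, y)) ∧
      (∀ p, 0 ≤ f p ∧ f p ≤ 1) ∧ ∫⁻ p, ‖f p - B.indicator 1 p‖ₑ ∂ν ≤ ε := by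
  let C : Set (Set (Ω × Y)) := {B | MeasurableSet B ∧ ∀ ε : ℝ≥0∞, 0 < ε →
    ∃ f : Ω × Y → ℝ, Measurable f ∧ (∀ ω, Continuous fun y => f (ω, y)) ∧
      (∀ p, 0 ≤ f p ∧ f p ≤ 1) ∧ ∫⁻ p, ‖f p - B.indicator 1 p‖ₑ ∂ν ≤ ε}
  have hCrect : ∀ (A : Set Ω) (F : Set Y), MeasurableSet A → IsClosed F → A ×ˢ F ∈ C := by
    intro A F hA hF
    refine ⟨hA.prod hF.measurableSet, fun ε hε => ?_⟩
    obtain ⟨U, hFU, hU, hUF⟩ := Set.exists_isOpen_lt_add F (μ := ν.map Prod.snd)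
      (measure_ne_top _ _) hε.ne'
    have hdiff : ν (Prod.snd ⁻¹' (U \ F)) ≤ ε := by
      rw [← Measure.map_apply measurable_snd (hU.measurableSet.diff hF.measurableSet),
        measure_sdiff hFU hF.measurableSet.nullMeasurableSet (measure_ne_top _ _)]
      exact tsub_le_iff_left.2 hUF.le
    obtain ⟨g, hg0, hg1, hg⟩ := exists_continuous_zero_one_of_isClosed hU.isClosed_compl hF
      (Set.disjoint_left.2 fun y hy hy' => hy (hFU hy'))
    refine ⟨fun p => A.indicator 1 p.1 * g p.2, ?_, fun ω => ?_, fun p => ?_, ?_⟩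
    · exact ((measurable_one.indicator hA).comp measurable_fst).mul
        (g.continuous.measurable.comp measurable_snd)
    · exact (continuous_const (y := A.indicator 1 ω)).mul g.continuous
    · by_cases h : p.1 ∈ A
      · simpa [h] using hg p.2
      · simp [h]
    · refine (lintegral_mono (g := (Prod.snd ⁻¹' (U \ F)).indicator 1) fun p => ?_).trans ?_
      · by_cases h : p.1 ∈ A
        · by_cases hF' : p.2 ∈ F
          · have := hg1 hF'
            simp_all [Set.indicator]
          · by_cases hU' : p.2 ∈ U
            · have := hg p.2
              simp only [Set.indicator, h, Set.mem_prod, hF', Set.mem_preimage, Set.mem_sdiff, hU']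
              simp only [if_true, and_false, if_false, not_false_iff, and_self, Pi.one_apply,
                one_mul, sub_zero]
              rw [← ofReal_norm, Real.norm_of_nonneg this.1]
              exact ENNReal.ofReal_le_one.2 this.2
            · have := hg0 hU'
              simp_all [Set.indicator]
        · simp [Set.indicator, h]
      · rw [lintegral_indicator_one ((measurable_snd (hU.measurableSet.diff hF.measurableSet)))]
        exact hdiff
  -- Union and difference act on indicators by `a + b - a * b` and `a * (1 - b)`. Both preserve the
  -- unit interval and are 1-Lipschitz in each variable there, so the `L¹` errors add.
  have hbin : ∀ (A B : Set (Ω × Y)) (E : Set (Ω × Y)) (op : ℝ → ℝ → ℝ),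
      A ∈ C → B ∈ C → MeasurableSet E → Continuous (Function.uncurry op) →
      (∀ a b, 0 ≤ a → a ≤ 1 → 0 ≤ b → b ≤ 1 → 0 ≤ op a b ∧ op a b ≤ 1) →
      (∀ a b a' b', 0 ≤ a → a ≤ 1 → 0 ≤ b → b ≤ 1 → 0 ≤ a' → a' ≤ 1 → 0 ≤ b' → b' ≤ 1 →
        |op a b - op a' b'| ≤ |a - a'| + |b - b'|) →
      (∀ p, E.indicator 1 p = op (A.indicator 1 p) (B.indicator 1 p)) → E ∈ C := by
    intro A B E op hA hB hE hop h01 hlip hind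
    refine ⟨hE, fun ε hε => ?_⟩
    obtain ⟨f, hf, hfc, hf1, hfA⟩ := hA.2 (ε / 2) (ENNReal.half_pos hε.ne')
    obtain ⟨g, hg, hgc, hg1, hgB⟩ := hB.2 (ε / 2) (ENNReal.half_pos hε.ne')
    have hI : ∀ (D : Set (Ω × Y)) p, 0 ≤ D.indicator (1 : Ω × Y → ℝ) p ∧
        D.indicator (1 : Ω × Y → ℝ) p ≤ 1 := fun D p => by
      by_cases h : p ∈ D <;> simp [h]
    refine ⟨fun p => op (f p) (g p), hop.measurable.comp (hf.prodMk hg), fun ω =>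
      hop.comp ((hfc ω).prodMk (hgc ω)), fun p => h01 _ _ (hf1 p).1 (hf1 p).2 (hg1 p).1 (hg1 p).2,
      ?_⟩
    calc ∫⁻ p, ‖op (f p) (g p) - E.indicator 1 p‖ₑ ∂ν
        ≤ ∫⁻ p, (‖f p - A.indicator 1 p‖ₑ + ‖g p - B.indicator 1 p‖ₑ) ∂ν := by
          refine lintegral_mono fun p => ?_
          rw [hind p]
          simp only [← ofReal_norm, Real.norm_eq_abs]
          rw [← ENNReal.ofReal_add (abs_nonneg _) (abs_nonneg _)]
          exact ENNReal.ofReal_le_ofReal (hlip _ _ _ _ (hf1 p).1 (hf1 p).2 (hg1 p).1 (hg1 p).2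
            (hI A p).1 (hI A p).2 (hI B p).1 (hI B p).2)
      _ = ∫⁻ p, ‖f p - A.indicator 1 p‖ₑ ∂ν + ∫⁻ p, ‖g p - B.indicator 1 p‖ₑ ∂ν :=
          lintegral_add_left (hf.sub (measurable_one.indicator hA.1)).enorm _
      _ ≤ ε := (add_le_add hfA hgB).trans (ENNReal.add_halves ε).le
  have hring : IsSetRing C := by
    refine ⟨?_, fun A B hA hB => ?_, fun A B hA hB => ?_⟩
    · simpa using hCrect ∅ ∅ MeasurableSet.empty isClosed_empty
    · refine hbin A B _ (fun a b => a + b - a * b) hA hB (hA.1.union hB.1) (by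
        simp only [Function.uncurry_def]; fun_prop) ?_ ?_ ?_
      · intro a b ha ha' hb hb'
        exact ⟨by nlinarith, by nlinarith⟩
      · intro a b a' b' ha ha1 hb hb1 ha' ha1' hb' hb1'
        have h : a + b - a * b - (a' + b' - a' * b') = (1 - b) * (a - a') + (1 - a') * (b - b') := by
          ring
        rw [h]
        refine (abs_add_le _ _).trans ?_
        rw [abs_mul, abs_mul, abs_of_nonneg (sub_nonneg.2 hb1), abs_of_nonneg (sub_nonneg.2 ha1')]
        exact add_le_add (mul_le_of_le_one_left (abs_nonneg _) (by linarith))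
          (mul_le_of_le_one_left (abs_nonneg _) (by linarith))
      · intro p
        by_cases h : p ∈ A <;> by_cases h' : p ∈ B <;> simp [h, h']
    · refine hbin A B _ (fun a b => a * (1 - b)) hA hB (hA.1.diff hB.1) (by
        simp only [Function.uncurry_def]; fun_prop) ?_ ?_ ?_
      · intro a b ha ha' hb hb'
        exact ⟨by nlinarith, by nlinarith⟩
      · intro a b a' b' ha ha1 hb hb1 ha' ha1' hb' hb1'
        have h : a * (1 - b) - a' * (1 - b') = (1 - b) * (a - a') + a' * (b' - b) := by
          ring
        rw [h]
        refine (abs_add_le _ _).trans ?_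
        rw [abs_mul, abs_mul, abs_of_nonneg (sub_nonneg.2 hb1), abs_of_nonneg ha', abs_sub_comm b']
        exact add_le_add (mul_le_of_le_one_left (abs_nonneg _) (by linarith))
          (mul_le_of_le_one_left (abs_nonneg _) (by linarith))
      · intro p
        by_cases h : p ∈ A <;> by_cases h' : p ∈ B <;> simp [h, h']
  have huniv : Set.univ ∈ C := by simpa using hCrect Set.univ Set.univ .univ isClosed_univ
  have hgen : (inferInstance : MeasurableSpace (Ω × Y)) = MeasurableSpace.generateFrom C := by
    refine le_antisymm ?_ (MeasurableSpace.generateFrom_le fun B hB => hB.1)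
    rw [← generateFrom_eq_prod (C := {A : Set Ω | MeasurableSet A}) (D := {F : Set Y | IsClosed F})
      MeasurableSpace.generateFrom_measurableSet
      (by rw [BorelSpace.measurable_eq (α := Y), borel_eq_generateFrom_isClosed])
      isCountablySpanning_measurableSet ⟨fun _ => Set.univ, fun _ => isClosed_univ, Set.iUnion_const _⟩]
    refine MeasurableSpace.generateFrom_mono ?_
    rintro _ ⟨A, hA, F, hF, rfl⟩
    exact hCrect A F hA hF
  obtain ⟨B', hB', hlt⟩ := exists_measure_symmDiff_lt_of_generateFrom_isSetRing hring
    ⟨{Set.univ}, Set.countable_singleton _, by simpa using huniv, by simp⟩ hgen hB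
    (ε := ε / 2) (ENNReal.half_pos hε.ne') (μ := ν)
  obtain ⟨f, hf, hfc, hf1, hfB⟩ := hB'.2 (ε / 2) (ENNReal.half_pos hε.ne')
  refine ⟨f, hf, hfc, hf1, ?_⟩
  calc ∫⁻ p, ‖f p - B.indicator 1 p‖ₑ ∂ν
      ≤ ∫⁻ p, (‖f p - B'.indicator 1 p‖ₑ + (symmDiff B' B).indicator 1 p) ∂ν := by
        refine lintegral_mono fun p => ?_
        by_cases h : p ∈ B' <;> by_cases h' : p ∈ B <;>
          simp only [Set.indicator, Set.mem_symmDiff, h, h'] <;>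
          simp only [Pi.one_apply, sub_zero, if_true, if_false, not_true, not_false_iff, and_true,
            and_false, or_false, false_or, add_zero, le_refl]
        · rw [← sub_add_cancel (f p) 1]
          refine (enorm_add_le _ _).trans ?_
          simp
        · rw [sub_eq_add_neg]
          refine (enorm_add_le _ _).trans ?_
          simp
    _ = ∫⁻ p, ‖f p - B'.indicator 1 p‖ₑ ∂ν + ν (symmDiff B' B) := by
        rw [← lintegral_indicator_one (hB'.1.symmDiff hB)]
        exact lintegral_add_left (hf.sub (measurable_one.indicator hB'.1)).enorm _
    _ ≤ ε := (add_le_add hfB hlt.le).trans (ENNReal.add_halves ε).le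

/-- Functions measurable in the first variable and continuous in the second are dense in `L¹`. -/
theorem exists_carath_approx {Ω Y : Type*} [MeasurableSpace Ω] [TopologicalSpace Y]
    [TopologicalSpace.PseudoMetrizableSpace Y] [MeasurableSpace Y] [BorelSpace Y]
    (ν : Measure (Ω × Y)) [IsFiniteMeasure ν] {e : Ω × Y → ℝ} (he : Measurable e)
    (he01 : ∀ p, 0 ≤ e p ∧ e p ≤ 1) {ε : ℝ≥0∞} (hε : 0 < ε) :
    ∃ f : Ω × Y → ℝ, Measurable f ∧ (∀ ω, Continuous fun y => f (ω, y)) ∧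
      (∀ p, 0 ≤ f p ∧ f p ≤ 1) ∧ ∫⁻ p, ‖e p - f p‖ₑ ∂ν ≤ ε := by
  have hmem : MemLp e 1 ν := by
    refine MemLp.of_bound he.aestronglyMeasurable 1 (Eventually.of_forall fun p => ?_)
    rw [Real.norm_of_nonneg (he01 p).1]
    exact (he01 p).2
  obtain ⟨f, hf, hfm, hfc⟩ := hmem.induction_dense ENNReal.one_ne_top
    (fun f => Measurable f ∧ ∀ ω, Continuous fun y => f (ω, y)) (by
      intro c s hs _ ε hε
      have hc : (‖c‖ₑ + 1) ≠ ∞ := by simp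
      obtain ⟨f, hf, hfc, -, hfs⟩ := exists_carath_indicator ν hs
        (ε := ε / (‖c‖ₑ + 1)) (ENNReal.div_pos hε hc)
      refine ⟨fun p => c * f p, ?_, hf.const_mul c, fun ω => (hfc ω).const_mul c⟩
      rw [eLpNorm_one_eq_lintegral_enorm]
      calc ∫⁻ p, ‖((fun p => c * f p) - s.indicator fun _ => c) p‖ₑ ∂ν
          = ∫⁻ p, ‖c‖ₑ * ‖f p - s.indicator 1 p‖ₑ ∂ν := by
            refine lintegral_congr fun p => ?_
            rw [← enorm_mul, Pi.sub_apply]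
            congr 1
            by_cases h : p ∈ s <;> simp [h, mul_sub]
        _ = ‖c‖ₑ * ∫⁻ p, ‖f p - s.indicator 1 p‖ₑ ∂ν := lintegral_const_mul' _ _ enorm_ne_top
        _ ≤ (‖c‖ₑ + 1) * (ε / (‖c‖ₑ + 1)) := mul_le_mul' le_self_add hfs
        _ = ε := ENNReal.mul_div_cancel (by simp) hc)
    (fun f g hf hg => ⟨hf.1.add hg.1, fun ω => (hf.2 ω).add (hg.2 ω)⟩)
    (fun f hf => hf.1.aestronglyMeasurable) hε.ne'
  -- Truncation to the unit interval does not increase the distance to `e`, which already takes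
  -- values there.
  refine ⟨fun p => max 0 (min 1 (f p)), measurable_const.max (measurable_const.min hfm),
    fun ω => continuous_const.max (continuous_const.min (hfc ω)),
    fun p => ⟨le_max_left _ _, max_le zero_le_one (min_le_left _ _)⟩, ?_⟩
  rw [eLpNorm_one_eq_lintegral_enorm] at hf
  refine (lintegral_mono fun p => ?_).trans hf
  simp only [← ofReal_norm, Real.norm_eq_abs, Pi.sub_apply]
  refine ENNReal.ofReal_le_ofReal ?_
  have hp : e p = max 0 (min 1 (e p)) := by
    rw [min_eq_right (he01 p).2, max_eq_right (he01 p).1]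
  nth_rewrite 1 [hp]
  refine (abs_max_sub_max_le_max _ _ _ _).trans (max_le (by simp) ?_)
  exact (abs_min_sub_min_le_max _ _ _ _).trans (max_le (by simp) le_rfl)

/-- Measurable sets in a product `Z × X` are approximated by sets `{(z, x) | z ∈ D (κ x)}` for
finite measurable partitions `κ` of `X`. -/
theorem exists_partition_approx {Z X : Type*} [MeasurableSpace Z] [MeasurableSpace X]
    (ν : Measure (Z × X)) [IsFiniteMeasure ν] {B : Set (Z × X)} (hB : MeasurableSet B)
    {ε : ℝ≥0∞} (hε : 0 < ε) :
    ∃ (ι : Type) (_ : Fintype ι) (κ : X → ι) (D : ι → Set Z), (∀ i, MeasurableSet (κ ⁻¹' {i})) ∧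
      (∀ i, MeasurableSet (D i)) ∧ ν (symmDiff {p | p.1 ∈ D (κ p.2)} B) < ε := by
  let C : Set (Set (Z × X)) := {B | ∃ (ι : Type) (_ : Fintype ι) (κ : X → ι) (D : ι → Set Z),
    (∀ i, MeasurableSet (κ ⁻¹' {i})) ∧ (∀ i, MeasurableSet (D i)) ∧ B = {p | p.1 ∈ D (κ p.2)}}
  have hCm : ∀ B ∈ C, MeasurableSet B := by
    rintro B ⟨ι, _, κ, D, hκ, hD, rfl⟩
    have : {p : Z × X | p.1 ∈ D (κ p.2)} = ⋃ i, D i ×ˢ (κ ⁻¹' {i}) := by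
      ext p; simp
    rw [this]
    exact MeasurableSet.iUnion fun i => (hD i).prod (hκ i)
  have hrect : ∀ (A : Set Z) (F : Set X), MeasurableSet A → MeasurableSet F → A ×ˢ F ∈ C := by
    classical
    intro A F hA hF
    refine ⟨Bool, inferInstance, fun x => decide (x ∈ F), fun b => if b then A else ∅, ?_, ?_, ?_⟩
    · rintro (_ | _)
      · have : (fun x => decide (x ∈ F)) ⁻¹' {false} = Fᶜ := by ext; simp
        rw [this]; exact hF.compl
      · have : (fun x => decide (x ∈ F)) ⁻¹' {true} = F := by ext; simp
        rw [this]; exact hF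
    · rintro (_ | _) <;> simp [hA]
    · ext p
      by_cases h : p.2 ∈ F <;> simp [h]
  -- Two such sets are written over the common refinement of their partitions of `X`, and the
  -- operation is carried out on the sets `D`.
  have hbin : ∀ (op : Set Z → Set Z → Set Z) (A B E : Set (Z × X)),
      (∀ a b, MeasurableSet a → MeasurableSet b → MeasurableSet (op a b)) → A ∈ C → B ∈ C →
      (∀ z x, (z, x) ∈ E ↔ z ∈ op {z | (z, x) ∈ A} {z | (z, x) ∈ B}) → E ∈ C := by
    rintro op A B E hop ⟨ι, _, κ, D, hκ, hD, rfl⟩ ⟨ι', _, κ', D', hκ', hD', rfl⟩ hE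
    refine ⟨ι × ι', inferInstance, fun x => (κ x, κ' x), fun i => op (D i.1) (D' i.2), ?_, ?_, ?_⟩
    · rintro ⟨i, i'⟩
      have : (fun x => (κ x, κ' x)) ⁻¹' {(i, i')} = κ ⁻¹' {i} ∩ κ' ⁻¹' {i'} := by ext; simp
      rw [this]
      exact (hκ i).inter (hκ' i')
    · exact fun i => hop _ _ (hD _) (hD' _)
    · ext ⟨z, x⟩
      rw [hE]
      rfl
  have hring : IsSetRing C := by
    refine ⟨?_, fun A B hA hB => ?_, fun A B hA hB => ?_⟩
    · simpa using hrect ∅ ∅ MeasurableSet.empty MeasurableSet.empty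
    · exact hbin (· ∪ ·) A B _ (fun _ _ h h' => h.union h') hA hB fun _ _ => Iff.rfl
    · exact hbin (· \ ·) A B _ (fun _ _ h h' => h.diff h') hA hB fun _ _ => Iff.rfl
  have huniv : Set.univ ∈ C := by simpa using hrect Set.univ Set.univ .univ .univ
  have hgen : (inferInstance : MeasurableSpace (Z × X)) = MeasurableSpace.generateFrom C := by
    refine le_antisymm ?_ (MeasurableSpace.generateFrom_le hCm)
    rw [← generateFrom_prod]
    refine MeasurableSpace.generateFrom_mono ?_
    rintro _ ⟨A, hA, F, hF, rfl⟩
    exact hrect A F hA hF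
  obtain ⟨B', ⟨ι, hι, κ, D, hκ, hD, rfl⟩, hlt⟩ :=
    exists_measure_symmDiff_lt_of_generateFrom_isSetRing hring
    ⟨{Set.univ}, Set.countable_singleton _, by simpa using huniv, by simp⟩ hgen hB hε (μ := ν)
  exact ⟨ι, hι, κ, D, hκ, hD, hlt⟩

/-! ### Codes

Conditional entropy is computed as the infimum of expected code lengths `∫ -log p`, over
sub-probability vectors `p` measurable for the conditioning σ-algebra. -/

/-- `-log t`, truncated below at `0`. -/
def codeLen (t : ℝ≥0∞) : ℝ≥0∞ := (-ENNReal.log t).toENNReal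

theorem codeLen_anti : Antitone codeLen := fun _ _ h =>
  EReal.toENNReal_le_toENNReal (EReal.neg_le_neg_iff.2 (ENNReal.log_le_log h))

theorem measurable_codeLen : Measurable codeLen :=
  ENNReal.measurable_log.neg.ereal_toENNReal

theorem codeLen_zero : codeLen 0 = ∞ := by simp [codeLen]

theorem codeLen_one : codeLen 1 = 0 := by simp [codeLen]

theorem codeLen_ofReal {x : ℝ} (hx : 0 < x) :
    codeLen (ENNReal.ofReal x) = ENNReal.ofReal (-Real.log x) := by
  rw [codeLen, ENNReal.log_ofReal_of_pos hx, ← EReal.coe_neg, EReal.real_coe_toENNReal]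

theorem codeLen_inv_natCast {N : ℕ} (hN : N ≠ 0) :
    codeLen ((N : ℝ≥0∞)⁻¹) = ENNReal.ofReal (Real.log N) := by
  have hN' : (0 : ℝ) < N := by positivity
  rw [← ENNReal.ofReal_natCast, ← ENNReal.ofReal_inv_of_pos hN', codeLen_ofReal (by positivity),
    Real.log_inv, neg_neg]

theorem codeLen_mul_le (s t : ℝ≥0∞) : codeLen (s * t) ≤ codeLen s + codeLen t := by
  rcases eq_or_ne s 0 with rfl | hs
  · simp [codeLen_zero]
  rcases eq_or_ne t 0 with rfl | ht
  · simp [codeLen_zero]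
  unfold codeLen
  rw [ENNReal.log_mul_add, EReal.neg_add (by simp [hs]) (by simp [ht]), sub_eq_add_neg]
  exact EReal.toENNReal_add_le

/-- The pointwise Gibbs inequality. -/
theorem ofReal_negMulLog_add_le {e : ℝ} (he : 0 ≤ e) (he1 : e ≤ 1) (q : ℝ≥0∞) :
    ENNReal.ofReal (Real.negMulLog e) + ENNReal.ofReal e ≤ ENNReal.ofReal e * codeLen q + q := by
  rcases he.eq_or_lt with rfl | he
  · simp
  rcases eq_or_ne q 0 with rfl | hq
  · simp [codeLen_zero, he]
  rcases eq_or_ne q ∞ with rfl | hq'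
  · simp
  obtain ⟨x, hx, rfl⟩ : ∃ x : ℝ, 0 < x ∧ q = ENNReal.ofReal x :=
    ⟨q.toReal, ENNReal.toReal_pos hq hq', (ENNReal.ofReal_toReal hq').symm⟩
  rw [codeLen_ofReal hx, ← ENNReal.ofReal_mul he.le,
    ← ENNReal.ofReal_add (Real.negMulLog_nonneg he.le he1) he.le]
  refine (ENNReal.ofReal_le_ofReal ?_).trans ENNReal.ofReal_add_le
  have h := Real.log_le_sub_one_of_pos (div_pos hx he)
  rw [Real.log_div hx.ne' he.ne'] at h
  have h' := mul_le_mul_of_nonneg_left h he.le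
  have h'' : e * (x / e - 1) = x - e := by field_simp
  rw [Real.negMulLog]
  linarith

theorem ofReal_mul_codeLen {e : ℝ} (he : 0 ≤ e) :
    ENNReal.ofReal e * codeLen (ENNReal.ofReal e) = ENNReal.ofReal (Real.negMulLog e) := by
  rcases he.eq_or_lt with rfl | he
  · simp
  · rw [codeLen_ofReal he, ← ENNReal.ofReal_mul he.le, Real.negMulLog]
    congr 1
    ring

/-- A family of sub-probability vectors on `κ`, indexed by `ι`, measurable for `𝒮`. -/
structure IsCode {α ι κ : Type*} (𝒮 : MeasurableSpace α) (p : ι → κ → α → ℝ≥0∞) : Prop where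
  measurable : ∀ i j, Measurable[𝒮] (p i j)
  tsum_le : ∀ i a, ∑' j, p i j a ≤ 1

/-- The least expected length of a code for `η` given `ξ` and `𝒮`. -/
def relCost {α ι κ : Type*} (𝒮 : MeasurableSpace α) {mα : MeasurableSpace α} (μ : Measure α)
    (ξ : α → ι) (η : α → κ) : ℝ≥0∞ :=
  ⨅ (p : ι → κ → α → ℝ≥0∞) (_ : IsCode 𝒮 p), ∫⁻ a, codeLen (p (ξ a) (η a) a) ∂μ

theorem measurable_tsum_ennreal {α ι : Type*} {m : MeasurableSpace α} [Countable ι]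
    {f : ι → α → ℝ≥0∞} (h : ∀ i, Measurable[m] (f i)) : Measurable[m] fun x => ∑' i, f i x :=
  Measurable.tsum h

/-! ### Inequalities between code lengths, and their identification with conditional entropy -/

section calculus

variable {α ι κ κ' : Type*} {𝒮 : MeasurableSpace α} {mα : MeasurableSpace α} {μ : Measure α}

theorem relCost_le {ξ : α → ι} {η : α → κ} {p : ι → κ → α → ℝ≥0∞} (hp : IsCode 𝒮 p) :
    relCost 𝒮 μ ξ η ≤ ∫⁻ a, codeLen (p (ξ a) (η a) a) ∂μ :=
  iInf₂_le p hp

theorem measurable_apply_label [Countable ι] [MeasurableSpace ι] [MeasurableSingletonClass ι]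
    {p : ι → α → ℝ≥0∞} (hp : ∀ i, Measurable (p i)) {ξ : α → ι} (hξ : Measurable ξ) :
    Measurable fun a => p (ξ a) a :=
  (measurable_from_prod_countable_right (f := fun x : ι × α => p x.1 x.2) hp).comp
    (hξ.prodMk measurable_id)

/-- Coarsening the described labelling does not increase the cost. -/
theorem relCost_comp_le [Countable κ] (ξ : α → ι) (η : α → κ) (f : κ → κ') :
    relCost 𝒮 μ ξ (f ∘ η) ≤ relCost 𝒮 μ ξ η := by
  classical
  refine le_iInf₂ fun p hp => ?_
  refine (relCost_le (p := fun i k a => ∑' j, if f j = k then p i j a else 0) ⟨fun i k => ?_,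
    fun i a => ?_⟩).trans (lintegral_mono fun a => codeLen_anti ?_)
  · refine measurable_tsum_ennreal fun j => ?_
    split_ifs
    · exact hp.measurable i j
    · exact measurable_const
  · rw [ENNReal.tsum_comm]
    simpa using hp.tsum_le i a
  · refine le_trans ?_ (ENNReal.le_tsum (η a))
    simp

/-- Coarsening the given labelling does not decrease the cost. -/
theorem relCost_le_comp (ξ : α → ι) (η : α → κ) {ι' : Type*} (f : ι → ι') :
    relCost 𝒮 μ ξ η ≤ relCost 𝒮 μ (f ∘ ξ) η := by
  refine le_iInf₂ fun p hp => ?_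
  exact relCost_le (p := fun i => p (f i)) ⟨fun i => hp.measurable _, fun i => hp.tsum_le _⟩

/-- The chain rule. -/
theorem relCost_prod_le (h𝒮 : 𝒮 ≤ mα) [Countable ι] [MeasurableSpace ι]
    [MeasurableSingletonClass ι] [Countable κ] [MeasurableSpace κ] [MeasurableSingletonClass κ]
    {ξ : α → ι} (hξ : Measurable ξ) {η : α → κ} (hη : Measurable η) (ζ : α → κ') :
    relCost 𝒮 μ ξ (fun a => (η a, ζ a)) ≤
      relCost 𝒮 μ ξ η + relCost 𝒮 μ (fun a => (ξ a, η a)) ζ := by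
  simp only [relCost, ENNReal.iInf_add, ENNReal.add_iInf]
  refine le_iInf₂ fun q hq => le_iInf₂ fun p hp => ?_
  -- Codes are concatenated by multiplying their weights; the inner sum over the second symbol is at
  -- most `1`.
  refine (relCost_le (p := fun i jk a => p i jk.1 a * q (i, jk.1) jk.2 a)
    ⟨fun i jk => (hp.measurable _ _).mul (hq.measurable _ _), fun i a => ?_⟩).trans ?_
  · rw [ENNReal.tsum_prod']
    simp only [ENNReal.tsum_mul_left]
    exact (ENNReal.tsum_le_tsum fun j => mul_le_of_le_one_right' (hq.tsum_le _ a)).trans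
      (hp.tsum_le i a)
  · rw [← lintegral_add_left]
    · exact lintegral_mono fun a => codeLen_mul_le _ _
    · exact measurable_codeLen.comp (measurable_apply_label (p := fun x : ι × κ => p x.1 x.2)
        (fun x => (hp.measurable _ _).mono h𝒮 le_rfl) (hξ.prodMk hη))

/-- Pulling back along a measure-preserving `𝒮`-measurable map does not increase the cost. -/
theorem relCost_comp_map_le (h𝒮 : 𝒮 ≤ mα) [Countable ι] [MeasurableSpace ι]
    [MeasurableSingletonClass ι] [Countable κ] [MeasurableSpace κ] [MeasurableSingletonClass κ]
    {f : α → α} (hf : MeasurePreserving f μ μ)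
    (hf𝒮 : Measurable[𝒮, 𝒮] f) {ξ : α → ι} (hξ : Measurable ξ) {η : α → κ} (hη : Measurable η) :
    relCost 𝒮 μ (ξ ∘ f) (η ∘ f) ≤ relCost 𝒮 μ ξ η := by
  refine le_iInf₂ fun p hp => ?_
  refine (relCost_le (p := fun i j => p i j ∘ f) ⟨fun i j => (hp.measurable i j).comp hf𝒮,
    fun i a => hp.tsum_le i _⟩).trans (le_of_eq ?_)
  refine hf.lintegral_comp (f := fun a => codeLen (p (ξ a) (η a) a)) ?_
  exact measurable_codeLen.comp (measurable_apply_label (p := fun x : ι × κ => p x.1 x.2)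
    (fun x => (hp.measurable _ _).mono h𝒮 le_rfl) (hξ.prodMk hη))

theorem measurable_itinerary [MeasurableSpace ι] {f : α → α} (hf : Measurable f) {ξ : α → ι}
    (hξ : Measurable ξ) (n : ℕ) : Measurable (itinerary f ξ n) :=
  measurable_pi_lambda _ fun i => hξ.comp (hf.iterate i)

/-- By the chain rule the symbol at time `0` is described from the symbol of `ξ` at time `0`, and
the rest from the shifted itinerary of `ξ`; invariance reduces the rest to length `n`. -/
theorem relCost_itinerary_le (h𝒮 : 𝒮 ≤ mα) [Countable ι] [MeasurableSpace ι]
    [MeasurableSingletonClass ι] [Countable κ] [MeasurableSpace κ] [MeasurableSingletonClass κ]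
    {f : α → α} (hf : MeasurePreserving f μ μ)
    (hf𝒮 : Measurable[𝒮, 𝒮] f) {ξ : α → ι} (hξ : Measurable ξ) {η : α → κ} (hη : Measurable η)
    (n : ℕ) : relCost 𝒮 μ (itinerary f ξ n) (itinerary f η n) ≤ n * relCost 𝒮 μ ξ η := by
  induction n with
  | zero =>
    refine (relCost_le (p := fun _ _ _ => 1) ⟨fun _ _ => measurable_const, fun _ _ => ?_⟩).trans ?_
    · simp
    · simp [codeLen_one]
  | succ n ih =>
    have hm := hf.measurable
    have hsplit : itinerary f η (n + 1) =
        (fun x : κ × (Fin n → κ) => (Fin.cons x.1 x.2 : Fin (n + 1) → κ)) ∘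
          fun a => (η a, (itinerary f η n ∘ f) a) := by
      funext a i
      refine Fin.cases ?_ (fun i => ?_) i
      · simp [itinerary]
      · simp [itinerary, Function.iterate_succ_apply]
    have h1 : relCost 𝒮 μ (itinerary f ξ (n + 1)) η ≤ relCost 𝒮 μ ξ η :=
      relCost_le_comp (itinerary f ξ (n + 1)) η (fun x => x 0)
    have h2 : relCost 𝒮 μ (fun a => (itinerary f ξ (n + 1) a, η a)) (itinerary f η n ∘ f) ≤
        n * relCost 𝒮 μ ξ η :=
      (relCost_le_comp (fun a => (itinerary f ξ (n + 1) a, η a)) (itinerary f η n ∘ f)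
        (fun x => Fin.tail x.1)).trans
      ((relCost_comp_map_le h𝒮 hf hf𝒮 (measurable_itinerary hm hξ n)
        (measurable_itinerary hm hη n)).trans ih)
    rw [hsplit]
    refine (relCost_comp_le _ _ _).trans ((relCost_prod_le h𝒮
      (measurable_itinerary hm hξ (n + 1)) hη _).trans ((add_le_add h1 h2).trans (le_of_eq ?_)))
    push_cast
    ring

/-- The restriction of `μ` to `A`, viewed on `𝒮`, has the conditional probability of `A` as density.
Taking `g` with values in `[0, ∞]` admits infinite code lengths. -/
theorem lintegral_mul_condExp (h𝒮 : 𝒮 ≤ mα) [IsFiniteMeasure μ] {A : Set α}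
    (hA : MeasurableSet A) {g : α → ℝ≥0∞} (hg : Measurable[𝒮] g) :
    ∫⁻ a in A, g a ∂μ = ∫⁻ a, ENNReal.ofReal ((μ⟦A | 𝒮⟧) a) * g a ∂μ := by
  have he : Measurable[𝒮] fun a => ENNReal.ofReal ((μ⟦A | 𝒮⟧) a) :=
    stronglyMeasurable_condExp.measurable.ennreal_ofReal
  have hnn : 0 ≤ᵐ[μ] μ⟦A | 𝒮⟧ :=
    condExp_nonneg (Eventually.of_forall fun a => Set.indicator_nonneg (fun _ _ => zero_le_one) a)
  have hm : (μ.restrict A).trim h𝒮 =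
      (μ.trim h𝒮).withDensity fun a => ENNReal.ofReal ((μ⟦A | 𝒮⟧) a) := by
    refine @Measure.ext _ 𝒮 _ _ fun s hs => ?_
    rw [trim_measurableSet_eq h𝒮 hs, withDensity_apply _ hs, restrict_trim h𝒮 μ hs,
      lintegral_trim h𝒮 he, ← ofReal_integral_eq_lintegral_ofReal integrable_condExp.integrableOn
      (ae_restrict_of_ae hnn), setIntegral_condExp h𝒮
      ((integrable_const (1 : ℝ)).indicator hA) hs, setIntegral_indicator hA,
      Measure.restrict_apply (h𝒮 s hs)]
    simp [Measure.real, ENNReal.ofReal_toReal]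
  rw [← lintegral_trim h𝒮 hg, hm, lintegral_withDensity_eq_lintegral_mul _ he hg,
    lintegral_trim h𝒮 (he.mul hg)]
  rfl

theorem lintegral_eq_tsum_label [Countable ι] [MeasurableSpace ι] [MeasurableSingletonClass ι]
    {ξ : α → ι} (hξ : Measurable ξ) (F : ι → α → ℝ≥0∞) :
    ∫⁻ a, F (ξ a) a ∂μ = ∑' i, ∫⁻ a in ξ ⁻¹' {i}, F i a ∂μ := by
  have hU : ⋃ i, ξ ⁻¹' {i} = Set.univ := by ext; simp
  have hd : Pairwise (Function.onFun Disjoint fun i => ξ ⁻¹' {i}) := fun i j hij =>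
    Set.disjoint_left.2 fun a ha ha' => hij (ha.symm.trans ha')
  rw [← setLIntegral_univ, ← hU, lintegral_iUnion (fun i => hξ (measurableSet_singleton i)) hd]
  refine tsum_congr fun i => setLIntegral_congr_fun (hξ (measurableSet_singleton i)) fun a ha => ?_
  rw [Set.mem_preimage, Set.mem_singleton_iff] at ha
  rw [ha]

theorem condExp_indicator_mem_Icc [IsFiniteMeasure μ] {A : Set α} (hA : MeasurableSet A) :
    ∀ᵐ a ∂μ, 0 ≤ (μ⟦A | 𝒮⟧) a ∧ (μ⟦A | 𝒮⟧) a ≤ 1 := by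
  by_cases h𝒮 : 𝒮 ≤ mα
  · have h0 : 0 ≤ᵐ[μ] μ⟦A | 𝒮⟧ :=
      condExp_nonneg (Eventually.of_forall fun a => Set.indicator_nonneg (fun _ _ => zero_le_one) a)
    have h1 : μ⟦A | 𝒮⟧ ≤ᵐ[μ] μ[fun _ => (1 : ℝ) | 𝒮] :=
      condExp_mono ((integrable_const (1 : ℝ)).indicator hA) (integrable_const _)
        (Eventually.of_forall fun a => Set.indicator_le_self' (fun _ _ => zero_le_one) a)
    rw [condExp_const h𝒮] at h1
    filter_upwards [h0, h1] with a ha ha' using ⟨ha, ha'⟩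
  · rw [condExp_of_not_le h𝒮]
    simp

theorem tsum_lintegral_condExp (h𝒮 : 𝒮 ≤ mα) [IsFiniteMeasure μ] [Countable ι]
    [MeasurableSpace ι] [MeasurableSingletonClass ι] {ξ : α → ι} (hξ : Measurable ξ)
    {g : α → ℝ≥0∞} (hg : Measurable[𝒮] g) :
    ∑' i, ∫⁻ a, ENNReal.ofReal ((μ⟦ξ ⁻¹' {i} | 𝒮⟧) a) * g a ∂μ = ∫⁻ a, g a ∂μ := by
  rw [lintegral_eq_tsum_label hξ fun _ => g]
  exact tsum_congr fun i => (lintegral_mul_condExp h𝒮 (hξ (measurableSet_singleton i)) hg).symm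

theorem condEntropy_eq_tsum (h𝒮 : 𝒮 ≤ mα) [Countable ι] (ξ : α → ι) :
    condEntropy 𝒮 μ ξ =
      ∑' i, ∫⁻ a, ENNReal.ofReal (Real.negMulLog ((μ⟦ξ ⁻¹' {i} | 𝒮⟧) a)) ∂μ := by
  refine lintegral_tsum fun i => ?_
  exact ((Real.continuous_negMulLog.measurable.comp
    (stronglyMeasurable_condExp.mono h𝒮).measurable).ennreal_ofReal).aemeasurable

/-- The unnormalized Gibbs inequality. -/
theorem condEntropy_add_one_le (h𝒮 : 𝒮 ≤ mα) [IsProbabilityMeasure μ] [Countable ι]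
    [MeasurableSpace ι] [MeasurableSingletonClass ι] {ξ : α → ι} (hξ : Measurable ξ)
    {q : ι → α → ℝ≥0∞} (hq : ∀ i, Measurable[𝒮] (q i)) :
    condEntropy 𝒮 μ ξ + 1 ≤ ∫⁻ a, codeLen (q (ξ a) a) ∂μ + ∑' i, ∫⁻ a, q i a ∂μ := by
  have hlen : ∫⁻ a, codeLen (q (ξ a) a) ∂μ =
      ∑' i, ∫⁻ a, ENNReal.ofReal ((μ⟦ξ ⁻¹' {i} | 𝒮⟧) a) * codeLen (q i a) ∂μ := by
    rw [lintegral_eq_tsum_label hξ fun i a => codeLen (q i a)]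
    exact tsum_congr fun i => lintegral_mul_condExp h𝒮 (hξ (measurableSet_singleton i))
      (measurable_codeLen.comp (hq i))
  have hone : (1 : ℝ≥0∞) = ∑' i, ∫⁻ a, ENNReal.ofReal ((μ⟦ξ ⁻¹' {i} | 𝒮⟧) a) ∂μ := by
    simpa using (tsum_lintegral_condExp (μ := μ) h𝒮 hξ (g := fun _ => 1) measurable_const).symm
  have hem : ∀ i, Measurable fun a => ENNReal.ofReal ((μ⟦ξ ⁻¹' {i} | 𝒮⟧) a) := fun i =>
    (stronglyMeasurable_condExp.mono h𝒮).measurable.ennreal_ofReal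
  rw [hlen, condEntropy_eq_tsum h𝒮, hone, ← ENNReal.tsum_add, ← ENNReal.tsum_add]
  refine ENNReal.tsum_le_tsum fun i => ?_
  rw [← lintegral_add_right _ (hem i), ← lintegral_add_right _ ((hq i).mono h𝒮 le_rfl)]
  refine lintegral_mono_ae ?_
  filter_upwards [condExp_indicator_mem_Icc (𝒮 := 𝒮) (μ := μ) (hξ (measurableSet_singleton i))] with a ha
  exact ofReal_negMulLog_add_le ha.1 ha.2 _

/-- This is the equality case of the Gibbs inequality: the conditional probabilities form an optimal
code. -/
theorem lintegral_codeLen_condExp (h𝒮 : 𝒮 ≤ mα) [IsProbabilityMeasure μ] [Countable ι]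
    [MeasurableSpace ι] [MeasurableSingletonClass ι] {ξ : α → ι} (hξ : Measurable ξ) :
    ∫⁻ a, codeLen (ENNReal.ofReal ((μ⟦ξ ⁻¹' {ξ a} | 𝒮⟧) a)) ∂μ = condEntropy 𝒮 μ ξ := by
  rw [lintegral_eq_tsum_label hξ fun i a => codeLen (ENNReal.ofReal ((μ⟦ξ ⁻¹' {i} | 𝒮⟧) a)),
    condEntropy_eq_tsum h𝒮]
  refine tsum_congr fun i => ?_
  refine (lintegral_mul_condExp h𝒮 (hξ (measurableSet_singleton i)) (measurable_codeLen.comp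
    stronglyMeasurable_condExp.measurable.ennreal_ofReal)).trans (lintegral_congr_ae ?_)
  filter_upwards [condExp_indicator_mem_Icc (𝒮 := 𝒮) (μ := μ) (hξ (measurableSet_singleton i))] with a ha
  exact ofReal_mul_codeLen ha.1

/-- One inequality is Gibbs. For the other, the conditional probabilities sum to at most `1` only
almost everywhere, so they are replaced by `0` on the exceptional set, which belongs to `𝒮`. Entropy
estimates thereby reduce to operations on codes. -/
theorem condEntropy_eq_relCost (h𝒮 : 𝒮 ≤ mα) [IsProbabilityMeasure μ] [Countable ι]
    [MeasurableSpace ι] [MeasurableSingletonClass ι] {ξ : α → ι} (hξ : Measurable ξ) :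
    condEntropy 𝒮 μ ξ = relCost 𝒮 μ (fun _ => ()) ξ := by
  classical
  refine le_antisymm (le_iInf₂ fun p hp => ?_) ?_
  · have h := condEntropy_add_one_le (μ := μ) h𝒮 hξ (q := p ()) (hp.measurable ())
    have h1 : ∑' i, ∫⁻ a, p () i a ∂μ ≤ 1 := by
      rw [← lintegral_tsum fun i => ((hp.measurable () i).mono h𝒮 le_rfl).aemeasurable]
      refine (lintegral_mono fun a => hp.tsum_le () a).trans ?_
      simp
    exact (ENNReal.add_le_add_iff_right ENNReal.one_ne_top).1 (h.trans (add_le_add_right h1 _))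
  · let e : ι → α → ℝ≥0∞ := fun i a => ENNReal.ofReal ((μ⟦ξ ⁻¹' {i} | 𝒮⟧) a)
    have he : ∀ i, Measurable[𝒮] (e i) := fun i =>
      stronglyMeasurable_condExp.measurable.ennreal_ofReal
    have hsum : Measurable[𝒮] fun a => ∑' i, e i a := measurable_tsum_ennreal he
    have hset : MeasurableSet[𝒮] {a | ∑' i, e i a ≤ 1} := hsum measurableSet_Iic
    have hae : ∀ᵐ a ∂μ, ∑' i, e i a ≤ 1 := by
      refine ae_of_ae_trim h𝒮 ?_
      refine @ae_le_of_forall_setLIntegral_le_of_sigmaFinite _ 𝒮 _ _ _ _ hsum fun s hs _ => ?_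
      rw [restrict_trim h𝒮 μ hs, lintegral_trim h𝒮 hsum, lintegral_trim h𝒮 measurable_const,
        lintegral_tsum fun i => ((he i).mono h𝒮 le_rfl).aemeasurable]
      have hg : Measurable[𝒮] (s.indicator fun _ => (1 : ℝ≥0∞)) := measurable_const.indicator hs
      have h := tsum_lintegral_condExp (μ := μ) h𝒮 hξ hg
      rw [lintegral_indicator (h𝒮 s hs)] at h
      rw [← h]
      refine ENNReal.tsum_le_tsum fun i => ?_
      rw [← lintegral_indicator (h𝒮 s hs)]
      refine lintegral_mono fun a => ?_
      by_cases ha : a ∈ s <;> simp [ha, e]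
    refine (relCost_le (p := fun _ i a => if ∑' i, e i a ≤ 1 then e i a else 0) ⟨fun _ i => ?_,
      fun _ a => ?_⟩).trans ?_
    · exact Measurable.ite hset (he i) measurable_const
    · by_cases h : ∑' i, e i a ≤ 1 <;> simp [h]
    · rw [← lintegral_codeLen_condExp h𝒮 hξ]
      refine lintegral_mono_ae ?_
      filter_upwards [hae] with a ha
      simp [ha, e]

end calculus

/-! ### Entropy and code lengths along orbits -/

section dynamics

variable {α ι : Type*} {𝒮 : MeasurableSpace α} {mα : MeasurableSpace α} {μ : Measure α}
  [Countable ι] [MeasurableSpace ι] [MeasurableSingletonClass ι]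

/-- The chain rule splits the itinerary at time `m`. Forgetting the first block only raises the cost
of the second, which is a pullback by `f^[m]` and so costs no more than an initial block. -/
theorem condEntropy_itinerary_add_le (h𝒮 : 𝒮 ≤ mα) [IsProbabilityMeasure μ] {f : α → α}
    (hf : MeasurePreserving f μ μ) (hf𝒮 : Measurable[𝒮, 𝒮] f) {ξ : α → ι} (hξ : Measurable ξ)
    (m n : ℕ) : condEntropy 𝒮 μ (itinerary f ξ (m + n)) ≤
      condEntropy 𝒮 μ (itinerary f ξ m) + condEntropy 𝒮 μ (itinerary f ξ n) := by
  have hm := hf.measurable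
  rw [condEntropy_eq_relCost h𝒮 (measurable_itinerary hm hξ _),
    condEntropy_eq_relCost h𝒮 (measurable_itinerary hm hξ _),
    condEntropy_eq_relCost h𝒮 (measurable_itinerary hm hξ _)]
  have hsplit : itinerary f ξ (m + n) =
      (fun x : (Fin m → ι) × (Fin n → ι) => Fin.append x.1 x.2) ∘
        fun a => (itinerary f ξ m a, (itinerary f ξ n ∘ f^[m]) a) := by
    funext a i
    refine Fin.addCases (fun i => ?_) (fun i => ?_) i
    · simp [itinerary]
    · simp [itinerary, ← Function.iterate_add_apply, add_comm]
  rw [hsplit]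
  refine (relCost_comp_le _ _ _).trans ((relCost_prod_le h𝒮 measurable_const
    (measurable_itinerary hm hξ m) _).trans ?_)
  refine add_le_add_right ((relCost_le_comp _ _ (fun _ => ())).trans ?_) _
  exact relCost_comp_map_le (ξ := fun _ => ()) h𝒮 (hf.iterate m)
    (@Measurable.iterate α 𝒮 f hf𝒮 m) measurable_const (measurable_itinerary hm hξ n)

/-- Fekete's lemma: the limit is an infimum. This form turns upper semicontinuity at a fixed length
`N` into upper semicontinuity of the entropy. -/
theorem partitionEntropy_le_div (h𝒮 : 𝒮 ≤ mα) [IsProbabilityMeasure μ] {f : α → α}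
    (hf : MeasurePreserving f μ μ) (hf𝒮 : Measurable[𝒮, 𝒮] f) {ξ : α → ι} (hξ : Measurable ξ)
    {N : ℕ} (hN : N ≠ 0) :
    partitionEntropy 𝒮 μ f ξ ≤ condEntropy 𝒮 μ (itinerary f ξ N) / N := by
  let a : ℕ → ℝ≥0∞ := fun n => condEntropy 𝒮 μ (itinerary f ξ n)
  have hsub : ∀ m n, a (m + n) ≤ a m + a n :=
    condEntropy_itinerary_add_le h𝒮 hf hf𝒮 hξ
  change limsup (fun n : ℕ => a n / n) atTop ≤ a N / N
  have hN' : (N : ℝ≥0∞) ≠ 0 := by exact_mod_cast hN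
  rcases eq_or_ne (a N) ∞ with hinf | hfin
  · rw [hinf, ENNReal.top_div_of_ne_top (by simp)]
    exact le_top
  -- Fekete's lemma is applied to real numbers. Finiteness of `a N` passes to `a 1`, and by
  -- subadditivity to every `a n`.
  have hone : a 1 ≤ a N := by
    simp only [a]
    rw [condEntropy_eq_relCost h𝒮 (measurable_itinerary hf.measurable hξ _),
      condEntropy_eq_relCost h𝒮 (measurable_itinerary hf.measurable hξ _)]
    refine le_trans (le_of_eq ?_) (relCost_comp_le (fun _ => ()) (itinerary f ξ N)
      (fun x (_ : Fin 1) => x ⟨0, Nat.pos_of_ne_zero hN⟩))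
    congr 1
    funext b i
    simp [itinerary]
  have hne : ∀ n, a n ≠ ∞ := by
    intro n
    induction n with
    | zero =>
      have h0 : a 0 = 0 := by
        refine le_antisymm ?_ bot_le
        simp only [a]
        rw [condEntropy_eq_relCost h𝒮 (measurable_itinerary hf.measurable hξ _)]
        refine (relCost_le (p := fun _ _ _ => 1) ⟨fun _ _ => measurable_const,
          fun _ _ => by simp⟩).trans ?_
        simp [codeLen_one]
      simp [h0]
    | succ n ih =>
      exact ne_top_of_le_ne_top (ENNReal.add_ne_top.2 ⟨ih, ne_top_of_le_ne_top hfin hone⟩) (hsub n 1)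
  have hS : Subadditive fun n => (a n).toReal := fun m n => by
    rw [← ENNReal.toReal_add (hne m) (hne n)]
    exact ENNReal.toReal_mono (ENNReal.add_ne_top.2 ⟨hne m, hne n⟩) (hsub m n)
  have hbdd : BddBelow (Set.range fun n : ℕ => (a n).toReal / n) :=
    ⟨0, by rintro _ ⟨n, rfl⟩; positivity⟩
  have hlim := ENNReal.tendsto_ofReal (hS.tendsto_lim hbdd)
  have hconv : ∀ n : ℕ, n ≠ 0 → ENNReal.ofReal ((a n).toReal / n) = a n / n := by
    intro n hn
    rw [ENNReal.ofReal_div_of_pos (by positivity), ENNReal.ofReal_toReal (hne n),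
      ENNReal.ofReal_natCast]
  have hlim' : Tendsto (fun n : ℕ => a n / n) atTop (𝓝 (ENNReal.ofReal hS.lim)) :=
    hlim.congr' ((eventually_ne_atTop 0).mono hconv)
  rw [hlim'.limsup_eq, ← hconv N hN]
  exact ENNReal.ofReal_le_ofReal (hS.lim_le_div hbdd hN)

/-- Entropy of `η` bounded by that of `ζ`, through intermediate labellings `ρ` and `κ`. -/
theorem condEntropy_itinerary_le_add (h𝒮 : 𝒮 ≤ mα) [IsProbabilityMeasure μ] {f : α → α}
    (hf : MeasurePreserving f μ μ) (hf𝒮 : Measurable[𝒮, 𝒮] f)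
    {ι₂ ι₃ ι₄ : Type*} [Countable ι₂] [MeasurableSpace ι₂] [MeasurableSingletonClass ι₂]
    [Countable ι₃] [MeasurableSpace ι₃] [MeasurableSingletonClass ι₃]
    [Countable ι₄] [MeasurableSpace ι₄] [MeasurableSingletonClass ι₄]
    {ζ : α → ι} (hζ : Measurable ζ) {ρ : α → ι₂} (hρ : Measurable ρ) {κ : α → ι₃}
    (hκ : Measurable κ) {η : α → ι₄} (hη : Measurable η) (n : ℕ) :
    condEntropy 𝒮 μ (itinerary f η n) ≤ condEntropy 𝒮 μ (itinerary f ζ n) +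
      n * relCost 𝒮 μ (fun _ => ()) ρ +
      relCost 𝒮 μ (fun a => (itinerary f ζ n a, itinerary f ρ n a)) (itinerary f κ n) +
      n * relCost 𝒮 μ κ η := by
  have hm := hf.measurable
  have hζn := measurable_itinerary hm hζ n
  have hρn := measurable_itinerary hm hρ n
  have hκn := measurable_itinerary hm hκ n
  rw [condEntropy_eq_relCost h𝒮 (measurable_itinerary hm hη n), condEntropy_eq_relCost h𝒮 hζn]
  have h1 : relCost 𝒮 μ (fun _ => ()) (fun a => (itinerary f ζ n a, itinerary f ρ n a)) ≤
      relCost 𝒮 μ (fun _ => ()) (itinerary f ζ n) + n * relCost 𝒮 μ (fun _ => ()) ρ := by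
    refine (relCost_prod_le h𝒮 measurable_const hζn _).trans (add_le_add_right ?_ _)
    refine (relCost_le_comp _ _ (fun _ (_ : Fin n) => ())).trans ?_
    exact relCost_itinerary_le (ξ := fun _ => ()) h𝒮 hf hf𝒮 measurable_const hρ n
  have h2 : relCost 𝒮 μ (fun _ => ())
      (fun a => ((itinerary f ζ n a, itinerary f ρ n a), itinerary f κ n a)) ≤
      relCost 𝒮 μ (fun _ => ()) (fun a => (itinerary f ζ n a, itinerary f ρ n a)) +
      relCost 𝒮 μ (fun a => (itinerary f ζ n a, itinerary f ρ n a)) (itinerary f κ n) := by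
    refine (relCost_prod_le h𝒮 measurable_const (hζn.prodMk hρn) (itinerary f κ n)).trans
      (add_le_add_right ?_ _)
    exact relCost_le_comp (fun a => ((), itinerary f ζ n a, itinerary f ρ n a)) (itinerary f κ n)
      Prod.snd
  have h3 : relCost 𝒮 μ (fun _ => ()) (fun a =>
      (((itinerary f ζ n a, itinerary f ρ n a), itinerary f κ n a), itinerary f η n a)) ≤
      relCost 𝒮 μ (fun _ => ())
      (fun a => ((itinerary f ζ n a, itinerary f ρ n a), itinerary f κ n a)) +
      n * relCost 𝒮 μ κ η := by
    refine (relCost_prod_le h𝒮 measurable_const ((hζn.prodMk hρn).prodMk hκn)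
      (itinerary f η n)).trans (add_le_add_right (le_trans ?_
      (relCost_itinerary_le h𝒮 hf hf𝒮 hκ hη n)) _)
    exact relCost_le_comp
      (fun a => ((), (itinerary f ζ n a, itinerary f ρ n a), itinerary f κ n a))
      (itinerary f η n) (fun x => x.2.2)
  refine (relCost_comp_le (fun _ => ()) (fun a =>
      (((itinerary f ζ n a, itinerary f ρ n a), itinerary f κ n a), itinerary f η n a))
      Prod.snd).trans (h3.trans ?_)
  gcongr
  exact h2.trans (add_le_add_left h1 _)

theorem relCost_trans_le (h𝒮 : 𝒮 ≤ mα) {ι₂ ι₃ : Type*} [Countable ι₂] [MeasurableSpace ι₂]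
    [MeasurableSingletonClass ι₂] [Countable ι₃] {ξ : α → ι} (hξ : Measurable ξ) {η : α → ι₂}
    (hη : Measurable η) (ζ : α → ι₃) :
    relCost 𝒮 μ ξ ζ ≤ relCost 𝒮 μ ξ η + relCost 𝒮 μ η ζ :=
  (relCost_comp_le ξ (fun a => (η a, ζ a)) Prod.snd).trans
    ((relCost_prod_le h𝒮 hξ hη ζ).trans
      (add_le_add_right (relCost_le_comp _ ζ (fun x : ι × ι₂ => x.2)) _))

end dynamics

/-! ### Relabellings of small cost -/

section smallCost

variable {α : Type*} {𝒮 : MeasurableSpace α} {mα : MeasurableSpace α} {μ : Measure α}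

/-- Merging the tail of a countable labelling of finite conditional entropy loses little. -/
theorem exists_relCost_min_le (h𝒮 : 𝒮 ≤ mα) [IsProbabilityMeasure μ] {η : α → ℕ}
    (hη : Measurable η) (hfin : condEntropy 𝒮 μ η < ∞) {ε : ℝ≥0∞} (hε : 0 < ε) :
    ∃ M : ℕ, relCost 𝒮 μ (fun a => min (η a) M) η ≤ ε := by
  rw [condEntropy_eq_relCost h𝒮 hη] at hfin
  obtain ⟨p, hp⟩ := iInf_lt_iff.1 hfin
  obtain ⟨hp, hlt⟩ := iInf_lt_iff.1 hp
  let s : ℕ → Set α := fun M => {a | M ≤ η a}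
  have hs : ∀ M, MeasurableSet (s M) := fun M => measurableSet_le measurable_const hη
  have hμs : Tendsto (fun M => μ (s M)) atTop (𝓝 0) := by
    have hanti : Antitone s := fun a b hab x (hx : b ≤ η x) => hab.trans hx
    have h := tendsto_measure_iInter_atTop (μ := μ) (fun M => (hs M).nullMeasurableSet) hanti
      ⟨0, measure_ne_top _ _⟩
    have hempty : ⋂ M, s M = ∅ := by
      refine Set.eq_empty_iff_forall_notMem.2 fun a ha => ?_
      have : η a + 1 ≤ η a := Set.mem_iInter.1 ha (η a + 1)
      omega
    rwa [hempty, measure_empty] at h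
  have hlim := tendsto_setLIntegral_zero hlt.ne hμs
  obtain ⟨M, hM⟩ := (hlim.eventually (ge_mem_nhds hε)).exists
  refine ⟨M, ?_⟩
  -- Labels below `M` are decoded exactly at no cost. The merged label is resolved by the code `p`,
  -- whose cost is then paid only on the small set `s M`.
  refine (relCost_le (p := fun i j a => if i < M then (if j = i then 1 else 0) else p () j a)
    ⟨fun i j => ?_, fun i a => ?_⟩).trans (le_trans ?_ hM)
  · by_cases h : i < M <;> simp only [h, if_true, if_false]
    · exact measurable_const
    · exact hp.measurable () j
  · by_cases h : i < M
    · simp [h]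
    · simpa [h] using hp.tsum_le () a
  · rw [← lintegral_indicator (hs M)]
    refine lintegral_mono fun a => ?_
    by_cases h : η a < M
    · simp [h, min_eq_left h.le, codeLen_one]
    · have hmem : a ∈ s M := not_lt.1 h
      simp [h, hmem]

/-- A labelling which is decoded from `ξ` and `𝒮` off a set of measure at most `δ` costs little. -/
theorem relCost_le_of_decode {ι κ : Type*} [Fintype κ] [Nonempty κ] {ξ : α → ι} {η : α → κ}
    [IsProbabilityMeasure μ] (e : ι → α → κ) (he : ∀ i j, MeasurableSet[𝒮] {a | e i a = j})
    {δ : ℝ≥0∞} (hδ : δ ≤ 1) (hbad : μ {a | η a ≠ e (ξ a) a} ≤ δ) :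
    relCost 𝒮 μ ξ η ≤ codeLen (1 - δ) + δ * codeLen (δ / Fintype.card κ) := by
  classical
  -- The decoded symbol receives weight `1 - δ`, and mass `δ` is reserved for equal shares among all
  -- symbols.
  refine (relCost_le (p := fun i j a => if e i a = j then 1 - δ else δ / Fintype.card κ)
    ⟨fun i j => Measurable.ite (he i j) measurable_const measurable_const, fun i a => ?_⟩).trans ?_
  · rw [tsum_fintype]
    calc ∑ j, (if e i a = j then 1 - δ else δ / Fintype.card κ)
        ≤ ∑ j, ((if e i a = j then 1 - δ else 0) + δ / Fintype.card κ) := by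
          refine Finset.sum_le_sum fun j _ => ?_
          split_ifs <;> simp
      _ = 1 - δ + δ := by
          rw [Finset.sum_add_distrib]
          simp only [Finset.sum_ite_eq, Finset.mem_univ, if_true, Finset.sum_const,
            Finset.card_univ, nsmul_eq_mul]
          rw [ENNReal.mul_div_cancel (by simp) (by simp)]
      _ ≤ 1 := (tsub_add_cancel_of_le hδ).le
  · let t := toMeasurable μ {a | η a ≠ e (ξ a) a}
    have ht : MeasurableSet t := measurableSet_toMeasurable _ _
    calc ∫⁻ a, codeLen (if e (ξ a) a = η a then 1 - δ else δ / Fintype.card κ) ∂μ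
        ≤ ∫⁻ a, (codeLen (1 - δ) + t.indicator (fun _ => codeLen (δ / Fintype.card κ)) a) ∂μ := by
          refine lintegral_mono fun a => ?_
          by_cases h : e (ξ a) a = η a
          · simp [h]
          · have hat : a ∈ t := subset_toMeasurable _ _ (Ne.symm h)
            simp [h, hat]
      _ = codeLen (1 - δ) + codeLen (δ / Fintype.card κ) * μ t := by
          rw [lintegral_add_left measurable_const, lintegral_indicator_const ht]
          simp
      _ ≤ _ := by
          rw [measure_toMeasurable, mul_comm]
          gcongr

/-- The bound of `relCost_le_of_decode` is `-log (1 - d) + k * negMulLog (d / k)`, which is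
continuous at `0` and vanishes there. -/
theorem exists_decode_cost_le (k : ℕ) (hk : k ≠ 0) {ε : ℝ≥0∞} (hε : 0 < ε) :
    ∃ δ : ℝ≥0∞, 0 < δ ∧ δ ≤ 1 ∧ codeLen (1 - δ) + δ * codeLen (δ / k) ≤ ε := by
  have hk' : (0 : ℝ) < k := by positivity
  have hlim : Tendsto (fun d : ℝ => ENNReal.ofReal (-Real.log (1 - d)) +
      ENNReal.ofReal (k * Real.negMulLog (d / k))) (𝓝[>] 0) (𝓝 0) := by
    have h1 : ContinuousAt (fun d : ℝ => -Real.log (1 - d)) 0 :=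
      ((continuousAt_const.sub continuousAt_id).log (by simp)).neg
    have h2 : Continuous fun d : ℝ => k * Real.negMulLog (d / k) :=
      (Real.continuous_negMulLog.comp (continuous_id.div_const _)).const_mul _
    have h := (ENNReal.tendsto_ofReal h1.tendsto).add (ENNReal.tendsto_ofReal (h2.tendsto 0))
    simp only [sub_zero, Real.log_one, neg_zero, zero_div, Real.negMulLog_zero, mul_zero,
      ENNReal.ofReal_zero, add_zero] at h
    exact h.mono_left nhdsWithin_le_nhds
  obtain ⟨d, hd, hd0, hd1⟩ := ((hlim.eventually (ge_mem_nhds hε)).and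
    (Ioo_mem_nhdsGT (zero_lt_one (α := ℝ)))).exists
  refine ⟨ENNReal.ofReal d, ENNReal.ofReal_pos.2 hd0, ENNReal.ofReal_le_one.2 hd1.le,
    le_trans (le_of_eq ?_) hd⟩
  congr 1
  · rw [← ENNReal.ofReal_one, ← ENNReal.ofReal_sub _ hd0.le, codeLen_ofReal (by linarith)]
  · rw [← ENNReal.ofReal_natCast, ← ENNReal.ofReal_div_of_pos hk', codeLen_ofReal (by positivity),
      ← ENNReal.ofReal_mul hd0.le, Real.negMulLog]
    congr 1
    field_simp

end smallCost

/-! ### Invariant measures and projections of the product bundle -/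

namespace BundleRDS

variable {Ω : Type*} [MeasurableSpace Ω] {P : Measure Ω} {θ : Ω → Ω}

section basic

variable {X : Type*} [TopologicalSpace X] [MeasurableSpace X]
  {Y : Type*} [TopologicalSpace Y] [MeasurableSpace Y]

theorem measurable_base (T : BundleRDS P θ X) : Measurable fun p : T.carrier => p.1.1 :=
  measurable_fst.comp measurable_subtype_coe

theorem measurable_skew (T : BundleRDS P θ X) (hθ : Measurable θ) : Measurable T.skew :=
  Measurable.subtype_mk ((hθ.comp T.measurable_base).prodMk T.measurable_fiberMap)

theorem isProbabilityMeasure_toMeasure {T : BundleRDS P θ X} [IsProbabilityMeasure P]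
    (μ : T.InvMeasure) : IsProbabilityMeasure μ.toMeasure := by
  refine ⟨?_⟩
  have h : (μ.toMeasure.map fun p => p.1.1) Set.univ = 1 := by
    rw [μ.marginal]; exact measure_univ
  rwa [Measure.map_apply T.measurable_base MeasurableSet.univ, Set.preimage_univ] at h

theorem ae_of_ae_base {T : BundleRDS P θ X} (μ : T.InvMeasure) {p : Ω → Prop}
    (hp : ∀ᵐ ω ∂P, p ω) : ∀ᵐ z ∂μ.toMeasure, p z.1.1 := by
  rw [← μ.marginal] at hp
  exact ae_of_ae_map T.measurable_base.aemeasurable hp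

theorem lintegral_base {T : BundleRDS P θ X} (μ : T.InvMeasure) {g : Ω → ℝ≥0∞}
    (hg : Measurable g) : ∫⁻ z, g z.1.1 ∂μ.toMeasure = ∫⁻ ω, g ω ∂P := by
  have h := lintegral_map (μ := μ.toMeasure) hg T.measurable_base
  rw [μ.marginal] at h
  exact h.symm

theorem ae_forall_iterate {T : BundleRDS P θ X} (μ : T.InvMeasure) {p : T.carrier → Prop}
    (hp : ∀ᵐ z ∂μ.toMeasure, p z) : ∀ᵐ z ∂μ.toMeasure, ∀ n, p (T.skew^[n] z) :=
  ae_all_iff.2 fun n => (μ.invariant.iterate n).quasiMeasurePreserving.ae hp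

variable (S : BundleRDS P θ Y) (T : BundleRDS P θ X)

theorem measurable_projLeft : Measurable (projLeft S T) :=
  Measurable.subtype_mk ((measurable_fst.comp measurable_subtype_coe).prodMk
    (measurable_fst.comp (measurable_snd.comp measurable_subtype_coe)))

theorem leftSigma_le : leftSigma S T ≤ Subtype.instMeasurableSpace :=
  (measurable_projLeft S T).comap_le

theorem measurable_leftSigma_projLeft : Measurable[leftSigma S T] (projLeft S T) :=
  comap_measurable _

theorem measurable_leftSigma_base :
    Measurable[leftSigma S T] fun z : (S.prod T).carrier => z.1.1 :=
  S.measurable_base.comp (measurable_leftSigma_projLeft S T)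

theorem measurable_leftSigma_skew (hθ : Measurable θ) :
    Measurable[leftSigma S T, leftSigma S T] (S.prod T).skew := by
  rw [measurable_comap_iff]
  exact (S.measurable_skew hθ).comp (measurable_leftSigma_projLeft S T)

/-- The projection `(ω, y, x) ↦ (ω, x)` of the product bundle onto the bundle of `T`. -/
def projRight (p : (S.prod T).carrier) : T.carrier := ⟨(p.1.1, p.1.2.2), p.2.2⟩

theorem measurable_projRight : Measurable (projRight S T) :=
  Measurable.subtype_mk ((measurable_fst.comp measurable_subtype_coe).prodMk
    (measurable_snd.comp (measurable_snd.comp measurable_subtype_coe)))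

theorem projRight_skew_iterate (n : ℕ) (z : (S.prod T).carrier) :
    projRight S T ((S.prod T).skew^[n] z) = T.skew^[n] (projRight S T z) :=
  (Function.Semiconj.iterate_right (f := projRight S T) (fun _ => rfl) n).eq z

theorem measurableSet_iterCover (hθ : Measurable θ) {k : ℕ} {U : Fin k → Set T.carrier}
    (hU : ∀ j, MeasurableSet (U j)) (n : ℕ) (a : Fin n → Fin k) :
    MeasurableSet (T.iterCover U n a) :=
  MeasurableSet.iInter fun i => ((T.measurable_skew hθ).iterate i) (hU (a i))

theorem IsOpenRandomCover.measurableSet {T : BundleRDS P θ X} {k : ℕ} {U : Fin k → Set T.carrier}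
    (hU : T.IsOpenRandomCover U) (j : Fin k) : MeasurableSet (U j) :=
  MeasurableSet.compl_iff.1 (hU.isClosedRandomSet_compl j).measurableSet

theorem iUnion_iterCover {k : ℕ} {U : Fin k → Set T.carrier} (hU : ⋃ j, U j = Set.univ) (n : ℕ) :
    ⋃ a, T.iterCover U n a = Set.univ := by
  refine Set.eq_univ_of_forall fun p => ?_
  have h : ∀ q, ∃ j, q ∈ U j := fun q => Set.mem_iUnion.1 (hU ▸ Set.mem_univ q)
  choose g hg using h
  exact Set.mem_iUnion.2 ⟨fun i => g (T.skew^[i] p), Set.mem_iInter.2 fun i => hg _⟩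

end basic

/-! ### Measurability of covering numbers, and codes built from covers -/

section counting

variable {X : Type*} [TopologicalSpace X] [MeasurableSpace X]
  {Y : Type*} [TopologicalSpace Y] [MeasurableSpace Y]

/-- The set is a projection to `Ω`, so completeness of `P` enters through the projection theorem. -/
theorem measurableSet_sect_nonempty [PolishSpace X] [BorelSpace X] [IsFiniteMeasure P]
    [P.IsComplete] (T : BundleRDS P θ X)
    {A : Set T.carrier} (hA : MeasurableSet A) : MeasurableSet {ω | (T.sect A ω).Nonempty} := by
  have h : {ω | (T.sect A ω).Nonempty} = Prod.fst '' (Subtype.val '' A) := by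
    ext ω
    constructor
    · rintro ⟨x, hx⟩
      exact ⟨_, ⟨_, hx, rfl⟩, rfl⟩
    · rintro ⟨_, ⟨p, hp, rfl⟩, rfl⟩
      exact ⟨⟨p.1.2, p.2⟩, hp⟩
  rw [h]
  exact measurableSet_image_fst P (T.measurableSet_carrier.subtype_image hA)

/-- The families of members of `R` covering `A` over `ω`. -/
def coveringFamilies (T : BundleRDS P θ X) {ι : Type*} (A : Set T.carrier) (R : ι → Set T.carrier)
    (ω : Ω) : Set (Finset ι) :=
  {J | T.sect A ω ⊆ ⋃ j ∈ J, T.sect (R j) ω}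

/-- For finite `ι` the target is a finite discrete space, so covering numbers and the choice of a
minimal subcover, being functions of this collection, inherit measurability in `ω`. -/
theorem measurable_coveringFamilies [PolishSpace X] [BorelSpace X] [IsFiniteMeasure P]
    [P.IsComplete] (T : BundleRDS P θ X)
    {ι : Type*} {A : Set T.carrier} (hA : MeasurableSet A)
    {R : ι → Set T.carrier} (hR : ∀ j, MeasurableSet (R j)) :
    Measurable (T.coveringFamilies A R) := by
  refine measurable_set_iff.2 fun J => measurableSet_setOfPred.1 ?_
  have h : {ω | J ∈ T.coveringFamilies A R ω} =
      {ω | (T.sect (A \ ⋃ j ∈ J, R j) ω).Nonempty}ᶜ := by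
    ext ω
    simp only [coveringFamilies, sect, Set.mem_compl_iff, Set.preimage_sdiff,
      Set.preimage_iUnion, Set.mem_ofPred_eq, Set.not_nonempty_iff_eq_empty, Set.sdiff_eq_empty]
  rw [h]
  exact (T.measurableSet_sect_nonempty (hA.diff
    (Finset.measurableSet_biUnion J fun j _ => hR j))).compl

/-- The cardinality of a smallest member of a collection of finite sets. -/
def minCard {ι : Type*} (𝒥 : Set (Finset ι)) : ℕ := sInf {c | ∃ J ∈ 𝒥, J.card = c}

open Classical in
/-- A smallest member of a collection of finite sets. -/
def minFamily {ι : Type*} (𝒥 : Set (Finset ι)) : Finset ι :=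
  if h : 𝒥.Nonempty then
    (Nat.sInf_mem (s := {c | ∃ J ∈ 𝒥, J.card = c}) ⟨_, h.some, h.some_mem, rfl⟩).choose
  else ∅

theorem minFamily_mem {ι : Type*} {𝒥 : Set (Finset ι)} (h : 𝒥.Nonempty) : minFamily 𝒥 ∈ 𝒥 := by
  rw [minFamily, dif_pos h]
  exact (Nat.sInf_mem (s := {c | ∃ J ∈ 𝒥, J.card = c}) ⟨_, h.some, h.some_mem, rfl⟩).choose_spec.1

theorem card_minFamily {ι : Type*} (𝒥 : Set (Finset ι)) : (minFamily 𝒥).card ≤ minCard 𝒥 := by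
  by_cases h : 𝒥.Nonempty
  · rw [minFamily, dif_pos h]
    exact (Nat.sInf_mem
      (s := {c | ∃ J ∈ 𝒥, J.card = c}) ⟨_, h.some, h.some_mem, rfl⟩).choose_spec.2.le
  · simp [minFamily, h]

open Classical in
-- An empty section is detected by the empty family being a covering one, so even the convention `1`
-- depends only on the collection of covering families.
theorem coverNumber_eq (T : BundleRDS P θ X) {ι : Type*} (A : Set T.carrier)
    (R : ι → Set T.carrier) (ω : Ω) :
    T.coverNumber A R ω = if ∅ ∈ T.coveringFamilies A R ω then 1
      else minCard (T.coveringFamilies A R ω) := by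
  have h : ∅ ∈ T.coveringFamilies A R ω ↔ ¬(T.sect A ω).Nonempty := by
    simp [coveringFamilies, Set.not_nonempty_iff_eq_empty]
  rw [coverNumber]
  by_cases hA : (T.sect A ω).Nonempty
  · rw [if_pos hA, if_neg (by rw [h]; simpa using hA), minCard]
    congr 1
    ext c
    exact exists_congr fun J => and_comm
  · rw [if_neg hA, if_pos (h.2 hA)]

theorem measurable_coverNumber [PolishSpace X] [BorelSpace X] [IsFiniteMeasure P]
    [P.IsComplete] (T : BundleRDS P θ X)
    {ι : Type*} [Finite ι] {A : Set T.carrier} (hA : MeasurableSet A)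
    {R : ι → Set T.carrier} (hR : ∀ j, MeasurableSet (R j)) : Measurable (T.coverNumber A R) := by
  classical
  have h : T.coverNumber A R =
      (fun 𝒥 : Set (Finset ι) => if ∅ ∈ 𝒥 then 1 else minCard 𝒥) ∘ T.coveringFamilies A R :=
    funext fun ω => T.coverNumber_eq A R ω
  rw [h]
  exact (Measurable.of_discrete).comp (T.measurable_coveringFamilies hA hR)

theorem measurable_condCoverNumber [PolishSpace X] [BorelSpace X] [IsFiniteMeasure P]
    [P.IsComplete] (T : BundleRDS P θ X)
    {ι κ : Type*} [Finite ι] [Fintype κ] {Q : κ → Set T.carrier} (hQ : ∀ j, MeasurableSet (Q j))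
    {R : ι → Set T.carrier} (hR : ∀ j, MeasurableSet (R j)) :
    Measurable (T.condCoverNumber R Q) := by
  exact (Measurable.of_discrete (f := fun v : κ → ℕ => Finset.univ.sup v)).comp
    (measurable_pi_lambda _ fun q => T.measurable_coverNumber (hQ q) hR)

theorem card_minFamily_coveringFamilies_le (T : BundleRDS P θ X) {ι κ : Type*} [Fintype κ]
    (Q : κ → Set T.carrier) (R : ι → Set T.carrier) (q : κ) (ω : Ω) :
    (minFamily (T.coveringFamilies (Q q) R ω)).card ≤ T.condCoverNumber R Q ω := by
  classical
  refine le_trans ?_ (Finset.le_sup (f := fun q => T.coverNumber (Q q) R ω) (Finset.mem_univ q))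
  refine (card_minFamily _).trans ?_
  rw [coverNumber_eq]
  split_ifs with h
  · have h0 : 0 ∈ {c | ∃ J ∈ T.coveringFamilies (Q q) R ω, J.card = c} := ⟨∅, h, rfl⟩
    exact (Nat.sInf_le h0).trans zero_le_one
  · exact le_rfl

/-- Given the itineraries through the cover `Q` and the visits to the domain of the partial
labelling `κ`, the itinerary of `κ` is described by choosing a member of the cover `R`. -/
theorem relCost_itinerary_le_condCoverNumber [PolishSpace X] [BorelSpace X]
    [IsProbabilityMeasure P] [P.IsComplete]
    (hθ : Measurable θ) (T : BundleRDS P θ X) (S : BundleRDS P θ Y) (μ : (S.prod T).InvMeasure)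
    {k l : ℕ} {R : Fin k → Set T.carrier} {Q : Fin l → Set T.carrier}
    (hR : ∀ j, MeasurableSet (R j)) (hQ : ∀ j, MeasurableSet (Q j)) (hRU : ⋃ j, R j = Set.univ)
    {ζ : (S.prod T).carrier → Fin l} (hζ : ∀ᵐ z ∂μ.toMeasure, projRight S T z ∈ Q (ζ z))
    {κ : (S.prod T).carrier → Option (Fin k)}
    (hκ : ∀ z i j, projRight S T z ∈ R i → κ z = some j → i = j) (n : ℕ) :
    relCost (leftSigma S T) μ.toMeasure
      (fun z => (itinerary (S.prod T).skew ζ n z,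
        itinerary (S.prod T).skew (fun z => (κ z).isSome) n z))
      (itinerary (S.prod T).skew κ n) ≤
    ∫⁻ ω, ENNReal.ofReal
      (Real.log (T.condCoverNumber (T.iterCover R n) (T.iterCover Q n) ω)) ∂P := by
  classical
  have hRn := T.measurableSet_iterCover hθ hR n
  have hQn := T.measurableSet_iterCover hθ hQ n
  let N : Ω → ℕ := T.condCoverNumber (T.iterCover R n) (T.iterCover Q n)
  have hN : Measurable N := T.measurable_condCoverNumber hQn hRn
  let J : (Fin n → Fin l) → Ω → Finset (Fin n → Fin k) := fun a ω =>
    minFamily (T.coveringFamilies (T.iterCover Q n a) (T.iterCover R n) ω)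
  have hJN : ∀ a ω, (J a ω).card ≤ N ω := fun a ω =>
    T.card_minFamily_coveringFamilies_le _ _ a ω
  have hJ : ∀ a ω, T.sect (T.iterCover Q n a) ω ⊆ ⋃ j ∈ J a ω, T.sect (T.iterCover R n j) ω := by
    intro a ω
    refine minFamily_mem (𝒥 := T.coveringFamilies (T.iterCover Q n a) (T.iterCover R n) ω)
      ⟨Finset.univ, fun x _ => ?_⟩
    have hx : T.incl ω x ∈ ⋃ a, T.iterCover R n a := by
      rw [T.iUnion_iterCover hRU]; trivial
    obtain ⟨b, hb⟩ := Set.mem_iUnion.1 hx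
    exact Set.mem_biUnion (Finset.mem_univ b) hb
  -- The decoder: at a time when `κ` is defined, `hκ` forces its value to be the index of any member
  -- of `R` containing the point.
  let g : (Fin n → Bool) → (Fin n → Fin k) → Fin n → Option (Fin k) := fun r j i =>
    if r i then some (j i) else none
  have hset : ∀ a r b, MeasurableSet {ω | b ∈ (J a ω).image (g r)} := by
    intro a r b
    have h : Measurable ((fun 𝒥 : Set (Finset (Fin n → Fin k)) => b ∈ (minFamily 𝒥).image (g r)) ∘
        T.coveringFamilies (T.iterCover Q n a) (T.iterCover R n)) :=
      Measurable.of_discrete.comp (T.measurable_coveringFamilies (hQn a) hRn)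
    exact measurableSet_setOfPred.2 h
  have hNinv : Measurable fun ω => ((N ω : ℝ≥0∞))⁻¹ :=
    (Measurable.of_discrete (f := fun m : ℕ => (m : ℝ≥0∞)⁻¹)).comp hN
  -- Uniform weights `1 / N ω` on the words decoded from the minimal subcover; they depend on the
  -- point only through `ω`.
  refine (relCost_le (p := fun ar b z => if b ∈ (J ar.1 z.1.1).image (g ar.2) then
    (N z.1.1 : ℝ≥0∞)⁻¹ else 0) ⟨fun ar b => ?_, fun ar z => ?_⟩).trans ?_
  · exact (Measurable.ite (hset ar.1 ar.2 b) hNinv measurable_const).comp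
      (measurable_leftSigma_base S T)
  · rw [tsum_fintype, ← Finset.sum_filter, Finset.sum_const, nsmul_eq_mul]
    have hcard : (Finset.univ.filter fun b => b ∈ (J ar.1 z.1.1).image (g ar.2)).card ≤ N z.1.1 := by
      simp only [Finset.filter_mem_eq_inter, Finset.univ_inter]
      exact Finset.card_image_le.trans (hJN _ _)
    refine le_trans (mul_le_mul_left (Nat.cast_le.2 hcard) _) ?_
    exact ENNReal.mul_inv_le_one _
  · have hlog : Measurable fun ω => ENNReal.ofReal (Real.log (N ω)) :=
      (Measurable.of_discrete (f := fun m : ℕ => ENNReal.ofReal (Real.log m))).comp hN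
    rw [← lintegral_base μ hlog]
    refine lintegral_mono_ae ?_
    filter_upwards [ae_forall_iterate μ hζ] with z hz
    have hzQ : (⟨z.1.2.2, z.2.2⟩ : T.Fiber z.1.1) ∈
        T.sect (T.iterCover Q n (itinerary (S.prod T).skew ζ n z)) z.1.1 := by
      refine Set.mem_iInter.2 fun i => ?_
      have := hz i
      rw [projRight_skew_iterate] at this
      exact this
    obtain ⟨j, hjJ, hj⟩ := Set.mem_iUnion₂.1 (hJ _ _ hzQ)
    have hgj : itinerary (S.prod T).skew κ n z =
        g (itinerary (S.prod T).skew (fun z => (κ z).isSome) n z) j := by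
      funext i
      have hi : projRight S T ((S.prod T).skew^[i] z) ∈ R (j i) := by
        rw [projRight_skew_iterate]
        exact Set.mem_iInter.1 hj i
      simp only [itinerary, g]
      rcases Option.eq_none_or_eq_some (κ ((S.prod T).skew^[i] z)) with h | ⟨b, h⟩
      · simp [h]
      · simp [h, hκ _ _ _ hi h]
    have hmem : itinerary (S.prod T).skew κ n z ∈
        (J (itinerary (S.prod T).skew ζ n z) z.1.1).image
          (g (itinerary (S.prod T).skew (fun z => (κ z).isSome) n z)) := by
      rw [hgj]
      exact Finset.mem_image_of_mem _ hjJ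
    have hN0 : N z.1.1 ≠ 0 :=
      ((Finset.card_pos.2 ⟨j, hjJ⟩).trans_le (hJN _ _)).ne'
    simp only [hmem, if_true]
    exact (codeLen_inv_natCast hN0).le

end counting

end BundleRDS

/-! ### Entropy bounded through a partition subordinate to a cover -/

theorem limsup_add_le_ennreal {β : Type*} {F : Filter β} (u v : β → ℝ≥0∞) :
    limsup (fun b => u b + v b) F ≤ limsup u F + limsup v F := by
  rcases eq_or_ne (limsup u F) ∞ with hu | hu
  · simp [hu]
  rcases eq_or_ne (limsup v F) ∞ with hv | hv
  · simp [hv]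
  refine ENNReal.le_of_forall_pos_le_add fun ε hε _ => ?_
  have hε2 : (ε : ℝ≥0∞) / 2 ≠ 0 := (ENNReal.half_pos (by simpa using hε.ne')).ne'
  have h1 := eventually_lt_of_limsup_lt (ENNReal.lt_add_right hu hε2)
  have h2 := eventually_lt_of_limsup_lt (ENNReal.lt_add_right hv hε2)
  refine limsup_le_of_le (by isBoundedDefault) ?_
  filter_upwards [h1, h2] with b hb1 hb2
  calc u b + v b ≤ (limsup u F + ε / 2) + (limsup v F + ε / 2) := add_le_add hb1.le hb2.le
    _ = limsup u F + limsup v F + (ε / 2 + ε / 2) := by ring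
    _ = limsup u F + limsup v F + ε := by rw [ENNReal.add_halves]

/-- A finite labelling of `Z × X` is determined, off a small set, by the first coordinate and a
partial labelling of `X` with compact level sets. -/
theorem exists_compact_labelling {Z X : Type*} [MeasurableSpace Z] [TopologicalSpace X]
    [PolishSpace X] [MeasurableSpace X] [BorelSpace X] [Nonempty X] (ν : Measure (Z × X))
    [IsFiniteMeasure ν] {r : ℕ} {η : Z × X → Fin (r + 1)} (hη : Measurable η) {δ : ℝ≥0∞}
    (hδ : 0 < δ) :
    ∃ (k : ℕ) (κ : X → Option (Fin k)) (e : Option (Fin k) → Z → Fin (r + 1)), 0 < k ∧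
      (∀ i, IsCompact (κ ⁻¹' {some i})) ∧ (∀ i, Measurable (e i)) ∧
      ν {p | κ p.2 = none} ≤ δ ∧ ν {p | η p ≠ e (κ p.2) p.1} ≤ δ := by
  classical
  -- Half of `δ` pays for approximating the level sets of `η`, the other half for shrinking the
  -- cells of `X` to compact sets.
  have hδ2 : δ / 2 ≠ 0 := (ENNReal.half_pos hδ.ne').ne'
  obtain ⟨ε, hε, hεsum⟩ := ENNReal.exists_pos_sum_of_countable' hδ2 (Fin (r + 1))
  choose ι hι κ D hκ hD hBD using fun j =>
    exists_partition_approx ν (hη (measurableSet_singleton j)) (hε j)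
  let I := ∀ j, ι j
  let k := Fintype.card I
  let E : I ≃ Fin k := Fintype.equivFin I
  let κ₀ : X → Fin k := fun x => E fun j => κ j x
  have hκ₀ : ∀ i, MeasurableSet (κ₀ ⁻¹' {i}) := by
    intro i
    have h : κ₀ ⁻¹' {i} = ⋂ j, κ j ⁻¹' {E.symm i j} := by
      ext x
      simp only [κ₀, Set.mem_preimage, Set.mem_singleton_iff, Set.mem_iInter, ← E.eq_symm_apply]
      exact funext_iff
    rw [h]
    exact MeasurableSet.iInter fun j => hκ j _
  obtain ⟨ε', hε', hεsum'⟩ := ENNReal.exists_pos_sum_of_countable' hδ2 (Fin k)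
  choose K hKsub hKc hKlt using fun i => (hκ₀ i).exists_isCompact_sdiff_lt
    (μ := ν.map Prod.snd) (measure_ne_top _ _) (hε' i).ne'
  let κ₁ : X → Option (Fin k) := fun x => if x ∈ K (κ₀ x) then some (κ₀ x) else none
  have hκ₁ : ∀ i, κ₁ ⁻¹' {some i} = K i := by
    intro i
    ext x
    simp only [κ₁, Set.mem_preimage, Set.mem_singleton_iff]
    constructor
    · intro h
      split_ifs at h with hx
      rwa [Option.some.inj h] at hx
    · intro hx
      have : κ₀ x = i := hKsub i hx
      rw [this, if_pos hx]
  -- The approximating sets need not be disjoint or cover. The label is read off when exactly one of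
  -- them contains the point, and is `0` otherwise.
  let dec : Set (Fin (r + 1)) → Fin (r + 1) := fun s =>
    if h : ∃ j, s = {j} then h.choose else 0
  have hdec : ∀ j, dec {j} = j := by
    intro j
    have h : ∃ j', ({j} : Set (Fin (r + 1))) = {j'} := ⟨j, rfl⟩
    simp only [dec, dif_pos h]
    exact (Set.singleton_injective h.choose_spec).symm
  let e₀ : Fin k → Z → Fin (r + 1) := fun i z => dec {j | z ∈ D j (E.symm i j)}
  have he₀ : ∀ i, Measurable (e₀ i) := fun i =>
    (Measurable.of_discrete (f := dec)).comp (measurable_set_iff.2 fun j =>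
      measurableSet_setOfPred.1 (hD j _))
  have hnone : ν {p | κ₁ p.2 = none} ≤ δ / 2 := by
    refine (measure_mono (t := ⋃ i, Prod.snd ⁻¹' (κ₀ ⁻¹' {i} \ K i)) fun p hp => ?_).trans
      ((measure_iUnion_le _).trans ((ENNReal.tsum_le_tsum fun i => ?_).trans hεsum'.le))
    · refine Set.mem_iUnion.2 ⟨κ₀ p.2, rfl, fun h => ?_⟩
      have hp' : κ₁ p.2 = none := hp
      simp [κ₁, h] at hp'
    · rw [← Measure.map_apply measurable_snd ((hκ₀ i).diff (hKc i).measurableSet)]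
      exact (hKlt i).le
  have hbad : ν {p | η p ≠ e₀ (κ₀ p.2) p.1} ≤ δ / 2 := by
    refine (measure_mono (t := ⋃ j, symmDiff {p : Z × X | p.1 ∈ D j (κ j p.2)} (η ⁻¹' {j}))
      fun p hp => ?_).trans
      ((measure_iUnion_le _).trans ((ENNReal.tsum_le_tsum fun j => (hBD j).le).trans hεsum.le))
    by_contra hcon
    refine hp ?_
    have hiff : ∀ j, p.1 ∈ D j (κ j p.2) ↔ η p = j := by
      intro j
      by_contra hne
      refine hcon (Set.mem_iUnion.2 ⟨j, Set.mem_symmDiff.2 ?_⟩)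
      by_cases h1 : p.1 ∈ D j (κ j p.2) <;> by_cases h2 : η p = j
      · exact absurd (iff_of_true h1 h2) hne
      · exact Or.inl ⟨h1, h2⟩
      · exact Or.inr ⟨h2, h1⟩
      · exact absurd (iff_of_false h1 h2) hne
    have hs : {j | p.1 ∈ D j (E.symm (κ₀ p.2) j)} = {η p} := by
      ext j
      simp only [κ₀, Equiv.symm_apply_apply, Set.mem_ofPred_eq, Set.mem_singleton_iff]
      rw [hiff j, eq_comm]
    change η p = dec _
    rw [hs, hdec]
  refine ⟨k, κ₁, fun o => o.elim (fun _ => 0) e₀, (κ₀ (Classical.arbitrary X)).pos,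
    fun i => hκ₁ i ▸ hKc i, ?_, hnone.trans ENNReal.half_le_self, ?_⟩
  · rintro (_ | i)
    · exact measurable_const
    · exact he₀ i
  · refine (measure_mono (t := {p | κ₁ p.2 = none} ∪ {p | η p ≠ e₀ (κ₀ p.2) p.1})
      fun p hp => ?_).trans ((measure_union_le _ _).trans
      ((add_le_add hnone hbad).trans (ENNReal.add_halves δ).le))
    by_cases h : κ₁ p.2 = none
    · exact Or.inl h
    · refine Or.inr ?_
      have hK : p.2 ∈ K (κ₀ p.2) := by
        by_contra h'
        exact h (if_neg h')
      have hsome : κ₁ p.2 = some (κ₀ p.2) := if_pos hK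
      have hp' : η p ≠ (κ₁ p.2).elim (fun _ => 0) e₀ p.1 := hp
      rw [hsome] at hp'
      exact hp'

namespace BundleRDS

variable {Ω : Type*} [MeasurableSpace Ω] {P : Measure Ω} {θ : Ω → Ω}
  {X : Type*} [TopologicalSpace X] [MeasurableSpace X]
  {Y : Type*} [TopologicalSpace Y] [MeasurableSpace Y]

/-- The open random cover attached to a partial labelling with compact level sets: its `i`-th member
consists of the points whose label is `i` or undefined. -/
theorem isOpenRandomCover_of_compact_labelling [PolishSpace X] [BorelSpace X]
    [IsFiniteMeasure P] [P.IsComplete]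
    (T : BundleRDS P θ X) {k : ℕ} (hk : 0 < k) {κ : X → Option (Fin k)}
    (hκ : ∀ i, IsCompact (κ ⁻¹' {some i})) :
    T.IsOpenRandomCover fun i : Fin k => {p : T.carrier | ∀ j, κ p.1.2 = some j → i = j} := by
  refine ⟨fun i => ?_, Set.eq_univ_of_forall fun p => Set.mem_iUnion.2 ?_⟩
  · let K : Set X := ⋃ j ∈ {j : Fin k | i ≠ j}, κ ⁻¹' {some j}
    have hK : IsCompact K := (Set.toFinite _).isCompact_biUnion fun j _ => hκ j
    have hmeas : Measurable fun p : T.carrier => p.1.2 := measurable_snd.comp measurable_subtype_coe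
    have hC : {p : T.carrier | ∀ j, κ p.1.2 = some j → i = j}ᶜ = (fun p => p.1.2) ⁻¹' K := by
      ext p
      simp only [K, Set.mem_compl_iff, Set.mem_ofPred_eq, Set.mem_preimage, Set.mem_iUnion,
        Set.mem_singleton_iff]
      push Not
      simp only [exists_prop, and_comm]
    rw [hC]
    refine ⟨hmeas hK.measurableSet, Eventually.of_forall fun ω => ?_, fun O hO => ?_⟩
    · exact hK.isClosed.preimage continuous_subtype_val
    · exact T.measurableSet_sect_nonempty
        (A := (fun p => p.1.2) ⁻¹' (K ∩ O)) (hmeas (hK.measurableSet.inter hO.measurableSet))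
  · by_cases h : ∃ j, κ p.1.2 = some j
    · obtain ⟨j, hj⟩ := h
      exact ⟨j, fun j' hj' => Option.some.inj (hj.symm.trans hj')⟩
    · exact ⟨⟨0, hk⟩, fun j hj => absurd ⟨j, hj⟩ h⟩

theorem measurableEmbedding_assoc (S : BundleRDS P θ Y) (T : BundleRDS P θ X) :
    MeasurableEmbedding fun z : (S.prod T).carrier => ((z.1.1, z.1.2.1), z.1.2.2) :=
  (MeasurableEquiv.prodAssoc (α := Ω) (β := Y) (γ := X)).symm.measurableEmbedding.comp
    (MeasurableEmbedding.subtype_coe (S.prod T).measurableSet_carrier)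

/-- A countable partition `η` is truncated to a finite `η'`, which is decoded with few errors from
`(ω, y)` and a partial labelling `κ` of `X` with compact level sets. The itinerary of `η` is
described in stages: that of `ζ`, the times when `κ` is defined, the itinerary of `κ` by means of
the cover `R` attached to it, and finally `η` itself. The second and last stages cost at most `n *
ε` together; the third contributes the covering numbers of `R` relative to `Q`. -/
theorem relEntropy_le_partitionEntropy_add [PolishSpace X] [BorelSpace X]
    [IsProbabilityMeasure P] [P.IsComplete]
    (hθ : Measurable θ) (T : BundleRDS P θ X) (S : BundleRDS P θ Y) (μ : (S.prod T).InvMeasure)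
    {l : ℕ} {Q : Fin l → Set T.carrier} (hQ : ∀ j, MeasurableSet (Q j))
    {ζ : (S.prod T).carrier → Fin l} (hζm : Measurable ζ)
    (hζ : ∀ᵐ z ∂μ.toMeasure, projRight S T z ∈ Q (ζ z)) :
    (S.prod T).relEntropy (leftSigma S T) μ ≤
      partitionEntropy (leftSigma S T) μ.toMeasure (S.prod T).skew ζ +
      ⨆ (k : ℕ) (R : Fin k → Set T.carrier) (_ : T.IsOpenRandomCover R),
        T.tailEntropyCovers R Q := by
  have := isProbabilityMeasure_toMeasure μ
  have h𝒮 := leftSigma_le S T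
  have hf𝒮 := measurable_leftSigma_skew S T hθ
  have hf := μ.invariant
  obtain ⟨z₀⟩ : Nonempty (S.prod T).carrier := nonempty_of_isProbabilityMeasure μ.toMeasure
  have : Nonempty X := ⟨z₀.1.2.2⟩
  refine iSup_le fun η => iSup₂_le fun hη hfin => ?_
  refine ENNReal.le_of_forall_pos_le_add fun ε hε _ => ?_
  have hε3 : 0 < (ε : ℝ≥0∞) / 3 := ENNReal.div_pos (by simpa using hε.ne') (by simp)
  obtain ⟨M, hM⟩ := exists_relCost_min_le h𝒮 hη hfin hε3
  let η' : (S.prod T).carrier → Fin (M + 1) := fun z => ⟨min (η z) M, by omega⟩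
  have hη' : Measurable η' := (Measurable.of_discrete
    (f := fun m : ℕ => (⟨min m M, by omega⟩ : Fin (M + 1)))).comp hη
  obtain ⟨δ₁, hδ₁, hδ₁1, hcost₁⟩ := exists_decode_cost_le (M + 1) (by omega) hε3
  obtain ⟨δ₂, hδ₂, hδ₂1, hcost₂⟩ := exists_decode_cost_le 2 (by omega) hε3
  have hemb := measurableEmbedding_assoc S T
  -- The labelling is extended from the bundle to all of `(Ω × Y) × X`, on which the approximation
  -- by partitions of `X` takes place.
  obtain ⟨g, hg, hgη⟩ := hemb.exists_measurable_extend hη' fun _ => ⟨0⟩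
  let ν := μ.toMeasure.map fun z : (S.prod T).carrier => ((z.1.1, z.1.2.1), z.1.2.2)
  have : IsFiniteMeasure ν := by infer_instance
  obtain ⟨k, κ, e, hk, hκ, he, hnone, hbad⟩ := exists_compact_labelling ν hg (lt_min hδ₁ hδ₂)
  let : MeasurableSpace (Option (Fin k)) := ⊤
  have : DiscreteMeasurableSpace (Option (Fin k)) := ⟨fun _ => trivial⟩
  have hκm : Measurable κ := by
    refine measurable_to_countable' fun o => ?_
    have hsome : ∀ i, MeasurableSet (κ ⁻¹' {some i}) := fun i => (hκ i).measurableSet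
    rcases o with _ | i
    · have h : κ ⁻¹' {none} = (⋃ i, κ ⁻¹' {some i})ᶜ := by
        ext x
        simp only [Set.mem_preimage, Set.mem_singleton_iff, Set.mem_compl_iff, Set.mem_iUnion]
        exact Option.eq_none_iff_forall_ne_some.trans (by simp)
      rw [h]
      exact (MeasurableSet.iUnion hsome).compl
    · exact hsome i
  let κH : (S.prod T).carrier → Option (Fin k) := fun z => κ z.1.2.2
  have hκH : Measurable κH := hκm.comp
    (measurable_snd.comp (measurable_snd.comp measurable_subtype_coe))
  let R : Fin k → Set T.carrier := fun i => {p | ∀ j, κ p.1.2 = some j → i = j}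
  have hR : T.IsOpenRandomCover R := T.isOpenRandomCover_of_compact_labelling hk hκ
  have hρm : Measurable fun z => (κH z).isSome :=
    (Measurable.of_discrete (f := Option.isSome)).comp hκH
  -- Since `κ` is undefined with probability at most `δ₂`, the constant guess `true` is a good
  -- decoder.
  have hρ : relCost (leftSigma S T) μ.toMeasure (fun _ => ()) (fun z => (κH z).isSome) ≤ ε / 3 := by
    refine (relCost_le_of_decode (fun _ _ => true) (fun _ j => ?_) hδ₂1 ?_).trans
      (by simpa using hcost₂)
    · exact MeasurableSet.const _
    · rw [hemb.map_apply] at hnone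
      refine le_trans (le_of_eq ?_) (hnone.trans (min_le_right _ _))
      congr 1
      ext z
      simp [κH]
  have hη'κ : relCost (leftSigma S T) μ.toMeasure κH η' ≤ ε / 3 := by
    refine (relCost_le_of_decode (fun i z => e i (z.1.1, z.1.2.1)) (fun i j => ?_) hδ₁1 ?_).trans
      (by simpa using hcost₁)
    · exact ((he i).comp (measurable_subtype_coe.comp (measurable_leftSigma_projLeft S T)))
        (measurableSet_singleton j)
    · rw [hemb.map_apply] at hbad
      refine le_trans (le_of_eq ?_) (hbad.trans (min_le_left _ _))
      congr 1
      ext z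
      simp [κH, ← hgη]
  have hηη' : relCost (leftSigma S T) μ.toMeasure η' η ≤ ε / 3 :=
    (relCost_le_comp η' η Fin.val).trans hM
  have hηκ : relCost (leftSigma S T) μ.toMeasure κH η ≤ ε / 3 + ε / 3 :=
    (relCost_trans_le h𝒮 hκH hη' η).trans (add_le_add hη'κ hηη')
  let t : ℕ → ℝ≥0∞ := fun n => ∫⁻ ω, ENNReal.ofReal
    (Real.log (T.condCoverNumber (T.iterCover R n) (T.iterCover Q n) ω)) ∂P
  have hmain : ∀ n : ℕ, condEntropy (leftSigma S T) μ.toMeasure (itinerary (S.prod T).skew η n) ≤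
      condEntropy (leftSigma S T) μ.toMeasure (itinerary (S.prod T).skew ζ n) + n * (ε / 3) +
      t n + n * (ε / 3 + ε / 3) := by
    intro n
    refine (condEntropy_itinerary_le_add h𝒮 hf hf𝒮 hζm
      hρm hκH hη n).trans ?_
    gcongr
    exact relCost_itinerary_le_condCoverNumber hθ T S μ hR.measurableSet hQ hR.cover hζ
      (κ := κH) (fun z i j hi hj => hi j hj) n
  have hlim : partitionEntropy (leftSigma S T) μ.toMeasure (S.prod T).skew η ≤
      partitionEntropy (leftSigma S T) μ.toMeasure (S.prod T).skew ζ +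
      T.tailEntropyCovers R Q + ε := by
    calc partitionEntropy (leftSigma S T) μ.toMeasure (S.prod T).skew η
        ≤ limsup (fun n : ℕ =>
            (condEntropy (leftSigma S T) μ.toMeasure (itinerary (S.prod T).skew ζ n) / n +
              t n / n) + ε) atTop := by
          refine limsup_le_limsup ?_
          filter_upwards [eventually_ne_atTop 0] with n hn
          have hn0 : (n : ℝ≥0∞) ≠ 0 := by exact_mod_cast hn
          have hcancel : (n : ℝ≥0∞) * ε / n = ε := by
            rw [mul_comm]; exact ENNReal.mul_div_cancel_right hn0 (by simp)
          calc condEntropy (leftSigma S T) μ.toMeasure (itinerary (S.prod T).skew η n) / n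
              ≤ (condEntropy (leftSigma S T) μ.toMeasure (itinerary (S.prod T).skew ζ n) +
                n * (ε / 3) + t n + n * (ε / 3 + ε / 3)) / n := by
                gcongr; exact hmain n
            _ = (condEntropy (leftSigma S T) μ.toMeasure (itinerary (S.prod T).skew ζ n) +
                t n + n * (ε / 3 + ε / 3 + ε / 3)) / n := by
                congr 1; ring
            _ = condEntropy (leftSigma S T) μ.toMeasure (itinerary (S.prod T).skew ζ n) / n +
                t n / n + ε := by
                rw [ENNReal.add_thirds, ENNReal.add_div, ENNReal.add_div, hcancel]
      _ ≤ _ := by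
          refine (limsup_add_le_ennreal _ _).trans (add_le_add (limsup_add_le_ennreal _ _) ?_)
          simp
  refine hlim.trans ?_
  gcongr
  exact le_iSup_of_le k (le_iSup₂_of_le R hR le_rfl)

end BundleRDS

/-! ### Bounded random continuous functions -/

namespace BundleRDS

variable {Ω : Type*} [MeasurableSpace Ω] {P : Measure Ω} {θ : Ω → Ω}

section carath

variable {X : Type*} [TopologicalSpace X] [MeasurableSpace X]
  {Y : Type*} [TopologicalSpace Y] [MeasurableSpace Y] {T : BundleRDS P θ X}

/-- Measurable, continuous on almost every fiber, and bounded. -/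
structure IsBoundedCarath (T : BundleRDS P θ X) (f : T.carrier → ℝ) : Prop where
  measurable : Measurable f
  continuous_fiber : ∀ᵐ ω ∂P, Continuous fun x : T.Fiber ω => f (T.incl ω x)
  bounded : ∃ c : ℝ, ∀ p, |f p| ≤ c

namespace IsBoundedCarath

variable {f g : T.carrier → ℝ}

theorem isRandomContinuous [IsFiniteMeasure P] (hf : T.IsBoundedCarath f) :
    T.IsRandomContinuous f :=
  ⟨hf.measurable, hf.continuous_fiber, hf.bounded.elim fun c hc =>
    ⟨fun _ => c, integrable_const c, hc⟩⟩

theorem const (c : ℝ) : T.IsBoundedCarath fun _ => c :=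
  ⟨measurable_const, Eventually.of_forall fun _ => continuous_const, |c|, fun _ => le_rfl⟩

theorem add (hf : T.IsBoundedCarath f) (hg : T.IsBoundedCarath g) :
    T.IsBoundedCarath fun p => f p + g p := by
  obtain ⟨c, hc⟩ := hf.bounded
  obtain ⟨d, hd⟩ := hg.bounded
  refine ⟨hf.measurable.add hg.measurable, ?_, c + d, fun p =>
    (abs_add_le _ _).trans (add_le_add (hc p) (hd p))⟩
  filter_upwards [hf.continuous_fiber, hg.continuous_fiber] with ω h1 h2 using h1.add h2

theorem mul (hf : T.IsBoundedCarath f) (hg : T.IsBoundedCarath g) :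
    T.IsBoundedCarath fun p => f p * g p := by
  obtain ⟨c, hc⟩ := hf.bounded
  obtain ⟨d, hd⟩ := hg.bounded
  refine ⟨hf.measurable.mul hg.measurable, ?_, c * d, fun p => ?_⟩
  · filter_upwards [hf.continuous_fiber, hg.continuous_fiber] with ω h1 h2 using h1.mul h2
  · rw [abs_mul]
    exact mul_le_mul (hc p) (hd p) (abs_nonneg _) ((abs_nonneg _).trans (hc p))

theorem sum {ι : Type*} (s : Finset ι) {f : ι → T.carrier → ℝ}
    (hf : ∀ i, T.IsBoundedCarath (f i)) : T.IsBoundedCarath fun p => ∑ i ∈ s, f i p := by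
  classical
  induction s using Finset.induction_on with
  | empty => simpa using const 0
  | insert i s hi ih => simpa [Finset.sum_insert hi] using (hf i).add ih

theorem prod {ι : Type*} (s : Finset ι) {f : ι → T.carrier → ℝ}
    (hf : ∀ i, T.IsBoundedCarath (f i)) : T.IsBoundedCarath fun p => ∏ i ∈ s, f i p := by
  classical
  induction s using Finset.induction_on with
  | empty => simpa using const 1
  | insert i s hi ih => simpa [Finset.prod_insert hi] using (hf i).mul ih

theorem comp_continuous (hf : T.IsBoundedCarath f) {φ : ℝ → ℝ} (hφ : Continuous φ) :
    T.IsBoundedCarath fun p => φ (f p) := by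
  obtain ⟨c, hc⟩ := hf.bounded
  obtain ⟨d, hd⟩ := (isCompact_Icc (a := -c) (b := c)).exists_bound_of_continuousOn hφ.continuousOn
  refine ⟨hφ.measurable.comp hf.measurable, ?_, d, fun p => hd _ (abs_le.1 (hc p))⟩
  filter_upwards [hf.continuous_fiber] with ω h using hφ.comp h

/-- The base fibers with discontinuities pull back under `θ` to a null set because `θ` preserves
`P`. -/
theorem comp_skew (hθ : MeasurePreserving θ P P) (hf : T.IsBoundedCarath f) :
    T.IsBoundedCarath fun p => f (T.skew p) := by
  obtain ⟨c, hc⟩ := hf.bounded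
  refine ⟨hf.measurable.comp (T.measurable_skew hθ.measurable), ?_, c, fun p => hc _⟩
  filter_upwards [hθ.quasiMeasurePreserving.ae hf.continuous_fiber, T.continuous_fiberMap] with
    ω h1 h2 using h1.comp h2

theorem comp_skew_iterate (hθ : MeasurePreserving θ P P) (hf : T.IsBoundedCarath f) (n : ℕ) :
    T.IsBoundedCarath fun p => f (T.skew^[n] p) := by
  induction n with
  | zero => exact hf
  | succ n ih => simpa only [Function.iterate_succ_apply] using ih.comp_skew hθ

theorem comp_projRight {S : BundleRDS P θ Y} (hf : T.IsBoundedCarath f) :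
    (S.prod T).IsBoundedCarath fun z => f (projRight S T z) := by
  obtain ⟨c, hc⟩ := hf.bounded
  refine ⟨hf.measurable.comp (measurable_projRight S T), ?_, c, fun p => hc _⟩
  filter_upwards [hf.continuous_fiber] with ω h
  exact h.comp (f := fun x : (S.prod T).Fiber ω => (⟨x.1.2, x.2.2⟩ : T.Fiber ω))
    (Continuous.subtype_mk (continuous_snd.comp continuous_subtype_val) _)

theorem of_base {S : BundleRDS P θ Y} {h : Ω × Y → ℝ} (hm : Measurable h)
    (hc : ∀ ω, Continuous fun y => h (ω, y)) (h01 : ∀ p, 0 ≤ h p ∧ h p ≤ 1) :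
    (S.prod T).IsBoundedCarath fun z => h (z.1.1, z.1.2.1) := by
  refine ⟨hm.comp (measurable_subtype_coe.comp (measurable_projLeft S T)),
    Eventually.of_forall fun ω => (hc ω).comp (continuous_fst.comp continuous_subtype_val), 1,
    fun p => ?_⟩
  rw [abs_of_nonneg (h01 _).1]
  exact (h01 _).2

end IsBoundedCarath

theorem continuous_integral {f : T.carrier → ℝ} (hf : T.IsRandomContinuous f) :
    Continuous fun μ : T.InvMeasure => ∫ p, f p ∂μ.toMeasure :=
  continuous_iInf_dom (i := (⟨f, hf⟩ : {f : T.carrier → ℝ // T.IsRandomContinuous f}))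
    continuous_induced_dom

end carath

/-! ### A random partition of unity subordinate to an open random cover -/

section cover

variable {X : Type*} [MetricSpace X] [MeasurableSpace X]

/-- The distance to the complement of `U` in the fiber, truncated at `1`. -/
def complDist (T : BundleRDS P θ X) (U : Set T.carrier) (x : X) (ω : Ω) : ℝ :=
  (min (Metric.infEDist x (Subtype.val '' T.sect Uᶜ ω)) 1).toReal

theorem continuous_complDist (T : BundleRDS P θ X) (U : Set T.carrier) (ω : Ω) :
    Continuous fun x => T.complDist U x ω :=
  ENNReal.continuousOn_toReal.comp_continuous (Metric.continuous_infEDist.min continuous_const)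
    fun _ => ((min_le_right _ _).trans_lt ENNReal.one_lt_top).ne

/-- The distance is continuous in `x`, and for fixed `x` it is below `r` exactly when the closed
random set hits the open ball of radius `r`, which is measurable in `ω`. -/
theorem measurable_complDist [SecondCountableTopology X] [BorelSpace X]
    (T : BundleRDS P θ X) {U : Set T.carrier}
    (hU : T.IsClosedRandomSet Uᶜ) : Measurable (Function.uncurry (T.complDist U)) := by
  refine measurable_uncurry_of_continuous_of_measurable (fun ω => ?_) fun x => ?_
  · exact T.continuous_complDist U ω
  · refine Measurable.ennreal_toReal (Measurable.min ?_ measurable_const)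
    refine measurable_of_Iio fun r => ?_
    have h : (fun ω => Metric.infEDist x (Subtype.val '' T.sect Uᶜ ω)) ⁻¹' Set.Iio r =
        {ω | ∃ y ∈ T.sect Uᶜ ω, y.1 ∈ Metric.eball x r} := by
      ext ω
      simp only [Set.mem_preimage, Set.mem_Iio, Metric.infEDist_lt_iff, Set.mem_ofPred_eq,
        Set.exists_mem_image, Metric.mem_eball']
    rw [h]
    exact hU.measurableSet_hit _ Metric.isOpen_eball

theorem measurable_complDist_carrier [SecondCountableTopology X] [BorelSpace X]
    (T : BundleRDS P θ X) {U : Set T.carrier} (hU : T.IsClosedRandomSet Uᶜ) :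
    Measurable fun p : T.carrier => T.complDist U p.1.2 p.1.1 := by
  have hg : Measurable fun p : T.carrier => (p.1.2, p.1.1) :=
    (measurable_snd.comp measurable_subtype_coe).prodMk T.measurable_base
  exact Measurable.comp (g := Function.uncurry (T.complDist U)) (f := fun p : T.carrier =>
    (p.1.2, p.1.1)) (T.measurable_complDist hU) hg

theorem complDist_nonneg (T : BundleRDS P θ X) (U : Set T.carrier) (x : X) (ω : Ω) :
    0 ≤ T.complDist U x ω := ENNReal.toReal_nonneg

theorem complDist_pos_iff (T : BundleRDS P θ X) (U : Set T.carrier) (x : X) (ω : Ω) :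
    0 < T.complDist U x ω ↔ x ∉ closure (Subtype.val '' T.sect Uᶜ ω) := by
  rw [Metric.mem_closure_iff_infEDist_zero, complDist, ENNReal.toReal_pos_iff,
    and_iff_left ((min_le_right _ _).trans_lt ENNReal.one_lt_top), lt_min_iff,
    and_iff_left zero_lt_one, pos_iff_ne_zero]

theorem mem_of_complDist_pos (T : BundleRDS P θ X) {U : Set T.carrier} (p : T.carrier)
    (hp : 0 < T.complDist U p.1.2 p.1.1) : p ∈ U := by
  have hp' := (T.complDist_pos_iff U p.1.2 p.1.1).1 hp
  by_contra hpQ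
  exact hp' (subset_closure ⟨⟨p.1.2, p.2⟩, hpQ, rfl⟩)

theorem complDist_pos (T : BundleRDS P θ X) {U : Set T.carrier} {ω : Ω}
    (hU : IsClosed (T.sect Uᶜ ω)) (x : T.Fiber ω) (hx : T.incl ω x ∈ U) :
    0 < T.complDist U x.1 ω := by
  have : CompactSpace (T.Fiber ω) := isCompact_iff_compactSpace.1 (T.isCompact_fiber ω)
  have hclosed : IsClosed (Subtype.val '' T.sect Uᶜ ω) :=
    (hU.isCompact.image continuous_subtype_val).isClosed
  rw [complDist_pos_iff, hclosed.closure_eq]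
  rintro ⟨y, hy, hyx⟩
  have hyx' : y = x := Subtype.ext hyx
  subst hyx'
  exact hy hx

/-- The distances to the complements are normalized by their sum, which is positive over almost
every `ω`. Elsewhere division by zero gives `0`, so the bound and the support condition hold
everywhere. -/
theorem exists_partition_of_unity [SecondCountableTopology X] [BorelSpace X]
    (T : BundleRDS P θ X) {l : ℕ} {Q : Fin l → Set T.carrier} (hQ : T.IsOpenRandomCover Q) :
    ∃ φ : Fin l → T.carrier → ℝ, (∀ j, T.IsBoundedCarath (φ j)) ∧
      (∀ j p, 0 < φ j p → p ∈ Q j) ∧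
      ∀ᵐ ω ∂P, ∀ x : T.Fiber ω, ∑ j, φ j (T.incl ω x) = 1 := by
  obtain ⟨d, hd0, hsub, hdm, hdc, hpos⟩ : ∃ d : Fin l → T.carrier → ℝ, (∀ j p, 0 ≤ d j p) ∧
      (∀ j p, 0 < d j p → p ∈ Q j) ∧ (∀ j, Measurable (d j)) ∧
      (∀ j ω, Continuous fun x : T.Fiber ω => d j (T.incl ω x)) ∧
      ∀ᵐ ω ∂P, ∀ x : T.Fiber ω, 0 < ∑ j, d j (T.incl ω x) := by
    refine ⟨fun j p => T.complDist (Q j) p.1.2 p.1.1, fun j p => T.complDist_nonneg _ _ _,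
      fun j p => T.mem_of_complDist_pos p, fun j => ?_, fun j ω => ?_, ?_⟩
    · exact T.measurable_complDist_carrier (hQ.isClosedRandomSet_compl j)
    · exact (T.continuous_complDist (Q j) ω).comp continuous_subtype_val
    · filter_upwards [ae_all_iff.2 fun j => (hQ.isClosedRandomSet_compl j).isClosed_sect] with
        ω hω x
      have hx : T.incl ω x ∈ ⋃ j, Q j := by rw [hQ.cover]; trivial
      obtain ⟨j, hj⟩ := Set.mem_iUnion.1 hx
      exact Finset.sum_pos' (fun i _ => T.complDist_nonneg _ _ _)
        ⟨j, Finset.mem_univ j, T.complDist_pos (hω j) x hj⟩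
  refine ⟨fun j p => d j p / ∑ i, d i p, fun j => ⟨?_, ?_, 1, fun p => ?_⟩, fun j p hp => ?_, ?_⟩
  · exact (hdm j).div (Finset.measurable_fun_sum _ fun i _ => hdm i)
  · filter_upwards [hpos] with ω hω
    exact (hdc j ω).div (continuous_finsetSum _ fun i _ => hdc i ω) fun x => (hω x).ne'
  · have hs : 0 ≤ ∑ i, d i p := Finset.sum_nonneg fun i _ => hd0 i p
    rw [abs_of_nonneg (div_nonneg (hd0 j p) hs)]
    exact div_le_one_of_le₀ (Finset.single_le_sum (fun i _ => hd0 i p) (Finset.mem_univ j)) hs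
  · refine hsub j p ((hd0 j p).lt_of_ne fun h => ?_)
    have hp' : 0 < d j p / ∑ i, d i p := hp
    rw [← h, zero_div] at hp'
    exact lt_irrefl _ hp'
  · filter_upwards [hpos] with ω hω x
    rw [← Finset.sum_div]
    exact div_self (hω x).ne'

end cover

end BundleRDS

/-! ### Upper semicontinuity of conditional entropy -/

/-- A continuous majorant of the indicator of `{v | t < v}` (for `true`) or of `{v | v ≤ t}` (for
`false`). -/
def softStep (s t : ℝ) (b : Bool) (v : ℝ) : ℝ :=
  max 0 (min 1 (1 + s * if b then v - t else t - v))

theorem softStep_nonneg (s t : ℝ) (b : Bool) (v : ℝ) : 0 ≤ softStep s t b v := le_max_left _ _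

theorem softStep_le_one (s t : ℝ) (b : Bool) (v : ℝ) : softStep s t b v ≤ 1 :=
  max_le zero_le_one (min_le_left _ _)

theorem continuous_softStep (s t : ℝ) (b : Bool) : Continuous (softStep s t b) := by
  unfold softStep
  cases b <;> simp only [Bool.false_eq_true, if_true, if_false] <;> fun_prop

theorem softStep_decide {s : ℝ} (hs : 0 ≤ s) (t v : ℝ) : softStep s t (decide (t < v)) v = 1 := by
  unfold softStep
  by_cases h : t < v
  · have : 0 ≤ s * (v - t) := mul_nonneg hs (by linarith)
    simp only [h, decide_true, if_true]
    rw [min_eq_left (by linarith), max_eq_right zero_le_one]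
  · have : 0 ≤ s * (t - v) := mul_nonneg hs (by linarith)
    simp only [h, decide_false, Bool.false_eq_true, if_false]
    rw [min_eq_left (by linarith), max_eq_right zero_le_one]

/-- At `v = t` both soft steps equal `1` for every slope, which is why the level must carry no mass.
-/
theorem eventually_softStep_eq_zero {t v : ℝ} (hv : v ≠ t) {b : Bool} (hb : b ≠ decide (t < v)) :
    ∀ᶠ n : ℕ in atTop, softStep n t b v = 0 := by
  have key : ∀ w : ℝ, w < 0 → ∀ᶠ n : ℕ in atTop, max 0 (min 1 (1 + (n : ℝ) * w)) = 0 := by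
    intro w hw
    have h : Tendsto (fun n : ℕ => (n : ℝ) * -w) atTop atTop :=
      tendsto_natCast_atTop_atTop.atTop_mul_const (by linarith)
    filter_upwards [h.eventually_ge_atTop 1] with n hn
    rw [max_eq_left]
    exact (min_le_right _ _).trans (by linarith)
  unfold softStep
  rcases lt_or_gt_of_ne hv with h | h
  · have hb' : b = true := by
      rw [decide_eq_false (not_lt.2 h.le)] at hb
      simpa using hb
    subst hb'
    simpa using key (v - t) (by linarith)
  · have hb' : b = false := by
      rw [decide_eq_true h] at hb
      simpa using hb
    subst hb'
    simpa using key (t - v) (by linarith)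

/-- The shift by `δ` bounds the slope of the logarithm at `g + δ` by `δ⁻¹`, so concavity gives the
estimate with no lower bound on `e`. -/
theorem codeLen_ofReal_add_le {e g δ : ℝ} (he : 0 ≤ e) (hg : 0 ≤ g) (hδ : 0 < δ) :
    codeLen (ENNReal.ofReal (g + δ)) ≤
      codeLen (ENNReal.ofReal e) + ENNReal.ofReal (δ⁻¹) * ‖e - g‖ₑ := by
  rcases he.eq_or_lt with rfl | he
  · simp [codeLen_zero]
  rw [codeLen_ofReal (by linarith), codeLen_ofReal he, ← ofReal_norm,
    ← ENNReal.ofReal_mul (by positivity)]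
  refine (ENNReal.ofReal_le_ofReal ?_).trans ENNReal.ofReal_add_le
  have hgd : 0 < g + δ := by linarith
  have h1 : Real.log e ≤ Real.log (e + δ) := Real.log_le_log he (by linarith)
  have h2 := Real.log_le_sub_one_of_pos (div_pos (show 0 < e + δ by linarith) hgd)
  rw [Real.log_div (by linarith) hgd.ne'] at h2
  have h3 : (e + δ) / (g + δ) - 1 = (e - g) / (g + δ) := by field_simp; ring
  have h4 : (e - g) / (g + δ) ≤ δ⁻¹ * ‖e - g‖ := by
    rw [← div_eq_inv_mul]
    exact (div_le_div_of_nonneg_right (le_abs_self _) hgd.le).trans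
      (div_le_div_of_nonneg_left (abs_nonneg _) hδ (by linarith))
  linarith

/-- The positive part of `-log (v + δ)`, as a continuous function of `v`. -/
def softLen (δ v : ℝ) : ℝ := max (-Real.log (max v 0 + δ)) 0

theorem softLen_nonneg (δ v : ℝ) : 0 ≤ softLen δ v := le_max_right _ _

theorem softLen_le {δ : ℝ} (hδ : 0 < δ) (v : ℝ) : softLen δ v ≤ max (-Real.log δ) 0 := by
  refine max_le_max (neg_le_neg (Real.log_le_log hδ ?_)) le_rfl
  have := le_max_right v 0
  linarith

theorem continuous_softLen {δ : ℝ} (hδ : 0 < δ) : Continuous (softLen δ) := by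
  refine Continuous.max (Continuous.neg (Continuous.log (by fun_prop) fun v => ?_))
    continuous_const
  have := le_max_right v 0
  linarith

theorem ofReal_softLen {δ v : ℝ} (hδ : 0 < δ) (hv : 0 ≤ v) :
    ENNReal.ofReal (softLen δ v) = codeLen (ENNReal.ofReal (v + δ)) := by
  unfold softLen
  rw [max_eq_left hv, codeLen_ofReal (by linarith), ENNReal.ofReal_max, ENNReal.ofReal_zero,
    max_eq_left (show (0 : ℝ≥0∞) ≤ _ from bot_le)]

/-! ### Continuous majorants of the code length of a level set labelling -/

section Majorant

variable {α J : Type*}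

/-- The labelling of points by the set of indices `j` with `t < ψ j`. -/
def levelLabel (ψ : J → α → ℝ) (t : ℝ) (a : α) (j : J) : Bool := decide (t < ψ j a)

theorem measurable_levelLabel {mα : MeasurableSpace α} {ψ : J → α → ℝ}
    (hψ : ∀ j, Measurable (ψ j)) (t : ℝ) : Measurable (levelLabel ψ t) :=
  measurable_pi_lambda _ fun j => measurable_to_bool (by
    have h : (fun a => levelLabel ψ t a j) ⁻¹' {true} = {a | t < ψ j a} := by
      ext; simp [levelLabel]
    rw [h]
    exact measurableSet_lt measurable_const (hψ j))

variable [Fintype J]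

theorem prod_softStep_levelLabel (ψ : J → α → ℝ) (t : ℝ) {s : ℝ} (hs : 0 ≤ s) (a : α) :
    ∏ j, softStep s t (levelLabel ψ t a j) (ψ j a) = 1 :=
  Finset.prod_eq_one fun _ _ => softStep_decide hs _ _

variable [DecidableEq J]

/-- The code length integrand of the sub-probability weights `g b + δ`, for the labelling by level
sets of the functions `ψ j`. -/
def labelMajorant (ψ : J → α → ℝ) (t δ : ℝ) (g : (J → Bool) → α → ℝ) (a : α) : ℝ :=
  softLen δ (g (levelLabel ψ t a) a) + ∑ b, (g b a + δ)

/-- A majorant of `labelMajorant` depending continuously on `ψ` and `g`. -/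
def softMajorant (ψ : J → α → ℝ) (t δ : ℝ) (g : (J → Bool) → α → ℝ) (s : ℝ) (a : α) : ℝ :=
  ∑ b, (∏ j, softStep s t (b j) (ψ j a)) * softLen δ (g b a) + ∑ b, (g b a + δ)

variable {ψ : J → α → ℝ} {t δ : ℝ} {g : (J → Bool) → α → ℝ}

theorem labelMajorant_nonneg (hδ : 0 < δ) (hg : ∀ b a, 0 ≤ g b a) (a : α) :
    0 ≤ labelMajorant ψ t δ g a :=
  add_nonneg (softLen_nonneg _ _) (Finset.sum_nonneg fun b _ => add_nonneg (hg b a) hδ.le)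

theorem labelMajorant_le_softMajorant {s : ℝ} (hs : 0 ≤ s) (a : α) :
    labelMajorant ψ t δ g a ≤ softMajorant ψ t δ g s a := by
  refine add_le_add ?_ le_rfl
  calc softLen δ (g (levelLabel ψ t a) a)
      = (∏ j, softStep s t (levelLabel ψ t a j) (ψ j a)) * softLen δ (g (levelLabel ψ t a) a) := by
        rw [prod_softStep_levelLabel ψ t hs, one_mul]
    _ ≤ _ := Finset.single_le_sum
        (f := fun b : J → Bool => (∏ j, softStep s t (b j) (ψ j a)) * softLen δ (g b a))
        (fun b _ => mul_nonneg (Finset.prod_nonneg fun j _ => softStep_nonneg _ _ _ _)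
          (softLen_nonneg _ _))
        (Finset.mem_univ (levelLabel ψ t a))

/-- Every wrong label disagrees with the true one at some `j`, and that factor of its product
vanishes for steep steps. -/
theorem eventually_softMajorant_eq {a : α} (ha : ∀ j, ψ j a ≠ t) :
    ∀ᶠ n : ℕ in atTop, softMajorant ψ t δ g n a = labelMajorant ψ t δ g a := by
  have h : ∀ b : J → Bool, b ≠ levelLabel ψ t a →
      ∀ᶠ n : ℕ in atTop, ∏ j, softStep n t (b j) (ψ j a) = 0 := by
    intro b hb
    obtain ⟨j, hj⟩ := Function.ne_iff.1 hb
    filter_upwards [eventually_softStep_eq_zero (ha j) hj] with n hn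
    exact Finset.prod_eq_zero (Finset.mem_univ j) hn
  have h' : ∀ᶠ n : ℕ in atTop, ∀ b : J → Bool, b ≠ levelLabel ψ t a →
      ∏ j, softStep n t (b j) (ψ j a) = 0 := by
    rw [eventually_all]
    intro b
    by_cases hb : b = levelLabel ψ t a
    · exact Eventually.of_forall fun n hn => absurd hb hn
    · filter_upwards [h b hb] with n hn _ using hn
  filter_upwards [h'] with n hn
  unfold softMajorant labelMajorant
  congr 1
  rw [Finset.sum_eq_single (levelLabel ψ t a) (fun b _ hb => by rw [hn b hb, zero_mul])
    (fun hb => absurd (Finset.mem_univ _) hb), prod_softStep_levelLabel ψ t (Nat.cast_nonneg n),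
    one_mul]

theorem norm_softMajorant_le (hδ : 0 < δ) (hg : ∀ b a, 0 ≤ g b a) (hg1 : ∀ b a, g b a ≤ 1)
    {s : ℝ} (hs : 0 ≤ s) (a : α) :
    ‖softMajorant ψ t δ g s a‖ ≤
      ∑ _b : J → Bool, max (-Real.log δ) 0 + ∑ _b : J → Bool, (1 + δ) := by
  rw [Real.norm_of_nonneg ((labelMajorant_nonneg hδ hg a).trans (labelMajorant_le_softMajorant hs a))]
  refine add_le_add (Finset.sum_le_sum fun b _ => ?_)
    (Finset.sum_le_sum fun b _ => add_le_add (hg1 b a) le_rfl)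
  calc (∏ j, softStep s t (b j) (ψ j a)) * softLen δ (g b a)
      ≤ 1 * softLen δ (g b a) := by
        refine mul_le_mul_of_nonneg_right ?_ (softLen_nonneg _ _)
        exact Finset.prod_le_one (fun j _ => softStep_nonneg _ _ _ _)
          fun j _ => softStep_le_one _ _ _ _
    _ ≤ max (-Real.log δ) 0 := by
        rw [one_mul]
        exact softLen_le hδ _

variable {𝒮 mα : MeasurableSpace α} {μ : Measure α}

theorem measurable_softMajorant (hψ : ∀ j, Measurable (ψ j)) (hg : ∀ b, Measurable (g b))
    (hδ : 0 < δ) (s : ℝ) : Measurable (softMajorant ψ t δ g s) := by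
  refine Measurable.add ?_ (Finset.measurable_fun_sum _ fun b _ => (hg b).add_const δ)
  refine Finset.measurable_fun_sum _ fun b _ => Measurable.mul ?_
    ((continuous_softLen hδ).measurable.comp (hg b))
  exact Finset.measurable_fun_prod _ fun j _ =>
    (continuous_softStep s t (b j)).measurable.comp (hψ j)

theorem integrable_softMajorant [IsFiniteMeasure μ] (hψ : ∀ j, Measurable (ψ j))
    (hg : ∀ b, Measurable (g b)) (hδ : 0 < δ) (hg0 : ∀ b a, 0 ≤ g b a) (hg1 : ∀ b a, g b a ≤ 1)
    {s : ℝ} (hs : 0 ≤ s) : Integrable (softMajorant ψ t δ g s) μ :=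
  Integrable.of_bound (measurable_softMajorant hψ hg hδ s).aestronglyMeasurable _
    (Eventually.of_forall fun a => norm_softMajorant_le hδ hg0 hg1 hs a)

theorem tendsto_lintegral_softMajorant [IsFiniteMeasure μ] (hψ : ∀ j, Measurable (ψ j))
    (hg : ∀ b, Measurable (g b)) (hδ : 0 < δ) (hg0 : ∀ b a, 0 ≤ g b a) (hg1 : ∀ b a, g b a ≤ 1)
    (ht : ∀ j, ∀ᵐ a ∂μ, ψ j a ≠ t) :
    Tendsto (fun n : ℕ => ∫⁻ a, ENNReal.ofReal (softMajorant ψ t δ g n a) ∂μ) atTop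
      (𝓝 (∫⁻ a, ENNReal.ofReal (labelMajorant ψ t δ g a) ∂μ)) := by
  refine tendsto_lintegral_of_dominated_convergence
    (fun _ => ENNReal.ofReal
      (∑ _b : J → Bool, max (-Real.log δ) 0 + ∑ _b : J → Bool, (1 + δ)))
    (fun n => (measurable_softMajorant hψ hg hδ n).ennreal_ofReal) (fun n => ?_) ?_ ?_
  · exact Eventually.of_forall fun a => ENNReal.ofReal_le_ofReal
      ((le_abs_self _).trans (norm_softMajorant_le hδ hg0 hg1 (Nat.cast_nonneg n) a))
  · rw [lintegral_const]
    exact ENNReal.mul_ne_top ENNReal.ofReal_ne_top (measure_ne_top μ _)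
  · filter_upwards [ae_all_iff.2 ht] with a ha
    refine tendsto_const_nhds.congr' ?_
    filter_upwards [eventually_softMajorant_eq (δ := δ) (g := g) ha] with n hn
    rw [hn]

theorem ofReal_labelMajorant (hδ : 0 < δ) (hg0 : ∀ b a, 0 ≤ g b a) (a : α) :
    ENNReal.ofReal (labelMajorant ψ t δ g a) =
      codeLen (ENNReal.ofReal (g (levelLabel ψ t a) a + δ)) +
        ∑ b, ENNReal.ofReal (g b a + δ) := by
  unfold labelMajorant
  rw [ENNReal.ofReal_add (softLen_nonneg _ _)
    (Finset.sum_nonneg fun b _ => add_nonneg (hg0 b a) hδ.le), ofReal_softLen hδ (hg0 _ a),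
    ENNReal.ofReal_sum_of_nonneg fun b _ => add_nonneg (hg0 b a) hδ.le]

/-- The Gibbs inequality for the weights `g b + δ`. -/
theorem condEntropy_levelLabel_add_one_le [IsProbabilityMeasure μ] (h𝒮 : 𝒮 ≤ mα)
    (hψ : ∀ j, Measurable (ψ j)) (hg : ∀ b, Measurable[𝒮] (g b)) (hδ : 0 < δ)
    (hg0 : ∀ b a, 0 ≤ g b a) {s : ℝ} (hs : 0 ≤ s) :
    condEntropy 𝒮 μ (levelLabel ψ t) + 1 ≤
      ∫⁻ a, ENNReal.ofReal (softMajorant ψ t δ g s a) ∂μ := by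
  have hgm : ∀ b, Measurable fun a => ENNReal.ofReal (g b a + δ) := fun b =>
    (((hg b).mono h𝒮 le_rfl).add_const δ).ennreal_ofReal
  refine (condEntropy_add_one_le h𝒮 (measurable_levelLabel hψ t)
    (q := fun b a => ENNReal.ofReal (g b a + δ))
    (fun b => ((hg b).add_const δ).ennreal_ofReal)).trans ?_
  rw [tsum_fintype, ← lintegral_finsetSum _ fun b _ => hgm b, ← lintegral_add_right _
    (Finset.measurable_fun_sum _ fun b _ => hgm b)]
  refine lintegral_mono fun a => ?_
  rw [← ofReal_labelMajorant hδ hg0]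
  exact ENNReal.ofReal_le_ofReal (labelMajorant_le_softMajorant hs a)

/-- If the weights are close in mean to the conditional probabilities, their code length is close
to the conditional entropy. -/
theorem lintegral_labelMajorant_le [IsProbabilityMeasure μ] (h𝒮 : 𝒮 ≤ mα)
    (hψ : ∀ j, Measurable (ψ j)) (hg : ∀ b, Measurable (g b)) (hδ : 0 < δ)
    (hg0 : ∀ b a, 0 ≤ g b a) {ε : ℝ≥0∞}
    (hε : ∀ b, ∫⁻ a, ‖(μ⟦levelLabel ψ t ⁻¹' {b} | 𝒮⟧) a - g b a‖ₑ ∂μ ≤ ε) :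
    ∫⁻ a, ENNReal.ofReal (labelMajorant ψ t δ g a) ∂μ ≤
      condEntropy 𝒮 μ (levelLabel ψ t) + 1 + Fintype.card (J → Bool) * ENNReal.ofReal δ +
        Fintype.card (J → Bool) * ((1 + ENNReal.ofReal δ⁻¹) * ε) := by
  have hσ := measurable_levelLabel hψ t
  let e : (J → Bool) → α → ℝ := fun b => μ⟦levelLabel ψ t ⁻¹' {b} | 𝒮⟧
  have hem : ∀ b, Measurable (e b) := fun b =>
    (stronglyMeasurable_condExp.mono h𝒮).measurable
  have he : ∀ᵐ a ∂μ, ∀ b, e b a ∈ Set.Icc (0 : ℝ) 1 := ae_all_iff.2 fun b =>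
    condExp_indicator_mem_Icc (𝒮 := 𝒮) (hσ (measurableSet_singleton b))
  have hdm : ∀ b, Measurable fun a => ‖e b a - g b a‖ₑ := fun b => ((hem b).sub (hg b)).enorm
  -- Replacing `g b + δ` by the conditional probability `e b` changes the code length by at most
  -- `δ⁻¹ * |e b - g b|` and the mass of `b` by at most `δ + |e b - g b|`.
  have hpt : ∀ᵐ a ∂μ, ENNReal.ofReal (labelMajorant ψ t δ g a) ≤
      codeLen (ENNReal.ofReal (e (levelLabel ψ t a) a)) +
        (∑ b, ENNReal.ofReal (e b a) + (Fintype.card (J → Bool) * ENNReal.ofReal δ +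
          ∑ b, (1 + ENNReal.ofReal δ⁻¹) * ‖e b a - g b a‖ₑ)) := by
    filter_upwards [he] with a ha
    rw [ofReal_labelMajorant hδ hg0]
    have h1 := codeLen_ofReal_add_le (ha (levelLabel ψ t a)).1 (hg0 (levelLabel ψ t a) a) hδ
    have h2 : ENNReal.ofReal δ⁻¹ * ‖e (levelLabel ψ t a) a - g (levelLabel ψ t a) a‖ₑ ≤
        ∑ b, ENNReal.ofReal δ⁻¹ * ‖e b a - g b a‖ₑ :=
      Finset.single_le_sum (f := fun b => ENNReal.ofReal δ⁻¹ * ‖e b a - g b a‖ₑ)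
        (fun _ _ => bot_le) (Finset.mem_univ (levelLabel ψ t a))
    have h3 : ∀ b, ENNReal.ofReal (g b a + δ) ≤
        ENNReal.ofReal (e b a) + ENNReal.ofReal δ + ‖e b a - g b a‖ₑ := by
      intro b
      rw [← ofReal_norm, ← ENNReal.ofReal_add (ha b).1 hδ.le,
        ← ENNReal.ofReal_add (add_nonneg (ha b).1 hδ.le) (norm_nonneg _)]
      refine ENNReal.ofReal_le_ofReal ?_
      have := neg_abs_le (e b a - g b a)
      rw [Real.norm_eq_abs]
      linarith
    calc _ ≤ (codeLen (ENNReal.ofReal (e (levelLabel ψ t a) a)) +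
          ∑ b, ENNReal.ofReal δ⁻¹ * ‖e b a - g b a‖ₑ) +
          ∑ b, (ENNReal.ofReal (e b a) + ENNReal.ofReal δ + ‖e b a - g b a‖ₑ) :=
        add_le_add (h1.trans (add_le_add le_rfl h2)) (Finset.sum_le_sum fun b _ => h3 b)
      _ = _ := by
        simp only [add_mul, one_mul, Finset.sum_add_distrib, Finset.sum_const, Finset.card_univ,
          nsmul_eq_mul]
        ring
  refine (lintegral_mono_ae hpt).trans ?_
  rw [lintegral_add_right _ (by fun_prop), lintegral_codeLen_condExp h𝒮 hσ, add_assoc, add_assoc]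
  refine add_le_add le_rfl ?_
  rw [lintegral_add_right _ (by fun_prop), lintegral_finsetSum _ fun b _ => (hem b).ennreal_ofReal]
  refine add_le_add (le_of_eq ?_) ?_
  · have h := tsum_lintegral_condExp (μ := μ) h𝒮 hσ (measurable_const (a := (1 : ℝ≥0∞)))
    simp only [mul_one, lintegral_const, measure_univ, tsum_fintype] at h
    exact h
  rw [lintegral_add_right _ (by fun_prop), lintegral_const, measure_univ, mul_one,
    lintegral_finsetSum _ fun b _ => (hdm b).const_mul _]
  refine add_le_add le_rfl ?_
  calc ∑ b, ∫⁻ a, (1 + ENNReal.ofReal δ⁻¹) * ‖e b a - g b a‖ₑ ∂μ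
      ≤ ∑ _b : J → Bool, (1 + ENNReal.ofReal δ⁻¹) * ε := by
        refine Finset.sum_le_sum fun b _ => ?_
        rw [lintegral_const_mul _ (hdm b)]
        exact mul_le_mul_right (hε b) _
    _ = _ := by rw [Finset.sum_const, Finset.card_univ, nsmul_eq_mul]

end Majorant

/-! ### Upper semicontinuity for one partition in the narrow topology -/

namespace BundleRDS

variable {Ω : Type*} [MeasurableSpace Ω] {P : Measure Ω} {θ : Ω → Ω}
  {X : Type*} [TopologicalSpace X] [MeasurableSpace X]
  {Y : Type*} [TopologicalSpace Y] [TopologicalSpace.PseudoMetrizableSpace Y] [MeasurableSpace Y]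
  [BorelSpace Y]

/-- The conditional probabilities given the left factor are approximated in mean by random
continuous functions. -/
theorem exists_carath_condExp [IsProbabilityMeasure P] (S : BundleRDS P θ Y) (T : BundleRDS P θ X)
    (m : (S.prod T).InvMeasure) {A : Set (S.prod T).carrier} (hA : MeasurableSet A) {ε : ℝ≥0∞}
    (hε : 0 < ε) :
    ∃ g : (S.prod T).carrier → ℝ, (S.prod T).IsBoundedCarath g ∧ Measurable[leftSigma S T] g ∧
      (∀ z, 0 ≤ g z) ∧ (∀ z, g z ≤ 1) ∧
      ∫⁻ z, ‖(m.toMeasure⟦A | leftSigma S T⟧) z - g z‖ₑ ∂m.toMeasure ≤ ε := by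
  have := isProbabilityMeasure_toMeasure m
  let π : (S.prod T).carrier → Ω × Y := fun z => (z.1.1, z.1.2.1)
  have hπ : Measurable π := measurable_subtype_coe.comp (measurable_projLeft S T)
  have hπ' : Measurable[leftSigma S T] π :=
    measurable_subtype_coe.comp (measurable_leftSigma_projLeft S T)
  -- The conditional probability is a function on the bundle of `S`, extended measurably to `Ω × Y`
  -- and clamped to the unit interval, where its values lie only almost surely.
  obtain ⟨e, he, hee⟩ := (stronglyMeasurable_condExp (μ := m.toMeasure) (m := leftSigma S T)
    (f := A.indicator fun _ => (1 : ℝ))).measurable.exists_eq_measurable_comp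
  obtain ⟨e', he', hee'⟩ :=
    (MeasurableEmbedding.subtype_coe S.measurableSet_carrier).exists_measurable_extend he
      fun _ => ⟨0⟩
  obtain ⟨g, hg, hgc, hg01, hge⟩ := exists_carath_approx (m.toMeasure.map π)
    (e := fun p => max 0 (min 1 (e' p))) (measurable_const.max (measurable_const.min he'))
    (fun p => ⟨le_max_left _ _, max_le zero_le_one (min_le_left _ _)⟩) hε
  refine ⟨fun z => g (π z), IsBoundedCarath.of_base hg hgc hg01, hg.comp hπ', fun z => (hg01 _).1,
    fun z => (hg01 _).2, ?_⟩
  rw [lintegral_map (μ := m.toMeasure) (f := fun p => ‖max 0 (min 1 (e' p)) - g p‖ₑ)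
    ((measurable_const.max (measurable_const.min he')).sub hg).enorm hπ] at hge
  refine le_trans (le_of_eq (lintegral_congr_ae ?_)) hge
  filter_upwards [condExp_indicator_mem_Icc (𝒮 := leftSigma S T) (μ := m.toMeasure) hA] with z hz
  have hez : (m.toMeasure⟦A | leftSigma S T⟧) z = e' (π z) := by
    rw [hee, ← hee']
    rfl
  rw [hez] at hz ⊢
  rw [min_eq_right hz.2, max_eq_right hz.1]

theorem IsBoundedCarath.softMajorant {T : BundleRDS P θ X} {J : Type*} [Fintype J]
    [DecidableEq J] {ψ : J → T.carrier → ℝ} (hψ : ∀ j, T.IsBoundedCarath (ψ j)) (t : ℝ) {δ : ℝ}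
    (hδ : 0 < δ) {g : (J → Bool) → T.carrier → ℝ} (hg : ∀ b, T.IsBoundedCarath (g b)) (s : ℝ) :
    T.IsBoundedCarath (softMajorant ψ t δ g s) := by
  have h1 : ∀ b : J → Bool, T.IsBoundedCarath fun p => ∏ j, softStep s t (b j) (ψ j p) :=
    fun b => IsBoundedCarath.prod (f := fun j p => softStep s t (b j) (ψ j p)) _ fun j =>
      (hψ j).comp_continuous (continuous_softStep s t (b j))
  have h2 : ∀ b, T.IsBoundedCarath fun p => softLen δ (g b p) := fun b =>
    (hg b).comp_continuous (continuous_softLen hδ)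
  have h3 : T.IsBoundedCarath fun p => ∑ b, (g b p + δ) :=
    IsBoundedCarath.sum (f := fun b p => g b p + δ) _ fun b =>
      (hg b).add (IsBoundedCarath.const δ)
  have h4 : T.IsBoundedCarath fun p =>
      ∑ b : J → Bool, (∏ j, softStep s t (b j) (ψ j p)) * softLen δ (g b p) :=
    IsBoundedCarath.sum (f := fun (b : J → Bool) p =>
      (∏ j, softStep s t (b j) (ψ j p)) * softLen δ (g b p)) _ fun b => (h1 b).mul (h2 b)
  exact h4.add h3

/-- Upper semicontinuity of the conditional entropy of partitions into level sets of random
continuous functions, at measures not charging the level. -/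
theorem eventually_condEntropy_levelLabel_lt [IsProbabilityMeasure P] (S : BundleRDS P θ Y)
    (T : BundleRDS P θ X) (m : (S.prod T).InvMeasure) {J : Type*} [Fintype J]
    {ψ : J → (S.prod T).carrier → ℝ} (hψ : ∀ j, (S.prod T).IsBoundedCarath (ψ j)) {t : ℝ}
    (ht : ∀ j, ∀ᵐ z ∂m.toMeasure, ψ j z ≠ t) {c : ℝ≥0∞}
    (hc : condEntropy (leftSigma S T) m.toMeasure (levelLabel ψ t) < c) :
    ∀ᶠ μ in 𝓝 m, condEntropy (leftSigma S T) μ.toMeasure (levelLabel ψ t) < c := by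
  classical
  have hm := isProbabilityMeasure_toMeasure m
  have h𝒮 := leftSigma_le S T
  have hψm : ∀ j, Measurable (ψ j) := fun j => (hψ j).measurable
  have hσ := measurable_levelLabel hψm t
  obtain ⟨γ, hγ, hγc⟩ := ENNReal.lt_iff_exists_add_pos_lt.1 hc
  have hk0 : (Fintype.card (J → Bool) : ℝ≥0∞) ≠ 0 := by simp
  have hktop : (Fintype.card (J → Bool) : ℝ≥0∞) ≠ ∞ := ENNReal.natCast_ne_top _
  have hγ2 : (γ : ℝ≥0∞) / 2 ≠ 0 := by simpa using hγ.ne'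
  have hγ2top : (γ : ℝ≥0∞) / 2 ≠ ∞ := ENNReal.div_ne_top ENNReal.coe_ne_top two_ne_zero
  -- The slack `γ` is halved. The shift `δ` is fixed first, because the error from the `L¹`
  -- approximation carries the factor `1 + δ⁻¹`.
  obtain ⟨δ, hδ, hkδ⟩ : ∃ δ : ℝ, 0 < δ ∧
      (Fintype.card (J → Bool) : ℝ≥0∞) * ENNReal.ofReal δ ≤ γ / 2 := by
    have htop : (γ : ℝ≥0∞) / 2 / (Fintype.card (J → Bool) : ℝ≥0∞) ≠ ∞ :=
      ENNReal.div_ne_top hγ2top hk0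
    refine ⟨((γ : ℝ≥0∞) / 2 / (Fintype.card (J → Bool) : ℝ≥0∞)).toReal,
      ENNReal.toReal_pos (ENNReal.div_pos hγ2 hktop).ne' htop, ?_⟩
    rw [ENNReal.ofReal_toReal htop]
    exact ENNReal.mul_div_le
  obtain ⟨ε, hε, hkε⟩ : ∃ ε : ℝ≥0∞, 0 < ε ∧
      (Fintype.card (J → Bool) : ℝ≥0∞) * ((1 + ENNReal.ofReal δ⁻¹) * ε) ≤ γ / 2 := by
    refine ⟨γ / 2 / (Fintype.card (J → Bool) * (1 + ENNReal.ofReal δ⁻¹)),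
      ENNReal.div_pos hγ2 (ENNReal.mul_ne_top hktop (by simp)), ?_⟩
    rw [← mul_assoc]
    exact ENNReal.mul_div_le
  choose g hgB hgD hg0 hg1 hge using
    fun b => exists_carath_condExp S T m (hσ (measurableSet_singleton b)) hε
  have hgm : ∀ b, Measurable (g b) := fun b => (hgB b).measurable
  have hint : ∀ (μ : (S.prod T).InvMeasure) (n : ℕ),
      ∫⁻ z, ENNReal.ofReal (softMajorant ψ t δ g n z) ∂μ.toMeasure =
        ENNReal.ofReal (∫ z, softMajorant ψ t δ g n z ∂μ.toMeasure) := by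
    intro μ n
    have hμ := isProbabilityMeasure_toMeasure μ
    exact (ofReal_integral_eq_lintegral_ofReal
      (integrable_softMajorant hψm hgm hδ hg0 hg1 (Nat.cast_nonneg n))
      (Eventually.of_forall fun z => (labelMajorant_nonneg hδ hg0 z).trans
        (labelMajorant_le_softMajorant (Nat.cast_nonneg n) z))).symm
  have hlt : ∫⁻ z, ENNReal.ofReal (labelMajorant ψ t δ g z) ∂m.toMeasure < c + 1 := by
    refine (lintegral_labelMajorant_le h𝒮 hψm hgm hδ hg0 hge).trans_lt ?_
    calc _ ≤ condEntropy (leftSigma S T) m.toMeasure (levelLabel ψ t) + 1 + γ / 2 + γ / 2 :=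
          add_le_add (add_le_add le_rfl hkδ) hkε
      _ = condEntropy (leftSigma S T) m.toMeasure (levelLabel ψ t) + γ + 1 := by
          rw [add_assoc _ ((γ : ℝ≥0∞) / 2), ENNReal.add_halves]
          ring
      _ < c + 1 := ENNReal.add_lt_add_right ENNReal.one_ne_top hγc
  obtain ⟨n, hn⟩ := ((tendsto_lintegral_softMajorant hψm hgm hδ hg0 hg1 ht).eventually
    (gt_mem_nhds hlt)).exists
  rw [hint] at hn
  have hcont : Continuous fun μ : (S.prod T).InvMeasure =>
      ENNReal.ofReal (∫ z, softMajorant ψ t δ g n z ∂μ.toMeasure) :=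
    ENNReal.continuous_ofReal.comp
      (continuous_integral (IsBoundedCarath.softMajorant hψ t hδ hgB n).isRandomContinuous)
  -- The weights `g b`, chosen for `m`, are kept fixed: the Gibbs inequality holds with them for
  -- every `μ`.
  filter_upwards [(hcont.tendsto m).eventually (gt_mem_nhds hn)] with μ hμ
  have hμp := isProbabilityMeasure_toMeasure μ
  rw [← hint] at hμ
  exact (ENNReal.add_lt_add_iff_right ENNReal.one_ne_top).1
    ((condEntropy_levelLabel_add_one_le h𝒮 hψm hgD hδ hg0 (Nat.cast_nonneg n)).trans_lt hμ)

end BundleRDS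

/-! ### Entropy of level set partitions and the main inequality -/

section Relabel

variable {α ι κ : Type*} {𝒮 mα : MeasurableSpace α} {μ : Measure α}

/-- Only countably many levels of finitely many functions are charged by a finite measure. -/
theorem exists_level_null [IsFiniteMeasure μ] {J : Type*} [Countable J] {ψ : J → α → ℝ}
    (hψ : ∀ j, Measurable (ψ j)) {a b : ℝ} (hab : a < b) :
    ∃ t ∈ Set.Ioo a b, ∀ j, ∀ᵐ x ∂μ, ψ j x ≠ t := by
  have hc : (⋃ j, {t : ℝ | 0 < μ {x | ψ j x = t}}).Countable :=
    Set.countable_iUnion fun j => Measure.countable_meas_level_set_pos (hψ j)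
  have hnot : ¬ Set.Ioo a b ⊆ ⋃ j, {t : ℝ | 0 < μ {x | ψ j x = t}} := fun h =>
    absurd (Cardinal.Real.Ioo_countable_iff.1 (hc.mono h)) (not_le.2 hab)
  obtain ⟨t, ht, hn⟩ := Set.not_subset.1 hnot
  refine ⟨t, ht, fun j => ?_⟩
  rw [Set.mem_iUnion, not_exists] at hn
  have := hn j
  rw [ae_iff]
  simpa using this

variable [MeasurableSpace ι] [MeasurableSingletonClass ι]

theorem condEntropy_lt_top [Finite ι] (h𝒮 : 𝒮 ≤ mα) [IsProbabilityMeasure μ] {ξ : α → ι}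
    (hξ : Measurable ξ) : condEntropy 𝒮 μ ξ < ∞ := by
  have := Fintype.ofFinite ι
  obtain ⟨a⟩ : Nonempty α := nonempty_of_isProbabilityMeasure μ
  have : Nonempty ι := ⟨ξ a⟩
  rw [condEntropy_eq_relCost h𝒮 hξ]
  refine (relCost_le (p := fun _ _ _ => (Fintype.card ι : ℝ≥0∞)⁻¹)
    ⟨fun _ _ => measurable_const, fun _ _ => ?_⟩).trans_lt ?_
  · rw [tsum_fintype, Finset.sum_const, Finset.card_univ, nsmul_eq_mul]
    exact ENNReal.mul_inv_le_one _
  · rw [lintegral_const, measure_univ, mul_one, codeLen_inv_natCast Fintype.card_ne_zero]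
    exact ENNReal.ofReal_lt_top

theorem partitionEntropy_lt_top [Finite ι] (h𝒮 : 𝒮 ≤ mα) [IsProbabilityMeasure μ]
    {f : α → α} (hf : MeasurePreserving f μ μ) (hf𝒮 : Measurable[𝒮, 𝒮] f) {ξ : α → ι}
    (hξ : Measurable ξ) : partitionEntropy 𝒮 μ f ξ < ∞ := by
  refine (partitionEntropy_le_div h𝒮 hf hf𝒮 hξ one_ne_zero).trans_lt ?_
  rw [Nat.cast_one, div_one]
  exact condEntropy_lt_top h𝒮 (measurable_itinerary hf.measurable hξ 1)

variable [Countable ι] [Countable κ] [MeasurableSpace κ] [MeasurableSingletonClass κ]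

theorem condEntropy_comp_le (h𝒮 : 𝒮 ≤ mα) [IsProbabilityMeasure μ] {ξ : α → ι}
    (hξ : Measurable ξ) (g : ι → κ) : condEntropy 𝒮 μ (g ∘ ξ) ≤ condEntropy 𝒮 μ ξ := by
  rw [condEntropy_eq_relCost h𝒮 hξ,
    condEntropy_eq_relCost h𝒮 (((measurable_of_countable g).comp hξ : Measurable (g ∘ ξ)))]
  exact relCost_comp_le _ _ _

theorem partitionEntropy_comp_le (h𝒮 : 𝒮 ≤ mα) [IsProbabilityMeasure μ] {f : α → α}
    (hf : Measurable f) {ξ : α → ι} (hξ : Measurable ξ) (g : ι → κ) :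
    partitionEntropy 𝒮 μ f (g ∘ ξ) ≤ partitionEntropy 𝒮 μ f ξ := by
  refine limsup_le_limsup (Eventually.of_forall fun n => ENNReal.div_le_div_right ?_ _)
  exact condEntropy_comp_le h𝒮 (measurable_itinerary hf hξ n) fun (w : Fin n → ι) i => g (w i)

theorem partitionEntropy_le_systemEntropy [Finite ι] (h𝒮 : 𝒮 ≤ mα) [IsProbabilityMeasure μ]
    {f : α → α} (hf : Measurable f) {ξ : α → ι} (hξ : Measurable ξ) :
    partitionEntropy 𝒮 μ f ξ ≤ systemEntropy 𝒮 μ f := by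
  obtain ⟨a⟩ : Nonempty α := nonempty_of_isProbabilityMeasure μ
  have : Nonempty ι := ⟨ξ a⟩
  -- The supremum defining the system entropy ranges over labellings by `ℕ`, so `ι` is encoded
  -- injectively and decoded again.
  obtain ⟨enc, henc⟩ := exists_injective_nat ι
  have hm : Measurable (enc ∘ ξ) := (measurable_of_countable enc).comp hξ
  have h : partitionEntropy 𝒮 μ f (Function.invFun enc ∘ enc ∘ ξ) ≤
      partitionEntropy 𝒮 μ f (enc ∘ ξ) := partitionEntropy_comp_le h𝒮 hf hm _
  rw [← Function.comp_assoc, Function.invFun_comp henc, Function.id_comp] at h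
  refine h.trans (le_iSup_of_le (enc ∘ ξ) (le_iSup_of_le hm (le_iSup_of_le ?_ le_rfl)))
  exact (condEntropy_comp_le h𝒮 hξ enc).trans_lt (condEntropy_lt_top h𝒮 hξ)

end Relabel

namespace BundleRDS

variable {Ω : Type*} [MeasurableSpace Ω] {P : Measure Ω} {θ : Ω → Ω}
  {X : Type*} [TopologicalSpace X] [MeasurableSpace X]
  {Y : Type*} [TopologicalSpace Y] [TopologicalSpace.PseudoMetrizableSpace Y] [MeasurableSpace Y]
  [BorelSpace Y]

/-- Upper semicontinuity of the entropy of partitions into level sets of random continuous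
functions, at measures not charging the level. -/
theorem limsup_partitionEntropy_levelLabel_le [IsProbabilityMeasure P]
    (hθ : MeasurePreserving θ P P) (S : BundleRDS P θ Y) (T : BundleRDS P θ X)
    (m : (S.prod T).InvMeasure) {J : Type*} [Fintype J] {ψ : J → (S.prod T).carrier → ℝ}
    (hψ : ∀ j, (S.prod T).IsBoundedCarath (ψ j)) {t : ℝ}
    (ht : ∀ j, ∀ᵐ z ∂m.toMeasure, ψ j z ≠ t) :
    limsup (fun μ : (S.prod T).InvMeasure => partitionEntropy (leftSigma S T) μ.toMeasure
      (S.prod T).skew (levelLabel ψ t)) (𝓝 m) ≤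
    partitionEntropy (leftSigma S T) m.toMeasure (S.prod T).skew (levelLabel ψ t) := by
  have hm := isProbabilityMeasure_toMeasure m
  have h𝒮 := leftSigma_le S T
  have hskew := (S.prod T).measurable_skew hθ.measurable
  have hlab := measurable_levelLabel (fun j => (hψ j).measurable) t
  refine (limsup_le_iff' (by isBoundedDefault) (by isBoundedDefault)).2 fun c hc => ?_
  -- One length `N` with normalized entropy below `c` at `m` suffices, since the entropy of nearby
  -- measures is bounded by their value at this `N`.
  obtain ⟨N, hNc, hN⟩ := ((eventually_lt_of_limsup_lt hc).and (eventually_ge_atTop 1)).exists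
  have hN0 : N ≠ 0 := Nat.one_le_iff_ne_zero.1 hN
  have hN0' : (N : ℝ≥0∞) ≠ 0 := by exact_mod_cast hN0
  have hNtop : (N : ℝ≥0∞) ≠ ∞ := ENNReal.natCast_ne_top N
  -- The itinerary of length `N` is, up to currying, the level labelling of the functions composed
  -- with iterates. By invariance of `m` their level `t` is null as well.
  let Ψ : Fin N × J → (S.prod T).carrier → ℝ := fun p z => ψ p.2 ((S.prod T).skew^[p.1] z)
  have hΨ : ∀ p, (S.prod T).IsBoundedCarath (Ψ p) := fun p =>
    (hψ p.2).comp_skew_iterate hθ (p.1 : ℕ)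
  have hΨt : ∀ p, ∀ᵐ z ∂m.toMeasure, Ψ p z ≠ t := fun p =>
    (m.invariant.iterate p.1).quasiMeasurePreserving.ae (ht p.2)
  have hcurry : itinerary (S.prod T).skew (levelLabel ψ t) N =
      (fun (b : Fin N × J → Bool) i j => b (i, j)) ∘ levelLabel Ψ t := rfl
  have huncurry : levelLabel Ψ t = (fun (b : Fin N → J → Bool) p => b p.1 p.2) ∘
      itinerary (S.prod T).skew (levelLabel ψ t) N := rfl
  have hlt : condEntropy (leftSigma S T) m.toMeasure (levelLabel Ψ t) < c * N := by
    rw [huncurry]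
    refine (condEntropy_comp_le h𝒮 (measurable_itinerary hskew hlab N) _).trans_lt ?_
    exact (ENNReal.div_lt_iff (Or.inl hN0') (Or.inl hNtop)).1 hNc
  filter_upwards [eventually_condEntropy_levelLabel_lt S T m hΨ hΨt hlt] with μ hμ
  have hμp := isProbabilityMeasure_toMeasure μ
  refine (partitionEntropy_le_div h𝒮 μ.invariant
    (measurable_leftSigma_skew S T hθ.measurable) hlab hN0).trans ?_
  refine ENNReal.div_le_of_le_mul (le_trans ?_ hμ.le)
  rw [hcurry]
  exact condEntropy_comp_le h𝒮 (measurable_levelLabel (fun p => (hΨ p).measurable) t) _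

end BundleRDS

/-! ### Partitions subordinate to an open random cover, and the main inequality -/

namespace BundleRDS

variable {Ω : Type*} [MeasurableSpace Ω] {P : Measure Ω} {θ : Ω → Ω}
  {X : Type*} [MetricSpace X] [CompactSpace X] [MeasurableSpace X] [BorelSpace X]
  {Y : Type*} [TopologicalSpace Y] [TopologicalSpace.PseudoMetrizableSpace Y] [MeasurableSpace Y]
  [BorelSpace Y]

/-- Every open random cover `Q` admits a finite partition, upper semicontinuous in entropy at `m`,
with respect to which the remaining entropy is controlled by the cover. -/
theorem exists_partition_of_cover [IsProbabilityMeasure P] [P.IsComplete]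
    (hθ : MeasurePreserving θ P P) (T : BundleRDS P θ X) (S : BundleRDS P θ Y)
    (m : (S.prod T).InvMeasure) {l : ℕ} {Q : Fin l → Set T.carrier}
    (hQ : T.IsOpenRandomCover Q) :
    ∃ ξ : (S.prod T).carrier → Fin l → Bool, Measurable ξ ∧
      limsup (fun μ : (S.prod T).InvMeasure =>
        partitionEntropy (leftSigma S T) μ.toMeasure (S.prod T).skew ξ) (𝓝 m) ≤
        partitionEntropy (leftSigma S T) m.toMeasure (S.prod T).skew ξ ∧
      ∀ μ : (S.prod T).InvMeasure, (S.prod T).relEntropy (leftSigma S T) μ ≤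
        partitionEntropy (leftSigma S T) μ.toMeasure (S.prod T).skew ξ +
          ⨆ (k : ℕ) (R : Fin k → Set T.carrier) (_ : T.IsOpenRandomCover R),
            T.tailEntropyCovers R Q := by
  classical
  have hm := isProbabilityMeasure_toMeasure m
  have h𝒮 := leftSigma_le S T
  have hskew := (S.prod T).measurable_skew hθ.measurable
  obtain ⟨φ, hφ, hφQ, hφ1⟩ := exists_partition_of_unity T hQ
  let ψ : Fin l → (S.prod T).carrier → ℝ := fun j z => φ j (projRight S T z)
  have hψ : ∀ j, (S.prod T).IsBoundedCarath (ψ j) := fun j => (hφ j).comp_projRight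
  obtain ⟨z₀⟩ : Nonempty (S.prod T).carrier := nonempty_of_isProbabilityMeasure m.toMeasure
  obtain ⟨j₀, -⟩ : ∃ j, projRight S T z₀ ∈ Q j := by
    have : projRight S T z₀ ∈ ⋃ j, Q j := hQ.cover ▸ Set.mem_univ _
    exact Set.mem_iUnion.1 this
  have hl : (0 : ℝ) < l := by exact_mod_cast (Fin.pos j₀)
  -- Below `1 / l`, since `l` numbers with sum `1` cannot all be at most `t`; positive, so that
  -- exceeding `t` implies membership in `Q j`.
  obtain ⟨t, ⟨ht0, htl⟩, ht⟩ :=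
    exists_level_null (μ := m.toMeasure) (fun j => (hψ j).measurable) (inv_pos.2 hl)
  have hlab := measurable_levelLabel (fun j => (hψ j).measurable) t
  refine ⟨levelLabel ψ t, hlab, limsup_partitionEntropy_levelLabel_le hθ S T m hψ ht,
    fun μ => ?_⟩
  have hμ := isProbabilityMeasure_toMeasure μ
  -- The default `j₀` is used only on a null set.
  let dec : (Fin l → Bool) → Fin l := fun b => if h : ∃ j, b j = true then h.choose else j₀
  have hdec : ∀ᵐ z ∂μ.toMeasure, projRight S T z ∈ Q ((dec ∘ levelLabel ψ t) z) := by
    filter_upwards [ae_of_ae_base μ hφ1] with z hz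
    have hsum : ∑ j, ψ j z = 1 := hz ⟨z.1.2.2, z.2.2⟩
    have hex : ∃ j, levelLabel ψ t z j = true := by
      by_contra! hcon
      have hle : ∀ j, ψ j z ≤ t := fun j => by
        have := hcon j
        simpa [levelLabel] using this
      have h1 : ∑ j, ψ j z ≤ ∑ _j : Fin l, t := Finset.sum_le_sum fun j _ => hle j
      rw [hsum, Finset.sum_const, Finset.card_univ, Fintype.card_fin, nsmul_eq_mul] at h1
      have h2 : (l : ℝ) * t < l * (l : ℝ)⁻¹ := mul_lt_mul_of_pos_left htl hl
      rw [mul_inv_cancel₀ hl.ne'] at h2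
      linarith
    have hval : (dec ∘ levelLabel ψ t) z = hex.choose := dif_pos hex
    rw [hval]
    have hlt : t < ψ hex.choose z := by
      have := hex.choose_spec
      simpa [levelLabel] using this
    exact hφQ _ _ (ht0.trans hlt)
  refine (relEntropy_le_partitionEntropy_add hθ.measurable T S μ (fun j => hQ.measurableSet j)
    ((measurable_of_countable dec).comp hlab) hdec).trans ?_
  exact add_le_add (partitionEntropy_comp_le h𝒮 hskew hlab dec) le_rfl

theorem entropyDefect_le_tailEntropy [IsProbabilityMeasure P] [P.IsComplete]
    (hθ : MeasurePreserving θ P P) (T : BundleRDS P θ X) (S : BundleRDS P θ Y)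
    (m : (S.prod T).InvMeasure) :
    (S.prod T).entropyDefect (leftSigma S T) m ≤ T.tailEntropy := by
  have hm := isProbabilityMeasure_toMeasure m
  have h𝒮 := leftSigma_le S T
  refine le_iInf fun l => le_iInf fun Q => le_iInf fun hQ => ?_
  obtain ⟨ξ, hξ, husc, hle⟩ := exists_partition_of_cover hθ T S m hQ
  unfold entropyDefect
  split_ifs with hfin
  · rw [tsub_le_iff_left]
    refine (limsup_le_limsup (Eventually.of_forall hle)).trans ?_
    refine (limsup_add_le_ennreal _ _).trans (add_le_add (husc.trans ?_) (limsup_const _).le)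
    exact partitionEntropy_le_systemEntropy h𝒮 m.invariant.measurable hξ
  -- With infinite entropy at `m`, the comparison bound at `m` itself makes the supremum over `R`
  -- infinite, as the finite partition has finite entropy.
  · have h := hle m
    rw [not_lt_top_iff.1 hfin, top_le_iff, ENNReal.add_eq_top] at h
    exact (h.resolve_left (partitionEntropy_lt_top h𝒮 m.invariant
      (measurable_leftSigma_skew S T hθ.measurable) hξ).ne).ge

end BundleRDS

end

end RandomBundle

theorem theorem2p1 {Ω X Y : Type*} [MeasurableSpace Ω]
    [MetricSpace X] [CompactSpace X] [MeasurableSpace X] [BorelSpace X]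
    [MetricSpace Y] [CompactSpace Y] [MeasurableSpace Y] [BorelSpace Y]
    (P : MeasureTheory.Measure Ω) [MeasureTheory.IsProbabilityMeasure P] [P.IsComplete]
    (θ : Ω → Ω) (hθ : MeasureTheory.MeasurePreserving θ P P)
    (T : RandomBundle.BundleRDS P θ X) (S : RandomBundle.BundleRDS P θ Y)
    (m : (S.prod T).InvMeasure) :
    (S.prod T).entropyDefect (RandomBundle.BundleRDS.leftSigma S T) m ≤ T.tailEntropy :=
  RandomBundle.BundleRDS.entropyDefect_le_tailEntropy hθ T S m
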